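/- **Setting.** Jobs $0,1,2,\dots$ with sizes $p_j\ge 0$ arrive one by one and must always be assigned to $m\ge1$ identical machines; the goal is to maximize the minimum machine load. $\mathrm{OPT}$ denotes the best possible minimum load for the jobs that have arrived. An online algorithm is $\alpha$-competitive if after every arrival its minimum load is at least $\mathrm{OPT}/\alpha$. It has migration factor $\beta$ if on the arrival of each job $j^*$ the total size of the old jobs whose machine changes is at most $\beta p_{j^*}$. **Algorithm (Online jump-optimality), accuracy $\delta=1/N$, $N\ge2$ an integer.** On the arrival of $j^*$, with current schedule $\mathcal S$ (initially empty): 1. Replace every $p_j>0$ by $\tilde p_j=2^{e}+\left\lfloor\frac{p_j-2^{e}}{\delta 2^{e}}\right\rfloor\delta 2^{e}$, where $e\in\mathbb Z$ and $2^{e}\le p_j<2^{e+1}$ (and $\tilde p_j=0$ if $p_j=0$). All loads below refer to $\tilde p$. 2. Let $\tau$ be the minimum load of the LPT (largest processing time first) schedule of all jobs including $j^*$, $UB=2\tau$, and let $\ell$ be the least integer with $\delta\,UB\le 2^\ell$. A job is small if $\tilde p_j<2^\ell$ (no job is small if $UB=0$). 3. If $j^*$ is small, assign it to a least loaded machine and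 stop. Otherwise set $\mathcal S'=\mathcal S$, $Q_B=\{j^*\}$, $Q_s=\emptyset$, and let $\mathcal S'_B$ be the restriction of $\mathcal S'$ to the jobs that are not small. 4. While $Q_B\ne\emptyset$: remove a largest job $j$ from $Q_B$; in $\mathcal S'_B$ apply Push to $j$ and a least loaded machine $m^*$ of $\mathcal S'_B$, i.e. put $j$ on $m^*$ and then go through the jobs $k$ that were on $m^*$ before, taking $k$ out whenever the current load of $m^*$ minus $\tilde p_k$ exceeds the current minimum load. Change $\mathcal S'$ so that it agrees with $\mathcal S'_B$ on the jobs that are not small. While $m^*$ contains a small job and has load in $\mathcal S'$ greater than the minimum load of $\mathcal S'$ plus $2^\ell$, move a smallest job of $m^*$ to $Q_s$. Add the jobs taken out by Push to $Q_B$. 5. Assign the jobs of $Q_s$ by list scheduling (in any order, each to a machine that is least loaded at that moment), and return $\mathcal S'$. Ties and orders of traversal are resolved arbitrarily; a *run* is any way of resolving them. **Theorem.** There are constants $C,c>0$ and a polynomial $P$ such that: * *Polynomial time.* For every $N\ge 2$ and on every input (sizes and any schedule of the previous jobs), every run on the arrival of a job halts with a schedule of all jobs; if the sizes are rational, it takes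 at most $P(\text{input size})$ steps, where the input size is $m$ plus the number of jobs plus the number of bits of $N$ and of the sizes, and arithmetic operations are charged by the bit lengths of their operands. * *Competitiveness.* For every $\varepsilon\in(0,1]$ and every integer $N\ge\max\{2,C/\varepsilon\}$, every run of the algorithm with accuracy $\delta=1/N$ is $(1.7+\varepsilon)$-competitive. * *Migration.* For every $N\ge2$, every run of the algorithm with accuracy $\delta=1/N$ has migration factor at most $C/\delta$. * *Lower bound.* For every $N\ge2$ there are a sequence of jobs of positive size, a number of machines and a run of the algorithm with accuracy $\delta=1/N$, started from the empty schedule, in which on some arrival of a job $j^*$ old jobs of total size at least $(c/\delta)\,p_{j^*}$ change their machine. In particular, for $\varepsilon\in(0,1]$ and $N=\max\{2,\lceil C/\varepsilon\rceil\}$ the algorithm is a polynomial-time $(1.7+\varepsilon)$-competitive algorithm with migration factor $O(1/\varepsilon)$, and there are instances on which it uses migration factor $\Omega(1/\varepsilon)$. -/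

import Mathlib

namespace MachineCovering

/-! ### The problem: jobs `0, 1, 2, …` arrive in this order, job `j` has size `p j` -/

/-- A (partial) assignment of jobs to `m` machines; `none` means "not assigned". -/
abbrev Sched (m : ℕ) := ℕ → Option (Fin m)

/-- `S` assigns exactly the jobs `0, …, t - 1`, i.e. it is a schedule for the first `t` jobs. -/
def IsSchedule {m : ℕ} (t : ℕ) (S : Sched m) : Prop := ∀ j, (S j).isSome ↔ j < t

/-- Load of machine `i` under sizes `p`, counting the first `t` jobs. -/
noncomputable def load {m : ℕ} (p : ℕ → ℝ) (t : ℕ) (S : Sched m) (i : Fin m) : ℝ :=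
  ∑ j ∈ Finset.range t, if S j = some i then p j else 0

/-- Load of a least loaded machine. -/
noncomputable def minLoad {m : ℕ} (p : ℕ → ℝ) (t : ℕ) (S : Sched m) : ℝ :=
  ⨅ i : Fin m, load p t S i

/-- The optimal (offline) minimum load for the first `t` jobs on `m` machines. -/
noncomputable def opt (p : ℕ → ℝ) (t m : ℕ) : ℝ :=
  ⨆ A : Fin t → Fin m, ⨅ i : Fin m, ∑ j : Fin t, if A j = i then p j else 0

/-- Total size of those of the first `t` jobs whose machine differs in `S` and `S'`. -/
noncomputable def migrated {m : ℕ} (p : ℕ → ℝ) (t : ℕ) (S S' : Sched m) : ℝ :=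
  ∑ j ∈ Finset.range t, if S j = S' j then 0 else p j

/-! ### The cost model

A random access machine with bit costs: one tick per elementary memory or list operation, and a
quadratic charge in the bit lengths of the operands for every arithmetic operation or comparison.
Whenever the algorithm leaves a choice open (ties, orders of traversal), it takes the element
named by the next entry of an arbitrary stream of choices; quantifying over all streams means
quantifying over all runs. -/

open Classical in
/-- Bit length of numerator and denominator for a rational number (and `0` for an irrational). -/
noncomputable def bitLength (x : ℝ) : ℕ :=
  if h : ∃ q : ℚ, (q : ℝ) = x then h.choose.num.natAbs.size + h.choose.den.size else 0

structure RunState where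
  /-- ticks used so far -/
  time : ℕ
  /-- resolution of the choices still to come -/
  choices : ℕ → ℕ

/-- Programs; the result `none` stands for a crash or an exceeded cap on loop iterations. -/
abbrev Prog (α : Type) := StateT RunState Option α

def tick (c : ℕ) : Prog Unit := fun r => some ((), { r with time := r.time + c })

/-- Arbitrary choice of an element of a list; crashes on the empty list. -/
def choose {α : Type} (l : List α) : Prog α := fun r =>
  match l[r.choices 0 % l.length]? with
  | some a => some (a, { time := r.time + 1, choices := fun k => r.choices (k + 1) })
  | none => none

noncomputable def opCost (x y : ℝ) : ℕ := (1 + bitLength x + bitLength y) ^ 2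

noncomputable def add (x y : ℝ) : Prog ℝ := do tick (opCost x y); pure (x + y)
noncomputable def sub (x y : ℝ) : Prog ℝ := do tick (opCost x y); pure (x - y)
noncomputable def mul (x y : ℝ) : Prog ℝ := do tick (opCost x y); pure (x * y)
noncomputable def div (x y : ℝ) : Prog ℝ := do tick (opCost x y); pure (x / y)
noncomputable def floor (x : ℝ) : Prog ℝ := do tick (opCost x 0); pure (⌊x⌋ : ℝ)
noncomputable def leq (x y : ℝ) : Prog Bool := do tick (opCost x y); pure (decide (x ≤ y))
noncomputable def lt (x y : ℝ) : Prog Bool := do tick (opCost x y); pure (decide (x < y))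

/-- For `x > 0`: the largest power of two (integer exponent) that is at most `x`. -/
noncomputable def pow2Floor (x : ℝ) : Prog ℝ := do tick (opCost x 0); pure ((2 : ℝ) ^ Int.log 2 x)

/-- For `x > 0`: the smallest power of two (integer exponent) that is at least `x`. -/
noncomputable def pow2Ceil (x : ℝ) : Prog ℝ := do tick (opCost x 0); pure ((2 : ℝ) ^ Int.clog 2 x)

/-- The elements of a list that pass a test. -/
def filterP {α : Type} (test : α → Prog Bool) : List α → Prog (List α)
  | [] => pure []
  | a :: l => do
    tick 1
    let b ← test a
    let r ← filterP test l
    pure (if b then a :: r else r)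

/-- `arrange l.length l` lists the jobs of `l` in an arbitrary order. -/
def arrange : ℕ → List ℕ → Prog (List ℕ)
  | 0, _ => pure []
  | c + 1, l => do
    let k ← choose l
    tick l.length
    let r ← arrange c (l.erase k)
    pure (k :: r)

/-- Write one entry of the array that holds the assignment. -/
def assign {m : ℕ} (S : Sched m) (j : ℕ) (o : Option (Fin m)) : Prog (Sched m) := do
  tick 1
  pure (Function.update S j o)

/-! ### Subroutines; `q` is the array of rounded sizes, `n` the number of jobs present -/

/-- Round the size `x` down to `2 ^ e + k * (1 / N) * 2 ^ e`, where `2 ^ e ≤ x < 2 ^ (e + 1)` and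
`k` is an integer; a job of size `0` keeps its size. -/
noncomputable def roundSize (N : ℕ) (x : ℝ) : Prog ℝ := do
  if ← leq x 0 then
    pure 0
  else
    let b ← pow2Floor x
    let g ← div b N
    let d ← sub x b
    let r ← div d g
    let k ← floor r
    let z ← mul k g
    add b z

/-- The array of the rounded sizes of the jobs `0, …, n - 1`. -/
noncomputable def roundAll (N n : ℕ) (p : ℕ → ℝ) : Prog (ℕ → ℝ) :=
  (List.range n).foldlM
    (fun q j => do
      tick 1
      let x ← roundSize N (p j)
      pure (Function.update q j x))
    (fun _ => 0)

noncomputable def computeLoad {m : ℕ} (q : ℕ → ℝ) (n : ℕ) (S : Sched m) (i : Fin m) : Prog ℝ :=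
  (List.range n).foldlM
    (fun a j => do
      tick 1
      if S j = some i then add a (q j) else pure a)
    0

noncomputable def computeMinLoad {m : ℕ} (q : ℕ → ℝ) (n : ℕ) (S : Sched m) : Prog ℝ :=
  match List.finRange m with
  | [] => failure
  | i :: l => do
    let a ← computeLoad q n S i
    l.foldlM
      (fun x i' => do
        let y ← computeLoad q n S i'
        if ← leq x y then pure x else pure y)
      a

/-- Some machine of minimum load. -/
noncomputable def leastLoaded {m : ℕ} (q : ℕ → ℝ) (n : ℕ) (S : Sched m) : Prog (Fin m) := do
  let x ← computeMinLoad q n S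
  let l ← filterP (fun i => do
    let y ← computeLoad q n S i
    leq y x) (List.finRange m)
  choose l

/-- Some job of maximum size in a list. -/
noncomputable def largest (q : ℕ → ℝ) : List ℕ → Prog ℕ
  | [] => failure
  | a :: l => do
    let b ← l.foldlM (fun b k => do if ← leq (q k) (q b) then pure b else pure k) a
    let c ← filterP (fun k => leq (q b) (q k)) (a :: l)
    choose c

/-- Some job of minimum size in a list. -/
noncomputable def smallest (q : ℕ → ℝ) : List ℕ → Prog ℕ
  | [] => failure
  | a :: l => do
    let b ← l.foldlM (fun b k => do if ← leq (q b) (q k) then pure b else pure k) a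
    let c ← filterP (fun k => leq (q k) (q b)) (a :: l)
    choose c

/-- The jobs that `S` assigns to machine `i`. -/
def jobsOn {m : ℕ} (n : ℕ) (S : Sched m) (i : Fin m) : Prog (List ℕ) :=
  filterP (fun j => pure (decide (S j = some i))) (List.range n)

/-- Minimum load of the schedule built by the rule "largest processing time first". -/
noncomputable def lptMinLoad (m : ℕ) (q : ℕ → ℝ) (n : ℕ) : Prog ℝ := do
  let S ← (List.range n).foldlM
    (fun (S : Sched m) _ => do
      let rest ← filterP (fun j => pure (decide (S j = none))) (List.range n)
      let j ← largest q rest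
      let i ← leastLoaded q n S
      assign S j (some i))
    (fun _ => none)
  computeMinLoad q n S

/-- The number `2 ^ ℓ` that separates small jobs from the others, where `ℓ` is the least integer
with `(1 / N) * UB ≤ 2 ^ ℓ`; if `UB = 0`, no job is small. -/
noncomputable def threshold (N : ℕ) (UB : ℝ) : Prog ℝ := do
  if ← leq UB 0 then
    pure 0
  else
    let x ← div UB N
    pow2Ceil x

/-- The restriction of `S` to the jobs that are not small. -/
noncomputable def bigPart {m : ℕ} (q : ℕ → ℝ) (n : ℕ) (h : ℝ) (S : Sched m) : Prog (Sched m) :=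
  (List.range n).foldlM
    (fun T j => do if ← lt (q j) h then assign T j none else assign T j (S j))
    (fun _ => none)

/-- Overwrite the assignment of the jobs that are not small in `S` by the one in `SB`. -/
noncomputable def copyBig {m : ℕ} (q : ℕ → ℝ) (n : ℕ) (h : ℝ) (SB S : Sched m) :
    Prog (Sched m) :=
  (List.range n).foldlM
    (fun T j => do if ← lt (q j) h then pure T else assign T j (SB j))
    S

/-- Push: put job `j` on machine `i`, then run through the jobs that were on `i` before, and take
out every job `k` with `load i - q k > min load` at that moment. Returns the list of jobs taken out
and the new schedule. -/
noncomputable def push {m : ℕ} (q : ℕ → ℝ) (n : ℕ) (S : Sched m) (i : Fin m) (j : ℕ) :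
    Prog (List ℕ × Sched m) := do
  let old ← jobsOn n S i
  let order ← arrange old.length old
  let S₁ ← assign S j (some i)
  order.foldlM
    (fun (Q, T) k => do
      let a ← computeLoad q n T i
      let d ← sub a (q k)
      let x ← computeMinLoad q n T
      if ← lt x d then
        let T' ← assign T k none
        pure (k :: Q, T')
      else
        pure (Q, T))
    ([], S₁)

/-- While machine `i` contains a small job and has load more than `min load + h`, take out a
smallest job from it and put it into `Qs`. The first argument caps the number of iterations:
`Halts` below asks for some sufficient cap, which is the meaning of the loop without a cap. -/
noncomputable def shedSmall {m : ℕ} (q : ℕ → ℝ) (n : ℕ) (h : ℝ) (i : Fin m) :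
    ℕ → Sched m → List ℕ → Prog (Sched m × List ℕ)
  | 0, _, _ => failure
  | cap + 1, S, Qs => do
    tick 1
    let jobs ← jobsOn n S i
    let small ← filterP (fun k => lt (q k) h) jobs
    let a ← computeLoad q n S i
    let x ← computeMinLoad q n S
    let y ← add x h
    let above ← lt y a
    if !small.isEmpty && above then
      let k ← smallest q jobs
      tick jobs.length
      let S' ← assign S k none
      shedSmall q n h i cap S' (k :: Qs)
    else
      pure (S, Qs)

/-- The main loop: as long as the set `QB` of unassigned jobs that are not small is nonempty, insert
a largest one of them, by Push, on a least loaded machine of the schedule `SB` of the jobs that are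
not small. The first argument caps the number of iterations, as before. -/
noncomputable def insertBig {m : ℕ} (q : ℕ → ℝ) (n : ℕ) (h : ℝ) :
    ℕ → Sched m → Sched m → List ℕ → List ℕ → Prog (Sched m × List ℕ)
  | 0, _, _, _, _ => failure
  | cap + 1, S, SB, QB, Qs => do
    tick 1
    if QB.isEmpty then
      pure (S, Qs)
    else
      let j ← largest q QB
      tick QB.length
      let i ← leastLoaded q n SB
      let (Q, SB') ← push q n SB i j
      let S₁ ← copyBig q n h SB' S
      let (S₂, Qs') ← shedSmall q n h i cap S₁ Qs
      tick Q.length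
      insertBig q n h cap S₂ SB' (Q ++ QB.erase j) Qs'

/-- List scheduling: assign the jobs of `l`, in an arbitrary order, each to some machine that is
least loaded at that moment. -/
noncomputable def listSchedule {m : ℕ} (q : ℕ → ℝ) (n : ℕ) (S : Sched m) (l : List ℕ) :
    Prog (Sched m) := do
  let order ← arrange l.length l
  order.foldlM
    (fun T k => do
      let i ← leastLoaded q n T
      assign T k (some i))
    S

/-- Algorithm "Online jump-optimality" with accuracy parameter `1 / N`: given a schedule `S` for the
jobs `0, …, t - 1`, on arrival of job `t`. The argument `cap` is the cap for its loops. -/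
noncomputable def onlineJump {m : ℕ} (cap N : ℕ) (p : ℕ → ℝ) (t : ℕ) (S : Sched m) :
    Prog (Sched m) := do
  let n := t + 1
  let q ← roundAll N n p
  let τ ← lptMinLoad m q n
  let UB ← mul 2 τ
  let h ← threshold N UB
  if ← lt (q t) h then
    let i ← leastLoaded q n S
    assign S t (some i)
  else
    let SB ← bigPart q n h S
    let (S', Qs) ← insertBig q n h cap S SB [t] []
    listSchedule q n S' Qs

/-! ### Runs of the online algorithm -/

/-- With the choices `ω`, the algorithm halts on this input with the schedule `S'` after `T`
ticks. -/
def Halts {m : ℕ} (N : ℕ) (p : ℕ → ℝ) (t : ℕ) (S : Sched m) (ω : ℕ → ℕ) (S' : Sched m)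
    (T : ℕ) : Prop :=
  ∃ (cap : ℕ) (r : RunState),
    onlineJump cap N p t S { time := 0, choices := ω } = some (S', r) ∧ r.time = T

/-- Some run of the algorithm turns `S` into `S'` when job `t` arrives. -/
def Step {m : ℕ} (N : ℕ) (p : ℕ → ℝ) (t : ℕ) (S S' : Sched m) : Prop :=
  ∃ (ω : ℕ → ℕ) (T : ℕ), Halts N p t S ω S' T

/-- `Reaches N p t S`: starting from the empty schedule, some run of the online algorithm has the
schedule `S` after the arrival of the jobs `0, …, t - 1`. -/
inductive Reaches {m : ℕ} (N : ℕ) (p : ℕ → ℝ) : ℕ → Sched m → Prop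
  | zero : Reaches N p 0 (fun _ => none)
  | succ {t : ℕ} {S S' : Sched m} :
      Reaches N p t S → Step N p t S S' → Reaches N p (t + 1) S'

/-- Size of the input on arrival of job `t`. -/
noncomputable def inputSize (m N : ℕ) (p : ℕ → ℝ) (t : ℕ) : ℕ :=
  m + N.size + ∑ j ∈ Finset.range (t + 1), (1 + bitLength (p j))

end MachineCovering

/-!
Write `q` for the rounded sizes, `h` for the threshold for small jobs and `L` for the minimum load.

**Invariant.** After every arrival the schedule is jump-optimal up to `h` (`JumpOpt`): for every
job `k` on a machine `i` we have `load i - q k ≤ L + h`. Push only displaces jobs that are smaller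
than the job it inserts, and lets the others fulfil the inequality; when it leaves small jobs on
the machine, shedding brings the load down to `L + h`. Minimum loads never decrease in the process,
so the inequality is not lost on the other machines (`JumpOpt.iteration`). It also survives the
arrival of a job, because `h` never decreases: the minimum load of an LPT schedule is monotone in
the set of jobs, as one sees from the function that counts the machines of load less than `c`
(`lptValue_mono`).

**Competitiveness.** If `L + h = 1`, there is a weight function such that every machine of a
jump-optimal schedule has weight at most `1`, the least loaded one less than `1`, while a machine
of load at least `1.7` has weight at least `1`; comparing total weights, no schedule has minimum
load `1.7` (`JumpOpt.minLoad_lt_mul`). Since the minimum load of LPT is at least half the optimum,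
`h` is `O(L / N)`, and rounding costs another factor `1 + 1 / N` (`opt_le_of_reaches`).

**Migration.** A push of a job of size `u` displaces jobs of total size less than `u` and sheds
small jobs of total size at most `3 * u`. If one job is displaced, its size is smaller than `u` by
at least `u / (2 * N)`, because sizes are rounded; if several are displaced, all of size at least
`h` and of total size `s`, then the sum of the squares of their sizes is at most `s ^ 2 - h * s`.
Hence a potential that is the sum of a multiple of `N * u` and a multiple of `u ^ 2 / h`, with `u`
in the second term truncated at the upper bound `UB` for the minimum load, pays for all migration
(`Iteration.potential_le`), and it is `O(N * u)` for the new job since `UB ≤ N * h`.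

**Running time.** A job that has been pushed is at least as large as all jobs that are pushed
later, and only smaller jobs are displaced, so it is never displaced; hence there are at most as
many iterations as jobs (`insertBig_spec`). The numbers that occur have denominators of
polynomially many bits and are not too large, so arithmetic is cheap (`exists_polynomial_time`).

**Lower bound.** For large `N`, there is an instance with about `N / 2` machines of almost equal
loads and two jobs on most of them, in which every push but the last displaces exactly one job,
smaller by only `2 / N`, and so the chain of displacements visits all machines
(`ChainState.insertBig_poss`). For small `N` it suffices to force a single migration, which the
invariant does.
-/

namespace MachineCovering

/-! ### Reasoning about programs -/

section Logic

variable {α β γ : Type}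

/-- The choices can be resolved in such a way that `x` returns `a` and leaves any prescribed stream
of choices to the program that follows. -/
def Can (x : Prog α) (a : α) : Prop :=
  ∀ ω' : ℕ → ℕ, ∃ ω : ℕ → ℕ, ∀ s : ℕ, ∃ s' : ℕ, x ⟨s, ω⟩ = some (a, ⟨s', ω'⟩)

/-- Total correctness with a time bound: however the choices are resolved, `x` returns within `c`
ticks a value that satisfies `Q`. The second field, that some value is a possible outcome in the
sense of `Can`, lets one continue a run whose later choices are prescribed. -/
structure Spec (x : Prog α) (c : ℕ) (Q : α → Prop) : Prop where
  total : ∀ r : RunState, ∃ a r', x r = some (a, r') ∧ r'.time ≤ r.time + c ∧ Q a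
  can : ∃ a, Can x a

/-- Some run of `x` returns a value that satisfies `Q`. -/
def Poss (x : Prog α) (Q : α → Prop) : Prop := ∃ a, Can x a ∧ Q a

theorem bind_eq (x : Prog α) (f : α → Prog β) (r : RunState) :
    (x >>= f) r = (x r).bind fun v => f v.1 v.2 := rfl

theorem Can.pure (a : α) : Can (pure a) a := fun ω' => ⟨ω', fun s => ⟨s, rfl⟩⟩

theorem Can.bind {x : Prog α} {f : α → Prog β} {a : α} {b : β} (hx : Can x a)
    (hf : Can (f a) b) : Can (x >>= f) b := by
  intro ω'
  obtain ⟨ω₁, h₁⟩ := hf ω'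
  obtain ⟨ω, h⟩ := hx ω₁
  refine ⟨ω, fun s => ?_⟩
  obtain ⟨s', hs'⟩ := h s
  obtain ⟨s'', hs''⟩ := h₁ s'
  exact ⟨s'', by rw [bind_eq, hs']; exact hs''⟩

theorem Spec.of_run {x : Prog α} {c : ℕ} {Q : α → Prop} (hx : Spec x c Q) {r : RunState} {a : α}
    {r' : RunState} (h : x r = some (a, r')) : Q a := by
  obtain ⟨b, r'', hb, -, hQ⟩ := hx.total r
  rw [h] at hb
  simp only [Option.some.injEq, Prod.mk.injEq] at hb
  exact hb.1 ▸ hQ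

theorem Spec.of_can {x : Prog α} {c : ℕ} {Q : α → Prop} (hx : Spec x c Q) {a : α}
    (h : Can x a) : Q a := by
  obtain ⟨ω, hω⟩ := h fun _ => 0
  obtain ⟨s', hs'⟩ := hω 0
  exact hx.of_run hs'

theorem Spec.poss {x : Prog α} {c : ℕ} {Q : α → Prop} (hx : Spec x c Q) : Poss x Q := by
  obtain ⟨a, ha⟩ := hx.can
  exact ⟨a, ha, hx.of_can ha⟩

theorem Spec.pure {a : α} {Q : α → Prop} (h : Q a) : Spec (pure a) 0 Q :=
  ⟨fun r => ⟨a, r, rfl, le_rfl, h⟩, a, Can.pure a⟩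

theorem Spec.bind {x : Prog α} {f : α → Prog β} {c d : ℕ} {Q : α → Prop} {R : β → Prop}
    (hx : Spec x c Q) (hf : ∀ a, Q a → Spec (f a) d R) : Spec (x >>= f) (c + d) R := by
  refine ⟨fun r => ?_, ?_⟩
  · obtain ⟨a, r', h, ht, hQ⟩ := hx.total r
    obtain ⟨b, r'', h', ht', hR⟩ := (hf a hQ).total r'
    exact ⟨b, r'', by rw [bind_eq, h]; exact h', by omega, hR⟩
  · obtain ⟨a, ha⟩ := hx.can
    obtain ⟨b, hb⟩ := (hf a (hx.of_can ha)).can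
    exact ⟨b, ha.bind hb⟩

theorem Spec.mono {x : Prog α} {c d : ℕ} {Q R : α → Prop} (hx : Spec x c Q) (hc : c ≤ d)
    (hQ : ∀ a, Q a → R a) : Spec x d R :=
  ⟨fun r => by
    obtain ⟨a, r', h, ht, h'⟩ := hx.total r
    exact ⟨a, r', h, ht.trans (by omega), hQ a h'⟩, hx.can⟩

theorem Spec.le {x : Prog α} {c d : ℕ} {Q : α → Prop} (hx : Spec x c Q) (hc : c ≤ d) :
    Spec x d Q := hx.mono hc fun _ h => h

theorem Spec.imp {x : Prog α} {c : ℕ} {Q R : α → Prop} (hx : Spec x c Q)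
    (hQ : ∀ a, Q a → R a) : Spec x c R := hx.mono le_rfl hQ

theorem Spec.ite {P : Prop} [Decidable P] {x y : Prog α} {c : ℕ} {Q : α → Prop}
    (hx : P → Spec x c Q) (hy : ¬P → Spec y c Q) : Spec (if P then x else y) c Q := by
  split_ifs with h
  · exact hx h
  · exact hy h

theorem Poss.bind {x : Prog α} {f : α → Prog β} {Q : α → Prop} {R : β → Prop} (hx : Poss x Q)
    (hf : ∀ a, Q a → Poss (f a) R) : Poss (x >>= f) R := by
  obtain ⟨a, ha, hQ⟩ := hx
  obtain ⟨b, hb, hR⟩ := hf a hQ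
  exact ⟨b, ha.bind hb, hR⟩

theorem Poss.imp {x : Prog α} {Q R : α → Prop} (hx : Poss x Q) (h : ∀ a, Q a → R a) : Poss x R := by
  obtain ⟨a, ha, hQ⟩ := hx
  exact ⟨a, ha, h a hQ⟩

theorem Poss.pure {a : α} {Q : α → Prop} (h : Q a) : Poss (pure a) Q := ⟨a, Can.pure a, h⟩

theorem tick_spec (c : ℕ) : Spec (tick c) c fun _ => True :=
  ⟨fun r => ⟨(), { r with time := r.time + c }, rfl, le_rfl, trivial⟩, (),
    fun ω' => ⟨ω', fun s => ⟨s + c, rfl⟩⟩⟩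

theorem Spec.ret (a : α) : Spec (Pure.pure a) 0 fun b => b = a := Spec.pure rfl

theorem tick_ret_spec {c κ : ℕ} (h : c ≤ κ) (a : α) :
    Spec (do tick c; Pure.pure a) κ fun b => b = a :=
  ((tick_spec c).bind fun _ _ => Spec.ret a).le h

theorem can_choose {l : List α} {a : α} (h : a ∈ l) : Can (choose l) a := by
  intro ω'
  obtain ⟨k, hk, rfl⟩ := List.getElem_of_mem h
  refine ⟨fun i => i.casesOn k ω', fun s => ⟨s + 1, ?_⟩⟩
  have : k % l.length = k := Nat.mod_eq_of_lt hk
  simp [choose, this, hk]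

theorem choose_spec {l : List α} (h : l ≠ []) : Spec (choose l) 1 fun a => a ∈ l := by
  refine ⟨fun r => ?_, l.head h, can_choose (List.head_mem h)⟩
  have hk : r.choices 0 % l.length < l.length := Nat.mod_lt _ (List.length_pos_iff.2 h)
  exact ⟨l[r.choices 0 % l.length], ⟨r.time + 1, fun k => r.choices (k + 1)⟩,
    by simp [choose, List.getElem?_eq_getElem hk], le_rfl,
    List.getElem_mem _⟩

/-- Every result of `x` is a result of `y` with the same choices. -/
def Refines (x y : Prog α) : Prop := ∀ r v, x r = some v → y r = some v

theorem Refines.rfl {x : Prog α} : Refines x x := fun _ _ h => h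

theorem Refines.bind {x y : Prog α} {f g : α → Prog β} (hx : Refines x y)
    (hf : ∀ a, Refines (f a) (g a)) : Refines (x >>= f) (y >>= g) := by
  intro r v h
  rw [bind_eq, Option.bind_eq_some_iff] at h ⊢
  obtain ⟨w, hw, hv⟩ := h
  exact ⟨w, hx _ _ hw, hf _ _ _ hv⟩

theorem Refines.ite {P : Prop} [Decidable P] {x x' y y' : Prog α} (hx : Refines x x')
    (hy : Refines y y') : Refines (if P then x else y) (if P then x' else y') := by
  split_ifs
  · exact hx
  · exact hy

/-- Rule for loops over the first `n` natural numbers. -/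
theorem foldlM_range_spec {f : β → ℕ → Prog β} {c n : ℕ} {s : β} (I : ℕ → β → Prop) (h0 : I 0 s)
    (hf : ∀ j < n, ∀ s, I j s → Spec (f s j) c (I (j + 1))) :
    Spec ((List.range n).foldlM f s) (n * c) (I n) := by
  induction n with
  | zero => exact (Spec.pure h0).le (by simp)
  | succ n ih =>
    rw [List.range_succ, List.foldlM_append]
    refine ((ih fun j hj => hf j (by omega)).bind fun a ha => ?_).le (by rw [Nat.succ_mul])
    have := hf n (by omega) a ha
    simpa using this

/-- Rule for loops over a list; the invariant speaks about the elements still to be visited. -/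
theorem foldlM_spec {f : β → α → Prog β} {c : ℕ} (I : List α → β → Prop) {l : List α} {s : β}
    (h0 : I l s) (hf : ∀ a l s, I (a :: l) s → Spec (f s a) c (I l)) :
    Spec (l.foldlM f s) (l.length * c) (I []) := by
  induction l generalizing s with
  | nil => exact (Spec.pure h0).le (by simp)
  | cons a l ih =>
    rw [List.foldlM_cons]
    exact ((hf a l s h0).bind fun b hb => ih hb).le (by simp [Nat.succ_mul, Nat.add_comm])

theorem filterP_spec {test : α → Prog Bool} {c : ℕ} {P : α → Prop} [DecidablePred P] {l : List α}
    (ht : ∀ a ∈ l, Spec (test a) c fun b => b = decide (P a)) :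
    Spec (filterP test l) (l.length * (1 + c)) fun r => r = l.filter fun a => decide (P a) := by
  induction l with
  | nil => exact (Spec.ret []).le (by simp)
  | cons a l ih =>
    rw [filterP]
    refine ((tick_spec 1).bind fun _ _ => (ht a (by simp)).bind fun b hb =>
      (ih fun a' ha' => ht a' (by simp [ha'])).bind fun r hr => Spec.pure ?_).le
        (by simp [Nat.succ_mul]; omega)
    subst hb hr
    rw [List.filter_cons]

theorem arrange_spec {c : ℕ} {l : List ℕ} (hc : l.length = c) :
    Spec (arrange c l) (c * (1 + c)) fun o => o.Perm l := by
  induction c generalizing l with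
  | zero =>
    rw [arrange]
    exact (Spec.pure (by simp [List.length_eq_zero_iff.1 hc])).le (by simp)
  | succ c ih =>
    rw [arrange]
    have hne : l ≠ [] := by rintro rfl; simp at hc
    refine ((choose_spec hne).bind fun k hk => (tick_spec _).bind fun _ _ =>
      (ih (l := l.erase k) (by rw [List.length_erase_of_mem hk]; omega)).bind fun r hr =>
        Spec.pure ((hr.cons k).trans (List.perm_cons_erase hk).symm)).le ?_
    rw [hc]; nlinarith

theorem assign_spec {m : ℕ} (S : Sched m) (j : ℕ) (o : Option (Fin m)) :
    Spec (assign S j o) 1 fun T => T = Function.update S j o :=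
  tick_ret_spec le_rfl _

section Operations

variable {x y : ℝ} {κ : ℕ} (hκ : opCost x y ≤ κ)
include hκ

theorem add_spec : Spec (add x y) κ fun z => z = x + y :=
  tick_ret_spec hκ _

theorem sub_spec : Spec (sub x y) κ fun z => z = x - y :=
  tick_ret_spec hκ _

theorem mul_spec : Spec (mul x y) κ fun z => z = x * y :=
  tick_ret_spec hκ _

theorem div_spec : Spec (div x y) κ fun z => z = x / y :=
  tick_ret_spec hκ _

theorem leq_spec : Spec (leq x y) κ fun b => b = decide (x ≤ y) :=
  tick_ret_spec hκ _

theorem lt_spec : Spec (lt x y) κ fun b => b = decide (x < y) :=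
  tick_ret_spec hκ _

end Operations

theorem floor_spec {x : ℝ} {κ : ℕ} (hκ : opCost x 0 ≤ κ) :
    Spec (floor x) κ fun z => z = (⌊x⌋ : ℝ) :=
  tick_ret_spec hκ _

theorem pow2Floor_spec {x : ℝ} {κ : ℕ} (hκ : opCost x 0 ≤ κ) :
    Spec (pow2Floor x) κ fun z => z = (2 : ℝ) ^ Int.log 2 x :=
  tick_ret_spec hκ _

theorem pow2Ceil_spec {x : ℝ} {κ : ℕ} (hκ : opCost x 0 ≤ κ) :
    Spec (pow2Ceil x) κ fun z => z = (2 : ℝ) ^ Int.clog 2 x :=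
  tick_ret_spec hκ _

end Logic

theorem shedSmall_refines {m : ℕ} (q : ℕ → ℝ) (n : ℕ) (h : ℝ) (i : Fin m) (c : ℕ) (S : Sched m)
    (Qs : List ℕ) : Refines (shedSmall q n h i c S Qs) (shedSmall q n h i (c + 1) S Qs) := by
  induction c generalizing S Qs with
  | zero => intro r v hv; simp [shedSmall] at hv; cases hv
  | succ c ih =>
    rw [shedSmall, shedSmall]
    refine .bind .rfl fun _ => .bind .rfl fun _ => .bind .rfl fun _ => .bind .rfl fun _ =>
      .bind .rfl fun _ => .bind .rfl fun _ => .bind .rfl fun _ => .ite ?_ .rfl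
    exact .bind .rfl fun _ => .bind .rfl fun _ => .bind .rfl fun _ => ih _ _

theorem insertBig_refines {m : ℕ} (q : ℕ → ℝ) (n : ℕ) (h : ℝ) (c : ℕ) (S SB : Sched m)
    (QB Qs : List ℕ) :
    Refines (insertBig q n h c S SB QB Qs) (insertBig q n h (c + 1) S SB QB Qs) := by
  induction c generalizing S SB QB Qs with
  | zero => intro r v hv; simp [insertBig] at hv; cases hv
  | succ c ih =>
    rw [insertBig, insertBig]
    refine .bind .rfl fun _ => .ite .rfl ?_
    refine .bind .rfl fun _ => .bind .rfl fun _ => .bind .rfl fun _ => .bind .rfl fun ⟨_, _⟩ =>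
      .bind .rfl fun _ => .bind (shedSmall_refines _ _ _ _ _ _ _) fun ⟨_, _⟩ =>
      .bind .rfl fun _ => ih _ _ _ _

theorem onlineJump_refines {m : ℕ} {c c' : ℕ} (hc : c ≤ c') (N : ℕ) (p : ℕ → ℝ) (t : ℕ)
    (S : Sched m) : Refines (onlineJump c N p t S) (onlineJump c' N p t S) := by
  induction c', hc using Nat.le_induction with
  | base => exact .rfl
  | succ c' _ ih =>
    intro r v hv
    refine Refines.bind .rfl (fun _ => .bind .rfl fun _ => .bind .rfl fun _ => .bind .rfl fun _ =>
      .bind .rfl fun _ => .ite .rfl (.bind .rfl fun _ => .bind (insertBig_refines _ _ _ _ _ _ _ _)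
        fun ⟨_, _⟩ => .rfl)) r v (ih r v hv)

/-! ### Loads -/

section Loads

variable {m n : ℕ} {q : ℕ → ℝ} {S T : Sched m}

theorem load_eq_sum_filter (q : ℕ → ℝ) (n : ℕ) (S : Sched m) (i : Fin m) :
    load q n S i = ∑ j ∈ (Finset.range n).filter (fun j => S j = some i), q j := by
  rw [load, Finset.sum_filter]

theorem load_nonneg (hq : ∀ j, 0 ≤ q j) (i : Fin m) : 0 ≤ load q n S i :=
  Finset.sum_nonneg fun j _ => by split_ifs; exacts [hq j, le_rfl]

theorem load_congr {q' : ℕ → ℝ} {i : Fin m} (hq : ∀ j < n, q j = q' j)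
    (hS : ∀ j < n, S j = some i ↔ T j = some i) : load q n S i = load q' n T i := by
  refine Finset.sum_congr rfl fun j hj => ?_
  rw [Finset.mem_range] at hj
  simp only [hq j hj, hS j hj]

theorem load_mono {q' : ℕ → ℝ} (hq : ∀ j < n, q j ≤ q' j) (i : Fin m) :
    load q n S i ≤ load q' n S i := by
  refine Finset.sum_le_sum fun j hj => ?_
  split_ifs
  exacts [hq j (Finset.mem_range.1 hj), le_rfl]

theorem load_le_of_sub (hq : ∀ j, 0 ≤ q j) {i : Fin m}
    (h : ∀ j < n, S j = some i → T j = some i) : load q n S i ≤ load q n T i := by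
  refine Finset.sum_le_sum fun j hj => ?_
  by_cases hS : S j = some i
  · simp [hS, h j (Finset.mem_range.1 hj) hS]
  · rw [if_neg hS]; split_ifs; exacts [hq j, le_rfl]

theorem le_load (hq : ∀ j, 0 ≤ q j) {j : ℕ} (hj : j < n) {i : Fin m} (h : S j = some i) :
    q j ≤ load q n S i := by
  rw [load_eq_sum_filter]
  exact Finset.single_le_sum (f := q) (fun k _ => hq k) (by simp [hj, h])

theorem add_le_load (hq : ∀ j, 0 ≤ q j) {j k : ℕ} (hj : j < n) (hk : k < n) (hjk : j ≠ k)
    {i : Fin m} (h : S j = some i) (h' : S k = some i) : q j + q k ≤ load q n S i := by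
  rw [load_eq_sum_filter, ← Finset.sum_pair hjk]
  refine Finset.sum_le_sum_of_subset_of_nonneg ?_ fun k _ _ => hq k
  intro l hl
  simp only [Finset.mem_insert, Finset.mem_singleton] at hl
  rcases hl with rfl | rfl <;> simp [*]

theorem load_update_some {j : ℕ} (hj : j < n) (h : S j = none) (i i' : Fin m) :
    load q n (Function.update S j (some i)) i' = load q n S i' + if i' = i then q j else 0 := by
  rw [load, load, ← Finset.add_sum_erase _ _ (Finset.mem_range.2 hj),
    ← Finset.add_sum_erase (Finset.range n) _ (Finset.mem_range.2 hj)]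
  have : ∀ k ∈ (Finset.range n).erase j,
      (if Function.update S j (some i) k = some i' then q k else 0)
        = if S k = some i' then q k else 0 := fun k hk => by
    rw [Function.update_of_ne (Finset.ne_of_mem_erase hk)]
  rw [Finset.sum_congr rfl this, Function.update_self, h]
  simp only [Option.some.injEq, reduceCtorEq, if_false, zero_add]
  by_cases hi : i' = i
  · simp [hi, add_comm]
  · simp [hi, Ne.symm hi]

theorem load_update_none {j : ℕ} (hj : j < n) {i : Fin m} (h : S j = some i) (i' : Fin m) :
    load q n (Function.update S j none) i' = load q n S i' - if i' = i then q j else 0 := by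
  have := load_update_some (q := q) (S := Function.update S j none) hj (by simp) i i'
  rw [Function.update_idem, ← h, Function.update_eq_self] at this
  linarith

theorem minLoad_le (q : ℕ → ℝ) (n : ℕ) (S : Sched m) (i : Fin m) :
    minLoad q n S ≤ load q n S i :=
  ciInf_le (Set.finite_range _).bddBelow i

theorem le_minLoad [NeZero m] {c : ℝ} (h : ∀ i, c ≤ load q n S i) : c ≤ minLoad q n S :=
  le_ciInf h

theorem exists_load_eq_minLoad [NeZero m] (q : ℕ → ℝ) (n : ℕ) (S : Sched m) :
    ∃ i, load q n S i = minLoad q n S :=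
  exists_eq_ciInf_of_finite

theorem minLoad_nonneg [NeZero m] (hq : ∀ j, 0 ≤ q j) : 0 ≤ minLoad q n S :=
  le_minLoad fun i => load_nonneg hq i

theorem minLoad_le_minLoad [NeZero m] {q' : ℕ → ℝ} {n' : ℕ}
    (h : ∀ i, minLoad q n S ≤ load q' n' T i) : minLoad q n S ≤ minLoad q' n' T := le_minLoad h

theorem sum_load (q : ℕ → ℝ) (n : ℕ) (S : Sched m) :
    ∑ i, load q n S i = ∑ j ∈ Finset.range n, if (S j).isSome then q j else 0 := by
  unfold load
  rw [Finset.sum_comm]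
  refine Finset.sum_congr rfl fun j _ => ?_
  cases h : S j with
  | none => simp
  | some i => simp [Finset.sum_ite_eq]

theorem sum_load_le (hq : ∀ j, 0 ≤ q j) : ∑ i, load q n S i ≤ ∑ j ∈ Finset.range n, q j := by
  rw [sum_load]
  refine Finset.sum_le_sum fun j _ => ?_
  split_ifs
  exacts [le_rfl, hq j]

theorem sum_load_eq (hS : ∀ j < n, (S j).isSome) :
    ∑ i, load q n S i = ∑ j ∈ Finset.range n, q j := by
  rw [sum_load]
  exact Finset.sum_congr rfl fun j hj => by rw [if_pos (hS j (Finset.mem_range.1 hj))]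

end Loads

/-! ### The subroutines -/

/-- The numbers that occur as operands when the algorithm works with the rounded sizes `q` of `n`
jobs and the threshold `h`. -/
def operands (q : ℕ → ℝ) (n : ℕ) (h : ℝ) : Set ℝ :=
  {x | ∃ A ⊆ Finset.range n, ∃ B ⊆ Finset.range n, ∃ e : ℝ, (e = 0 ∨ e = h) ∧
    x = ∑ j ∈ A, q j - ∑ j ∈ B, q j + e}

/-- Every arithmetic operation on two of the `operands` costs at most `κ` ticks. -/
def Cheap (q : ℕ → ℝ) (n : ℕ) (h : ℝ) (κ : ℕ) : Prop :=
  ∀ x ∈ operands q n h, ∀ y ∈ operands q n h, opCost x y ≤ κ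

section Operands

variable {m n : ℕ} {q : ℕ → ℝ} {h : ℝ}

theorem threshold_mem_operands : h ∈ operands q n h :=
  ⟨∅, by simp, ∅, by simp, h, by simp, by simp⟩

theorem size_mem_operands {j : ℕ} (hj : j < n) : q j ∈ operands q n h :=
  ⟨{j}, by simpa using hj, ∅, by simp, 0, by simp, by simp⟩

theorem filter_range_subset {j : ℕ} (hj : j ≤ n) (P : ℕ → Prop) [DecidablePred P] :
    (Finset.range j).filter P ⊆ Finset.range n :=
  (Finset.filter_subset _ _).trans (Finset.range_subset_range.2 hj)

theorem load_mem_operands {j : ℕ} (hj : j ≤ n) (S : Sched m) (i : Fin m) :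
    load q j S i ∈ operands q n h :=
  ⟨_, filter_range_subset hj (fun k => S k = some i), ∅, by simp, 0, by simp,
    by rw [load_eq_sum_filter]; simp⟩

theorem minLoad_mem_operands [NeZero m] (S : Sched m) : minLoad q n S ∈ operands q n h := by
  obtain ⟨i, hi⟩ := exists_load_eq_minLoad q n S
  exact hi ▸ load_mem_operands le_rfl S i

theorem load_sub_mem_operands {j : ℕ} (hj : j < n) (S : Sched m) (i : Fin m) :
    load q n S i - q j ∈ operands q n h :=
  ⟨_, filter_range_subset le_rfl (fun k => S k = some i), {j}, by simpa using hj, 0, by simp,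
    by rw [load_eq_sum_filter]; simp⟩

theorem minLoad_add_mem_operands [NeZero m] (S : Sched m) :
    minLoad q n S + h ∈ operands q n h := by
  obtain ⟨i, hi⟩ := exists_load_eq_minLoad q n S
  exact ⟨_, filter_range_subset le_rfl (fun k => S k = some i), ∅, by simp, h, by simp,
    by rw [← hi, load_eq_sum_filter]; simp⟩

end Operands

theorem length_le_of_nodup {n : ℕ} {l : List ℕ} (hl : l.Nodup) (h : ∀ k ∈ l, k < n) :
    l.length ≤ n := by
  rw [← List.toFinset_card_of_nodup hl, ← Finset.card_range n]
  exact Finset.card_le_card fun k hk => Finset.mem_range.2 (h k (List.mem_toFinset.1 hk))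

section Subroutines

variable {m n κ : ℕ} {q : ℕ → ℝ} {h : ℝ}

/-- Time bound for `computeLoad`. -/
def loadCost (n κ : ℕ) : ℕ := n * (1 + κ)

/-- Time bound for `computeMinLoad`. -/
def minLoadCost (m n κ : ℕ) : ℕ := loadCost n κ + m * (loadCost n κ + κ)

/-- Time bound for `leastLoaded`. -/
def leastCost (m n κ : ℕ) : ℕ := minLoadCost m n κ + (m * (1 + (loadCost n κ + κ)) + 1)

/-- Time bound for `largest` and `smallest`. -/
def extremeCost (n κ : ℕ) : ℕ := n * κ + (n * (1 + κ) + 1)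

theorem computeLoad_spec (hc : Cheap q n h κ) (S : Sched m) (i : Fin m) :
    Spec (computeLoad q n S i) (loadCost n κ) fun x => x = load q n S i := by
  refine foldlM_range_spec (fun j x => x = load q j S i) (by simp [load]) fun j hj x hx => ?_
  have hs : load q (j + 1) S i = load q j S i + if S j = some i then q j else 0 := by
    simp [load, Finset.sum_range_succ]
  refine (tick_spec 1).bind fun _ _ => .ite (fun hS => ?_) fun hS => ?_
  · refine (add_spec (hc _ ?_ _ (size_mem_operands hj))).imp fun z hz => ?_
    · rw [hx]; exact load_mem_operands hj.le S i
    · rw [hz, hs, if_pos hS, hx]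
  · refine (Spec.ret x).mono (by omega) fun z hz => ?_
    rw [hz, hs, if_neg hS, hx, add_zero]

variable [NeZero m]

theorem computeMinLoad_spec (hc : Cheap q n h κ) (S : Sched m) :
    Spec (computeMinLoad q n S) (minLoadCost m n κ) fun x => x = minLoad q n S := by
  unfold computeMinLoad
  cases hl : List.finRange m with
  | nil => exact absurd (List.finRange_eq_nil_iff.1 hl) (NeZero.ne m)
  | cons i l =>
    have hlen : l.length ≤ m := by
      have := congrArg List.length hl
      simp only [List.length_finRange, List.length_cons] at this
      omega
    refine ((computeLoad_spec hc S i).bind fun a ha => foldlM_spec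
      (c := loadCost n κ + κ)
      (fun r x => (∃ i, x = load q n S i) ∧ ∀ i, i ∉ r → x ≤ load q n S i)
      ⟨⟨i, ha⟩, fun k hk => ?_⟩ fun k r x hx => ?_).mono
        (Nat.add_le_add_left (Nat.mul_le_mul_right _ hlen) _) fun x hx => ?_
    · have : k ∈ i :: l := hl ▸ List.mem_finRange k
      rcases List.mem_cons.1 this with rfl | h'
      · exact ha.le
      · exact absurd h' hk
    · obtain ⟨⟨i₀, hi₀⟩, hx⟩ := hx
      refine (computeLoad_spec hc S k).bind fun y hy =>
        ((leq_spec (hc _ ?_ _ ?_)).bind fun b hb => Spec.ite (c := 0) (fun h1 => ?_)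
          fun h1 => ?_).le (by omega)
      · rw [hi₀]; exact load_mem_operands le_rfl _ _
      · rw [hy]; exact load_mem_operands le_rfl _ _
      · refine Spec.pure ⟨⟨i₀, hi₀⟩, fun i' hi' => ?_⟩
        have hxy : x ≤ y := by simpa [hb] using h1
        by_cases hk : i' = k
        · rw [hk, ← hy]; exact hxy
        · exact hx i' (by simp [hk, hi'])
      · refine Spec.pure ⟨⟨k, hy⟩, fun i' hi' => ?_⟩
        have hxy : y < x := by simpa [hb] using h1
        by_cases hk : i' = k
        · rw [hk, ← hy]
        · exact hxy.le.trans (hx i' (by simp [hk, hi']))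
    · obtain ⟨⟨i₀, hi₀⟩, hx⟩ := hx
      exact le_antisymm (le_minLoad fun i => hx i (by simp)) (hi₀ ▸ minLoad_le q n S i₀)

theorem leastLoaded_filter_spec (hc : Cheap q n h κ) (S : Sched m) :
    Spec (filterP (fun i => do
      let y ← computeLoad q n S i
      leq y (minLoad q n S)) (List.finRange m)) (m * (1 + (loadCost n κ + κ)))
      fun r => r = (List.finRange m).filter fun i => decide (load q n S i ≤ minLoad q n S) := by
  refine (filterP_spec (P := fun i => load q n S i ≤ minLoad q n S) fun i _ =>
    (computeLoad_spec hc S i).bind fun y hy => ?_).le (by rw [List.length_finRange])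
  subst hy
  exact leq_spec (hc _ (load_mem_operands le_rfl _ _) _ (minLoad_mem_operands _))

theorem leastLoaded_spec (hc : Cheap q n h κ) (S : Sched m) :
    Spec (leastLoaded q n S) (leastCost m n κ) fun i => load q n S i = minLoad q n S := by
  refine (computeMinLoad_spec hc S).bind fun x hx => ?_
  subst hx
  refine (leastLoaded_filter_spec hc S).bind fun l hl => (choose_spec ?_).imp fun i hi => ?_
  · obtain ⟨i, hi⟩ := exists_load_eq_minLoad q n S
    exact List.ne_nil_of_mem (a := i) (by simp [hl, hi])
  · rw [hl] at hi
    simp only [List.mem_filter, decide_eq_true_eq] at hi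
    exact le_antisymm hi.2 (minLoad_le q n S i)

/-- Every machine of minimum load is a possible outcome of the search for one. -/
theorem can_leastLoaded (hc : Cheap q n h κ) (S : Sched m) {i : Fin m}
    (hi : load q n S i = minLoad q n S) : Can (leastLoaded q n S) i := by
  have h₁ := computeMinLoad_spec hc S
  obtain ⟨x, hx⟩ := h₁.can
  obtain rfl := h₁.of_can hx
  have h₂ := leastLoaded_filter_spec hc S
  obtain ⟨l, hl⟩ := h₂.can
  obtain rfl := h₂.of_can hl
  exact hx.bind (hl.bind (can_choose (by simp [hi])))

omit [NeZero m]

theorem largest_spec (hc : Cheap q n h κ) {l : List ℕ} (hne : l ≠ []) (hl : ∀ k ∈ l, k < n)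
    (hlen : l.length ≤ n) :
    Spec (largest q l) (extremeCost n κ) fun j => j ∈ l ∧ ∀ k ∈ l, q k ≤ q j := by
  cases l with
  | nil => exact absurd rfl hne
  | cons a l =>
    unfold largest
    have hop : ∀ k ∈ a :: l, q k ∈ operands q n h := fun k hk => size_mem_operands (hl k hk)
    refine Spec.le (c := l.length * κ + ((a :: l).length * (1 + κ) + 1)) ?_ ?_
    · refine (foldlM_spec (c := κ)
        (fun r b => (∀ k ∈ r, k ∈ a :: l) ∧ b ∈ a :: l ∧ ∀ k ∈ a :: l, k ∉ r → q k ≤ q b)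
        ⟨fun k hk => by simp [hk], by simp, fun k hk hk' => ?_⟩ fun k r b hb => ?_).bind
          fun b hb => ?_
      · rcases List.mem_cons.1 hk with rfl | h'
        · exact le_rfl
        · exact absurd h' hk'
      · obtain ⟨hr, hb, hmax⟩ := hb
        have hk : k ∈ a :: l := hr k (by simp)
        refine ((leq_spec (hc _ (hop k hk) _ (hop b hb))).bind fun c hc' => Spec.ite (c := 0)
          (fun h1 => ?_) fun h1 => ?_).le le_rfl
        · have hle : q k ≤ q b := by simpa [hc'] using h1
          refine Spec.pure ⟨fun k' hk' => hr k' (by simp [hk']), hb, fun k' hk' hr' => ?_⟩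
          by_cases hkk : k' = k
          · exact hkk ▸ hle
          · exact hmax k' hk' (by simp [hkk, hr'])
        · have hle : q b < q k := by simpa [hc'] using h1
          refine Spec.pure ⟨fun k' hk' => hr k' (by simp [hk']), hk, fun k' hk' hr' => ?_⟩
          by_cases hkk : k' = k
          · rw [hkk]
          · exact (hmax k' hk' (by simp [hkk, hr'])).trans hle.le
      · obtain ⟨-, hb, hmax⟩ := hb
        refine (filterP_spec (P := fun k => q b ≤ q k) fun k hk =>
          leq_spec (hc _ (hop b hb) _ (hop k hk))).bind fun c hc' => ?_
        refine (choose_spec ?_).imp fun j hj => ?_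
        · exact List.ne_nil_of_mem (a := b) (by rw [hc', List.mem_filter]; simpa using hb)
        · rw [hc', List.mem_filter] at hj
          have hbj : q b ≤ q j := by simpa using hj.2
          exact ⟨hj.1, fun k hk => (hmax k hk (by simp)).trans hbj⟩
    · simp only [extremeCost, List.length_cons] at hlen ⊢
      have h1 : l.length * κ ≤ n * κ := Nat.mul_le_mul_right _ (by omega)
      have h2 : (l.length + 1) * (1 + κ) ≤ n * (1 + κ) := Nat.mul_le_mul_right _ hlen
      omega

theorem smallest_spec (hc : Cheap q n h κ) {l : List ℕ} (hne : l ≠ []) (hl : ∀ k ∈ l, k < n)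
    (hlen : l.length ≤ n) :
    Spec (smallest q l) (extremeCost n κ) fun j => j ∈ l ∧ ∀ k ∈ l, q j ≤ q k := by
  cases l with
  | nil => exact absurd rfl hne
  | cons a l =>
    unfold smallest
    have hop : ∀ k ∈ a :: l, q k ∈ operands q n h := fun k hk => size_mem_operands (hl k hk)
    refine Spec.le (c := l.length * κ + ((a :: l).length * (1 + κ) + 1)) ?_ ?_
    · refine (foldlM_spec (c := κ)
        (fun r b => (∀ k ∈ r, k ∈ a :: l) ∧ b ∈ a :: l ∧ ∀ k ∈ a :: l, k ∉ r → q b ≤ q k)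
        ⟨fun k hk => by simp [hk], by simp, fun k hk hk' => ?_⟩ fun k r b hb => ?_).bind
          fun b hb => ?_
      · rcases List.mem_cons.1 hk with rfl | h'
        · exact le_rfl
        · exact absurd h' hk'
      · obtain ⟨hr, hb, hmin⟩ := hb
        have hk : k ∈ a :: l := hr k (by simp)
        refine ((leq_spec (hc _ (hop b hb) _ (hop k hk))).bind fun c hc' => Spec.ite (c := 0)
          (fun h1 => ?_) fun h1 => ?_).le le_rfl
        · have hle : q b ≤ q k := by simpa [hc'] using h1
          refine Spec.pure ⟨fun k' hk' => hr k' (by simp [hk']), hb, fun k' hk' hr' => ?_⟩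
          by_cases hkk : k' = k
          · exact hkk ▸ hle
          · exact hmin k' hk' (by simp [hkk, hr'])
        · have hle : q k < q b := by simpa [hc'] using h1
          refine Spec.pure ⟨fun k' hk' => hr k' (by simp [hk']), hk, fun k' hk' hr' => ?_⟩
          by_cases hkk : k' = k
          · rw [hkk]
          · exact hle.le.trans (hmin k' hk' (by simp [hkk, hr']))
      · obtain ⟨-, hb, hmin⟩ := hb
        refine (filterP_spec (P := fun k => q k ≤ q b) fun k hk =>
          leq_spec (hc _ (hop k hk) _ (hop b hb))).bind fun c hc' => ?_
        refine (choose_spec ?_).imp fun j hj => ?_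
        · exact List.ne_nil_of_mem (a := b) (by rw [hc', List.mem_filter]; simpa using hb)
        · rw [hc', List.mem_filter] at hj
          have hbj : q j ≤ q b := by simpa using hj.2
          exact ⟨hj.1, fun k hk => hbj.trans (hmin k hk (by simp))⟩
    · simp only [extremeCost, List.length_cons] at hlen ⊢
      have h1 : l.length * κ ≤ n * κ := Nat.mul_le_mul_right _ (by omega)
      have h2 : (l.length + 1) * (1 + κ) ≤ n * (1 + κ) := Nat.mul_le_mul_right _ hlen
      omega

theorem jobsOn_spec (n : ℕ) (S : Sched m) (i : Fin m) :
    Spec (jobsOn n S i) n fun l => l = (List.range n).filter fun j => decide (S j = some i) :=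
  (filterP_spec (P := fun j => S j = some i) fun _ _ => Spec.ret _).le (by simp)

end Subroutines

/-! ### The minimum load of an LPT schedule -/

/-- How the function `c ↦ #{machines of load < c}` changes when a job of size `x` is put on a least
loaded machine. -/
def insertCount (F : ℝ → ℕ) (x : ℝ) : ℝ → ℕ := fun c => if F (c - x) = 0 then F c - 1 else F c

theorem insertCount_le (F : ℝ → ℕ) (x : ℝ) : insertCount F x ≤ F := by
  intro c
  unfold insertCount
  split_ifs
  exacts [Nat.sub_le _ _, le_rfl]

theorem insertCount_mono {F G : ℝ → ℕ} (h : F ≤ G) (x : ℝ) : insertCount F x ≤ insertCount G x := by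
  intro c
  have h1 : F c ≤ G c := h c
  have h2 : F (c - x) ≤ G (c - x) := h (c - x)
  simp only [insertCount]
  split_ifs <;> omega

theorem foldl_insertCount_mono {F G : ℝ → ℕ} (h : F ≤ G) (l : List ℝ) :
    l.foldl insertCount F ≤ l.foldl insertCount G := by
  induction l generalizing F G with
  | nil => exact h
  | cons a l ih => exact ih (insertCount_mono h a)

theorem foldl_insertCount_orderedInsert_le (a : ℝ) (l : List ℝ) (F : ℝ → ℕ) :
    (l.orderedInsert (· ≥ ·) a).foldl insertCount F ≤ l.foldl insertCount F := by
  induction l generalizing F with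
  | nil => exact insertCount_le F a
  | cons b l ih =>
    rw [List.orderedInsert_cons]
    split_ifs
    · exact foldl_insertCount_mono (insertCount_mono (insertCount_le F a) b) l
    · exact ih _

/-- The function `c ↦ #{machines of load < c}` after list scheduling of the sizes in `s` in
decreasing order, starting from `F`. -/
noncomputable def lptCount (F : ℝ → ℕ) (s : Multiset ℝ) : ℝ → ℕ :=
  (s.sort (· ≥ ·)).foldl insertCount F

theorem lptCount_cons_le (F : ℝ → ℕ) (a : ℝ) (s : Multiset ℝ) :
    lptCount F (a ::ₘ s) ≤ lptCount F s := by
  have : (a ::ₘ s).sort (· ≥ ·) = (s.sort (· ≥ ·)).orderedInsert (· ≥ ·) a := by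
    refine List.Perm.eq_of_pairwise' (Multiset.pairwise_sort _ _)
      ((Multiset.pairwise_sort s _).orderedInsert _ _) ?_
    rw [← Multiset.coe_eq_coe, Multiset.sort_eq,
      Multiset.coe_eq_coe.2 (List.perm_orderedInsert _ _ _), ← Multiset.cons_coe,
      Multiset.sort_eq]
  rw [lptCount, this]
  exact foldl_insertCount_orderedInsert_le a _ F

/-- The minimum load of an LPT schedule of the first `n` jobs; it does not depend on the resolution
of ties, since the number of machines with load less than `c` does not. -/
noncomputable def lptValue (m : ℕ) (q : ℕ → ℝ) (n : ℕ) : ℝ :=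
  sSup {c | lptCount (fun c => if 0 < c then m else 0) ((Multiset.range n).map q) c = 0}

section

variable {m n κ : ℕ} {q : ℕ → ℝ} {h : ℝ} {S : Sched m}

/-- The number of machines with load less than `c`. -/
noncomputable def countBelow (q : ℕ → ℝ) (n : ℕ) (S : Sched m) (c : ℝ) : ℕ :=
  (Finset.univ.filter fun i => load q n S i < c).card

theorem countBelow_eq_zero [NeZero m] {c : ℝ} : countBelow q n S c = 0 ↔ c ≤ minLoad q n S := by
  rw [countBelow, Finset.card_eq_zero, Finset.filter_eq_empty_iff]
  constructor
  · exact fun h => le_minLoad fun i => not_lt.1 (h (Finset.mem_univ i))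
  · exact fun h i _ => not_lt.2 (h.trans (minLoad_le q n S i))

theorem countBelow_update [NeZero m] (hq : ∀ j, 0 ≤ q j) {j : ℕ} (hj : j < n) (hS : S j = none)
    {i : Fin m} (hi : load q n S i = minLoad q n S) :
    countBelow q n (Function.update S j (some i)) = insertCount (countBelow q n S) (q j) := by
  funext c
  have hl := load_update_some (q := q) hj hS i
  unfold insertCount
  simp only [countBelow_eq_zero, ← hi]
  split_ifs with hc
  · have : (Finset.univ.filter fun i' => load q n (Function.update S j (some i)) i' < c)
        = (Finset.univ.filter fun i' => load q n S i' < c).erase i := by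
      ext i'
      simp only [Finset.mem_filter_univ, Finset.mem_erase, hl]
      by_cases h' : i' = i
      · simp only [h', if_true, ne_eq, not_true, false_and, iff_false, not_lt]; linarith
      · simp [h']
    rw [countBelow, this]
    by_cases hic : load q n S i < c
    · rw [Finset.card_erase_of_mem (by simpa using hic), countBelow]
    · rw [Finset.erase_eq_of_notMem (by simpa using hic)]
      have : countBelow q n S c = 0 := countBelow_eq_zero.2 (hi ▸ not_lt.1 hic)
      rw [this]; exact this
  · unfold countBelow
    congr 1
    ext i'
    simp only [Finset.mem_filter_univ, hl]
    have := hq j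
    by_cases h' : i' = i
    · simp only [h', if_true]
      constructor <;> intro <;> linarith
    · simp [h']

theorem countBelow_empty :
    countBelow q n (fun _ => none : Sched m) = fun c => if 0 < c then m else 0 := by
  funext c
  by_cases hc : 0 < c <;> simp [countBelow, load, hc]

/-- The unassigned ones of the first `n` jobs. -/
def unassigned (n : ℕ) (S : Sched m) : Finset ℕ := (Finset.range n).filter fun j => S j = none

theorem mem_unassigned {j : ℕ} : j ∈ unassigned n S ↔ j < n ∧ S j = none := by
  simp [unassigned]

/-- No machine with two jobs has load more than twice the minimum load. -/
def TwiceBounded (q : ℕ → ℝ) (n : ℕ) (S : Sched m) : Prop :=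
  ∀ i j k, j < n → k < n → j ≠ k → S j = some i → S k = some i →
    load q n S i ≤ 2 * minLoad q n S

/-- Invariant of the LPT rule after the assignment of `k` jobs: the remaining jobs are the smallest
ones, and continuing from here gives the final counts. -/
structure LptState (q : ℕ → ℝ) (n k : ℕ) (S : Sched m) : Prop where
  card : (unassigned n S).card + k = n
  count : lptCount (countBelow q n S) ((unassigned n S).val.map q)
    = lptCount (fun c => if 0 < c then m else 0) ((Multiset.range n).map q)
  sorted : ∀ a < n, ∀ b < n, S a ≠ none → S b = none → q b ≤ q a
  twice : TwiceBounded q n S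

theorem lptState_empty : LptState q n 0 (fun _ => none : Sched m) where
  card := by simp [unassigned]
  count := by rw [countBelow_empty]; simp [unassigned, Finset.range]
  sorted := fun a _ b _ ha => absurd rfl ha
  twice := fun i j k _ _ _ hj => by simp at hj

theorem LptState.update [NeZero m] (hq : ∀ j, 0 ≤ q j) {k : ℕ} (hS : LptState q n k S) {j : ℕ}
    (hj : j ∈ unassigned n S) (hmax : ∀ j' ∈ unassigned n S, q j' ≤ q j) {i : Fin m}
    (hi : load q n S i = minLoad q n S) :
    LptState q n (k + 1) (Function.update S j (some i)) := by
  obtain ⟨hjn, hjS⟩ := mem_unassigned.1 hj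
  have hU : unassigned n (Function.update S j (some i)) = (unassigned n S).erase j := by
    ext l
    by_cases h : l = j
    · simp [mem_unassigned, h]
    · simp [mem_unassigned, h]
  have hl := load_update_some (q := q) hjn hjS i
  have hmono : minLoad q n S ≤ minLoad q n (Function.update S j (some i)) := by
    refine le_minLoad fun i' => (minLoad_le q n S i').trans ?_
    rw [hl]
    split_ifs
    · linarith [hq j]
    · simp
  refine ⟨?_, ?_, fun a ha b hb haS hbS => ?_, fun i' a b ha hb hab hai hbi => ?_⟩
  · rw [hU, Finset.card_erase_of_mem hj]
    have := Finset.card_pos.2 ⟨j, hj⟩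
    have := hS.card
    omega
  · rw [← hS.count, countBelow_update hq hjn hjS hi, hU, Finset.erase_val]
    conv_rhs => rw [← Multiset.cons_erase (Finset.mem_def.1 hj), Multiset.map_cons]
    rw [lptCount, lptCount, Multiset.sort_cons]
    · rfl
    · intro b hb
      obtain ⟨l, hl, rfl⟩ := Multiset.mem_map.1 hb
      exact hmax l (Multiset.mem_of_mem_erase hl)
  · have hbj : b ≠ j := by rintro rfl; simp at hbS
    rw [Function.update_of_ne hbj] at hbS
    by_cases haj : a = j
    · exact haj ▸ hmax b (mem_unassigned.2 ⟨hb, hbS⟩)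
    · rw [Function.update_of_ne haj] at haS
      exact hS.sorted a ha b hb haS hbS
  · have key : ∀ c < n, c ≠ j → S c = some i' → i' = i →
        load q n (Function.update S j (some i)) i'
          ≤ 2 * minLoad q n (Function.update S j (some i)) := by
      intro c hc hcj hci hii
      subst hii
      have h1 : q j ≤ q c := hS.sorted c hc j hjn (by simp [hci]) hjS
      have h2 := le_load hq hc hci
      rw [hl, if_pos rfl]
      linarith
    by_cases haj : a = j
    · subst haj
      have hii : i' = i := by simpa using hai.symm
      rw [Function.update_of_ne hab.symm] at hbi
      exact key b hb hab.symm hbi hii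
    · rw [Function.update_of_ne haj] at hai
      by_cases hbj : b = j
      · subst hbj
        have hii : i' = i := by simpa using hbi.symm
        exact key a ha haj hai hii
      · rw [Function.update_of_ne hbj] at hbi
        by_cases hii : i' = i
        · exact key a ha haj hai hii
        · rw [hl, if_neg hii, add_zero]
          exact (hS.twice i' a b ha hb hab hai hbi).trans (by linarith)

/-- What is known about the final LPT schedule. -/
theorem LptState.final [NeZero m] (hS : LptState q n n S) :
    (∀ j < n, (S j).isSome) ∧ TwiceBounded q n S ∧ minLoad q n S = lptValue m q n := by
  have h0 : unassigned n S = ∅ := Finset.card_eq_zero.1 (by have := hS.card; omega)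
  refine ⟨fun j hj => ?_, hS.twice, ?_⟩
  · by_contra hn
    have : j ∈ unassigned n S := mem_unassigned.2 ⟨hj, by simpa using hn⟩
    simp [h0] at this
  · have hc := hS.count
    rw [h0] at hc
    have : {c | lptCount (fun c => if 0 < c then m else 0) ((Multiset.range n).map q) c = 0}
        = Set.Iic (minLoad q n S) := by
      rw [← hc]
      ext c
      simp [lptCount, countBelow_eq_zero]
    rw [lptValue, this, csSup_Iic]

/-- Time bound for `lptMinLoad`. -/
def lptCost (m n κ : ℕ) : ℕ :=
  n * (n + (extremeCost n κ + (leastCost m n κ + 1))) + minLoadCost m n κ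

theorem lptMinLoad_spec [NeZero m] (hq : ∀ j, 0 ≤ q j) (hc : Cheap q n h κ) :
    Spec (lptMinLoad m q n) (lptCost m n κ) fun τ => τ = lptValue m q n ∧
      ∃ S : Sched m, (∀ j < n, (S j).isSome) ∧ TwiceBounded q n S ∧ minLoad q n S = τ := by
  refine (foldlM_range_spec (fun k S => LptState q n k S) lptState_empty
    fun k hk S hS => ?_).bind fun S hS => ?_
  · refine ((filterP_spec (P := fun j => S j = none) fun _ _ => Spec.ret _).le
      (d := n) (by simp)).bind fun rest hr => ?_
    have hmem : ∀ j, j ∈ rest ↔ j ∈ unassigned n S := fun j => by simp [hr, mem_unassigned]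
    have hne : rest ≠ [] := by
      have : 0 < (unassigned n S).card := by have := hS.card; omega
      obtain ⟨j, hj⟩ := Finset.card_pos.1 this
      exact List.ne_nil_of_mem ((hmem j).2 hj)
    have hlt : ∀ j ∈ rest, j < n := fun j hj => (mem_unassigned.1 ((hmem j).1 hj)).1
    refine (largest_spec hc hne hlt (length_le_of_nodup (hr ▸ List.nodup_range.filter _) hlt)).bind
      fun j hj => (leastLoaded_spec hc S).bind fun i hi => (assign_spec S j (some i)).imp
        fun T hT => ?_
    subst hT
    exact hS.update hq ((hmem j).1 hj.1) (fun j' hj' => hj.2 j' ((hmem j').2 hj')) hi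
  · obtain ⟨h1, h2, h3⟩ := hS.final
    exact (computeMinLoad_spec hc S).imp fun τ hτ => ⟨hτ.trans h3, S, h1, h2, hτ.symm⟩

theorem operands_finite (q : ℕ → ℝ) (n : ℕ) (h : ℝ) : (operands q n h).Finite := by
  refine (((Finset.range n).powerset ×ˢ (Finset.range n).powerset ×ˢ ({0, h} : Finset ℝ)).image
    fun x => ∑ j ∈ x.1, q j - ∑ j ∈ x.2.1, q j + x.2.2).finite_toSet.subset ?_
  rintro x ⟨A, hA, B, hB, e, he, rfl⟩
  simp only [Finset.coe_image, Set.mem_image, Finset.mem_coe, Finset.mem_product,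
    Finset.mem_powerset, Finset.mem_insert, Finset.mem_singleton]
  exact ⟨(A, B, e), ⟨hA, hB, he⟩, rfl⟩

theorem exists_cheap (q : ℕ → ℝ) (n : ℕ) (h : ℝ) : ∃ κ, Cheap q n h κ := by
  obtain ⟨κ, hκ⟩ := (((operands_finite q n h).prod (operands_finite q n h)).image
    fun x => opCost x.1 x.2).bddAbove
  exact ⟨κ, fun x hx y hy => hκ ⟨(x, y), ⟨hx, hy⟩, rfl⟩⟩

theorem exists_lpt [NeZero m] (hq : ∀ j, 0 ≤ q j) (n : ℕ) :
    ∃ S : Sched m, LptState q n n S := by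
  have : ∀ k ≤ n, ∃ S : Sched m, LptState q n k S := by
    intro k
    induction k with
    | zero => exact fun _ => ⟨_, lptState_empty⟩
    | succ k ih =>
      intro hk
      obtain ⟨S, hS⟩ := ih (by omega)
      have : 0 < (unassigned n S).card := by have := hS.card; omega
      obtain ⟨j, hj, hmax⟩ := Finset.exists_max_image _ q (Finset.card_pos.1 this)
      obtain ⟨i, hi⟩ := exists_load_eq_minLoad q n S
      exact ⟨_, hS.update hq hj hmax hi⟩
  exact this n le_rfl

theorem exists_lpt_schedule [NeZero m] (hq : ∀ j, 0 ≤ q j) (n : ℕ) :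
    ∃ S : Sched m, (∀ j < n, (S j).isSome) ∧ TwiceBounded q n S ∧
      minLoad q n S = lptValue m q n := by
  obtain ⟨S, hS⟩ := exists_lpt (m := m) hq n
  exact ⟨S, hS.final⟩

theorem lptValue_nonneg [NeZero m] (hq : ∀ j, 0 ≤ q j) (n : ℕ) : 0 ≤ lptValue m q n := by
  obtain ⟨S, -, -, hS⟩ := exists_lpt_schedule (m := m) hq n
  exact hS ▸ minLoad_nonneg hq

/-- An additional job does not decrease the LPT value. -/
theorem lptValue_mono [NeZero m] (hq : ∀ j, 0 ≤ q j) (n : ℕ) :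
    lptValue m q n ≤ lptValue m q (n + 1) := by
  have key : ∀ n c, lptCount (fun c => if 0 < c then m else 0) ((Multiset.range n).map q) c = 0 ↔
      c ≤ lptValue m q n := by
    intro n c
    obtain ⟨S, hS⟩ := exists_lpt (m := m) hq n
    have h0 : unassigned n S = ∅ := Finset.card_eq_zero.1 (by have := hS.card; omega)
    rw [← hS.final.2.2, ← hS.count, h0]
    simp [lptCount, countBelow_eq_zero]
  rw [← key, Multiset.range_succ, Multiset.map_cons]
  exact Nat.le_zero.1 ((lptCount_cons_le _ _ _ _).trans ((key n _).2 le_rfl).le)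

/-- Comparison of two schedules by weights of the jobs. -/
theorem weight_comparison [NeZero m] {T : Sched m} {w : ℕ → ℝ} (hw : ∀ j, 0 ≤ w j)
    (hS : ∀ j < n, (S j).isSome) {x : ℝ} (h1 : ∀ i, load w n S i ≤ x)
    (h2 : ∃ i, load w n S i < x) (h3 : ∀ i, x ≤ load w n T i) : False := by
  have ha : ∑ i, load w n S i < ∑ _i : Fin m, x :=
    Finset.sum_lt_sum (fun i _ => h1 i) (h2.imp fun i hi => ⟨Finset.mem_univ i, hi⟩)
  have hb : ∑ _i : Fin m, x ≤ ∑ i, load w n T i := Finset.sum_le_sum fun i _ => h3 i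
  rw [sum_load_eq hS] at ha
  exact absurd (ha.trans_le (hb.trans (sum_load_le hw))) (lt_irrefl _)

/-- The LPT rule is a 2-approximation. The weights are the sizes, cut off at the minimum load of the
competing schedule `T`. -/
theorem minLoad_le_two_mul [NeZero m] (hq : ∀ j, 0 ≤ q j) (hS : ∀ j < n, (S j).isSome)
    (h2 : TwiceBounded q n S) (T : Sched m) : minLoad q n T ≤ 2 * minLoad q n S := by
  by_contra! hlt
  set x := minLoad q n T with hx
  have h0 : 0 ≤ minLoad q n S := minLoad_nonneg hq
  have hle : ∀ i, load (fun j => min (q j) x) n S i ≤ load q n S i :=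
    fun i => load_mono (fun j _ => min_le_left _ _) i
  refine weight_comparison (S := S) (T := T) (w := fun j => min (q j) x) (x := x)
    (fun j => le_min (hq j) (by linarith)) hS (fun i => ?_) ?_ fun i => ?_
  · by_cases hi : load q n S i ≤ 2 * minLoad q n S
    · exact (hle i).trans (by linarith)
    · by_cases hj : ∃ j < n, S j = some i
      · obtain ⟨j, hj, hji⟩ := hj
        refine le_trans (le_of_eq ?_) (min_le_right (q j) x)
        rw [load_eq_sum_filter]
        refine Finset.sum_eq_single_of_mem j (by simp [hj, hji]) fun k hk hkj => ?_
        simp only [Finset.mem_filter, Finset.mem_range] at hk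
        exact absurd (h2 i k j hk.1 hj hkj hk.2 hji) hi
      · push Not at hj
        rw [load_eq_sum_filter, Finset.sum_eq_zero]
        · linarith
        · intro k hk
          simp only [Finset.mem_filter, Finset.mem_range] at hk
          exact absurd hk.2 (hj k hk.1)
  · obtain ⟨i, hi⟩ := exists_load_eq_minLoad q n S
    exact ⟨i, (hle i).trans_lt (by linarith)⟩
  · by_cases hj : ∃ j < n, T j = some i ∧ x ≤ q j
    · obtain ⟨j, hj, hji, hjx⟩ := hj
      have := le_load (q := fun j => min (q j) x) (fun j => le_min (hq j) (by linarith)) hj hji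
      simpa [hjx] using this
    · push Not at hj
      refine (minLoad_le q n T i).trans (le_of_eq ?_)
      rw [load_eq_sum_filter, load_eq_sum_filter]
      refine Finset.sum_congr rfl fun k hk => ?_
      simp only [Finset.mem_filter, Finset.mem_range] at hk
      exact (min_eq_left (hj k hk.1 hk.2).le).symm

theorem minLoad_le_two_mul_lptValue [NeZero m] (hq : ∀ j, 0 ≤ q j) (T : Sched m) :
    minLoad q n T ≤ 2 * lptValue m q n := by
  obtain ⟨S, h1, h2, h3⟩ := exists_lpt_schedule (m := m) hq n
  exact h3 ▸ minLoad_le_two_mul hq h1 h2 T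

end

/-! ### Push, shedding of small jobs, the main loop and list scheduling -/

section

variable {m n κ : ℕ} {q : ℕ → ℝ} {h : ℝ} {S : Sched m}

/-- What Push does when job `j` is put on the machine `i`, least loaded in `S`: `Q` are the jobs
taken out, `T` is the new schedule. -/
structure PushResult (q : ℕ → ℝ) (n : ℕ) (S : Sched m) (i : Fin m) (j : ℕ) (Q : List ℕ)
    (T : Sched m) : Prop where
  eq : ∀ k, T k = if k = j then some i else if k ∈ Q then none else S k
  nodup : Q.Nodup
  mem : ∀ k ∈ Q, k < n ∧ S k = some i
  load_self : load q n T i = load q n S i + q j - (Q.map q).sum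
  load_other : ∀ i', i' ≠ i → load q n T i' = load q n S i'
  mono : minLoad q n S ≤ minLoad q n T
  strict : Q ≠ [] → minLoad q n S < load q n T i
  opt : ∀ k < n, T k = some i → load q n T i - q k ≤ minLoad q n T

theorem le_sum_map (hq : ∀ j, 0 ≤ q j) {l : List ℕ} {k : ℕ} (hk : k ∈ l) :
    q k ≤ (l.map q).sum :=
  List.single_le_sum (fun x hx => by obtain ⟨j, -, rfl⟩ := List.mem_map.1 hx; exact hq j) _
    (List.mem_map_of_mem hk)

theorem PushResult.sum_lt {i : Fin m} {j : ℕ} {Q : List ℕ} {T : Sched m}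
    (hP : PushResult q n S i j Q T) (hi : load q n S i = minLoad q n S) (hQ : Q ≠ []) :
    (Q.map q).sum < q j := by
  have h1 := hP.strict hQ
  have h2 := hP.load_self
  linarith

/-- Push only takes out jobs that are smaller than the new one. -/
theorem PushResult.lt {i : Fin m} {j : ℕ} {Q : List ℕ} {T : Sched m}
    (hP : PushResult q n S i j Q T) (hq : ∀ j, 0 ≤ q j) (hi : load q n S i = minLoad q n S)
    {k : ℕ} (hk : k ∈ Q) : q k < q j :=
  (le_sum_map hq hk).trans_lt (hP.sum_lt hi (List.ne_nil_of_mem hk))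

/-- Time bound for `push`. -/
def pushCost (m n κ : ℕ) : ℕ :=
  n + (n * (1 + n) + (1 + n * (loadCost n κ + (κ + (minLoadCost m n κ + (κ + 1))))))

theorem push_spec [NeZero m] (hq : ∀ j, 0 ≤ q j) (hc : Cheap q n h κ) {i : Fin m}
    (hi : load q n S i = minLoad q n S) {j : ℕ} (hj : j < n) (hS : S j = none) :
    Spec (push q n S i j) (pushCost m n κ) fun r => PushResult q n S i j r.1 r.2 := by
  unfold push
  refine (jobsOn_spec n S i).bind fun old hold => ?_
  have hmem : ∀ k, k ∈ old ↔ k < n ∧ S k = some i := fun k => by simp [hold]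
  have hnd : old.Nodup := hold ▸ List.nodup_range.filter _
  have hlen : old.length ≤ n := length_le_of_nodup hnd fun k hk => ((hmem k).1 hk).1
  refine ((arrange_spec rfl).le (d := n * (1 + n)) (by gcongr)).bind fun o ho =>
    (assign_spec S j (some i)).bind fun S₁ hS₁ => ?_
  have hl := load_update_some (q := q) hj hS i
  refine ((foldlM_spec (c := loadCost n κ + (κ + (minLoadCost m n κ + (κ + 1))))
    (fun r (x : List ℕ × Sched m) => r.Nodup ∧ (∀ k ∈ r, k < n ∧ S k = some i ∧ k ∉ x.1) ∧
      (∀ k, x.2 k = if k = j then some i else if k ∈ x.1 then none else S k) ∧ x.1.Nodup ∧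
      (∀ k ∈ x.1, k < n ∧ S k = some i) ∧
      load q n x.2 i = load q n S i + q j - (x.1.map q).sum ∧
      (∀ i', i' ≠ i → load q n x.2 i' = load q n S i') ∧
      minLoad q n S ≤ minLoad q n x.2 ∧ (x.1 ≠ [] → minLoad q n S < load q n x.2 i) ∧
      ∀ k < n, k ∉ r → x.2 k = some i → load q n x.2 i - q k ≤ minLoad q n x.2)
    ⟨ho.nodup_iff.2 hnd, fun k hk => ?_, fun k => ?_, List.nodup_nil, by simp, ?_, ?_, ?_, by simp,
      fun k hk hk' hkT => ?_⟩ ?_).mono (by rw [ho.length_eq]; gcongr) fun x hx => ?_)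
  · have := (hmem k).1 (ho.mem_iff.1 hk)
    exact ⟨this.1, this.2, by simp⟩
  · simp only [hS₁, List.not_mem_nil, if_false, Function.update_apply]
  · simp [hS₁, hl]
  · intro i' hi'
    simp [hS₁, hl, hi']
  · refine le_minLoad fun i' => (minLoad_le q n S i').trans ?_
    simp only [hS₁, hl]
    split_ifs
    · linarith [hq j]
    · simp
  · simp only [hS₁, hl] at hkT ⊢
    have hkj : k = j := by
      by_contra hne
      rw [Function.update_of_ne hne] at hkT
      exact hk' (ho.mem_iff.2 ((hmem k).2 ⟨hk, hkT⟩))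
    simp only [hkj, if_true]
    have : minLoad q n S ≤ minLoad q n (Function.update S j (some i)) := by
      refine le_minLoad fun i' => (minLoad_le q n S i').trans ?_
      rw [hl]
      split_ifs
      · linarith [hq j]
      · simp
    linarith
  · rintro k r ⟨Q, T⟩ ⟨hnr, hr, heq, hQn, hQ, hload, hother, hmono, hstrict, hopt⟩
    obtain ⟨hkn, hkS, hkQ⟩ := hr k (by simp)
    have hkQ : k ∉ Q := hkQ
    have hkj : k ≠ j := by rintro rfl; rw [hS] at hkS; simp at hkS
    have heq : ∀ k, T k = if k = j then some i else if k ∈ Q then none else S k := heq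
    have hload : load q n T i = load q n S i + q j - (Q.map q).sum := hload
    have hother : ∀ i', i' ≠ i → load q n T i' = load q n S i' := hother
    have hmono : minLoad q n S ≤ minLoad q n T := hmono
    have hopt : ∀ k' < n, k' ∉ k :: r → T k' = some i → load q n T i - q k' ≤ minLoad q n T :=
      hopt
    have hkT : T k = some i := by rw [heq, if_neg hkj, if_neg hkQ, hkS]
    refine (computeLoad_spec hc T i).bind fun a ha => ?_
    subst ha
    refine (sub_spec (hc _ (load_mem_operands le_rfl _ _) _ (size_mem_operands hkn))).bind
      fun d hd => (computeMinLoad_spec hc T).bind fun x hx => ?_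
    subst hx hd
    refine (lt_spec (hc _ (minLoad_mem_operands _) _ (load_sub_mem_operands hkn _ _))).bind
      fun b hb => Spec.ite (fun hlt => ?_) fun hlt => ?_
    · have hlt : minLoad q n T < load q n T i - q k := by simpa [hb] using hlt
      refine ((assign_spec T k none).bind fun T' hT' => Spec.pure ?_).le le_rfl
      have hl' := load_update_none (q := q) hkn hkT
      have hm : minLoad q n T ≤ minLoad q n T' := by
        refine le_minLoad fun i' => ?_
        rw [hT', hl']
        split_ifs with hii
        · rw [hii]; exact hlt.le
        · simpa using minLoad_le q n T i'
      have hTi : load q n T' i = load q n T i - q k := by rw [hT', hl', if_pos rfl]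
      refine ⟨(List.nodup_cons.1 hnr).2, fun k' hk' => ?_, fun k' => ?_, ?_, ?_, ?_, ?_,
        hmono.trans hm, fun _ => ?_, fun k' hk' hkr hkT' => ?_⟩
      · have h1 := hr k' (by simp [hk'])
        refine ⟨h1.1, h1.2.1, ?_⟩
        simp only [List.mem_cons, not_or]
        exact ⟨fun hkk => (List.nodup_cons.1 hnr).1 (hkk ▸ hk'), h1.2.2⟩
      · simp only [hT', Function.update_apply, List.mem_cons]
        by_cases hkk : k' = k
        · simp [hkk, hkj]
        · simp [hkk, heq]
      · exact List.nodup_cons.2 ⟨hkQ, hQn⟩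
      · intro k' hk'
        rcases List.mem_cons.1 hk' with rfl | hk'
        · exact ⟨hkn, hkS⟩
        · exact hQ k' hk'
      · simp only [List.map_cons, List.sum_cons, hTi, hload]; ring
      · intro i' hi'
        simp only [hT', hl', if_neg hi', sub_zero, hother i' hi']
      · simp only [hTi]; linarith
      · have hkk : k' ≠ k := by rintro rfl; simp [hT'] at hkT'
        simp only [hT', Function.update_of_ne hkk] at hkT'
        have := hopt k' hk' (by simpa [hkk] using hkr) hkT'
        simp only [hTi]
        linarith [hq k]
    · have hlt : load q n T i - q k ≤ minLoad q n T := by simpa [hb] using hlt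
      refine Spec.mono (c := 0) (Spec.ret _) (by omega) fun x hx => ?_
      rw [hx]
      refine ⟨(List.nodup_cons.1 hnr).2, fun k' hk' => hr k' (by simp [hk']), heq, hQn, hQ, hload,
        hother, hmono, hstrict, fun k' hk' hkr hkT' => ?_⟩
      by_cases hkk : k' = k
      · rw [hkk]; exact hlt
      · exact hopt k' hk' (by simp [hkk, hkr]) hkT'
  · obtain ⟨-, -, h1, h2, h3, h4, h5, h6, h7, h8⟩ := hx
    exact ⟨h1, h2, h3, h4, h5, h6, h7, fun k hk => h8 k hk (by simp)⟩

/-- The effect of taking the small jobs in `R` off machine `i`, as `shedSmall` does. -/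
structure ShedResult (q : ℕ → ℝ) (n : ℕ) (h : ℝ) (S : Sched m) (i : Fin m) (R : List ℕ)
    (T : Sched m) : Prop where
  eq : ∀ k, T k = if k ∈ R then none else S k
  nodup : R.Nodup
  mem : ∀ k ∈ R, k < n ∧ q k < h ∧ S k = some i
  load_self : load q n T i = load q n S i - (R.map q).sum
  load_other : ∀ i', i' ≠ i → load q n T i' = load q n S i'
  mono : minLoad q n S ≤ minLoad q n T
  strict : R ≠ [] → minLoad q n S < load q n T i
  small : ∀ k < n, T k = some i → q k < h → load q n T i ≤ minLoad q n T + h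

/-- Time bound for one iteration of `shedSmall`. -/
def shedIterCost (m n κ : ℕ) : ℕ :=
  1 + (n + (n * (1 + κ) + (loadCost n κ + (minLoadCost m n κ + (κ + (κ +
    (extremeCost n κ + (n + 1))))))))

theorem shedSmall_spec [NeZero m] (hc : Cheap q n h κ) (i : Fin m) {d cap : ℕ} {Qs : List ℕ}
    (hd : ((Finset.range n).filter fun k => S k = some i).card ≤ d) (hcap : d < cap) :
    Spec (shedSmall q n h i cap S Qs) ((d + 1) * shedIterCost m n κ) fun r =>
      ∃ R, r.2 = R ++ Qs ∧ ShedResult q n h S i R r.1 := by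
  induction d using Nat.strong_induction_on generalizing cap S Qs with
  | _ d ih =>
    obtain ⟨cap, rfl⟩ := Nat.exists_eq_succ_of_ne_zero (Nat.ne_of_gt (Nat.zero_lt_of_lt hcap))
    rw [shedSmall]
    refine Spec.le (c := 1 + (n + (n * (1 + κ) + (loadCost n κ + (minLoadCost m n κ + (κ + (κ +
      ((extremeCost n κ + (n + (1 + d * shedIterCost m n κ))))))))))) ?_
        (by
          rw [Nat.succ_mul]
          generalize d * shedIterCost m n κ = e
          simp only [shedIterCost]
          omega)
    refine (tick_spec 1).bind fun _ _ => (jobsOn_spec n S i).bind fun jobs hjobs => ?_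
    have hmem : ∀ k, k ∈ jobs ↔ k < n ∧ S k = some i := fun k => by simp [hjobs]
    have hlen : jobs.length ≤ n :=
      length_le_of_nodup (hjobs ▸ List.nodup_range.filter _) fun k hk => ((hmem k).1 hk).1
    refine ((filterP_spec (P := fun k => q k < h) (c := κ) fun k hk =>
      lt_spec (hc _ (size_mem_operands ((hmem k).1 hk).1) _ threshold_mem_operands)).le
      (d := n * (1 + κ)) (by gcongr)).bind fun small hsmall => ?_
    refine (computeLoad_spec hc S i).bind fun a ha => ?_
    refine (computeMinLoad_spec hc S).bind fun x hx => ?_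
    subst ha hx
    refine (add_spec (hc _ (minLoad_mem_operands S) _ threshold_mem_operands)).bind fun y hy => ?_
    subst hy
    refine (lt_spec (hc _ (minLoad_add_mem_operands S) _ (load_mem_operands le_rfl S i))).bind
      fun b hb => ?_
    refine Spec.ite (fun hcond => ?_) fun hcond => ?_
    · have hcond' : small ≠ [] ∧ minLoad q n S + h < load q n S i := by
        simpa [hb] using hcond
      obtain ⟨hne, hlt⟩ := hcond'
      obtain ⟨s, hs⟩ := List.exists_mem_of_ne_nil _ hne
      rw [hsmall, List.mem_filter, decide_eq_true_eq] at hs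
      refine (smallest_spec hc (List.ne_nil_of_mem hs.1) (fun k hk => ((hmem k).1 hk).1)
        hlen).bind fun k hk => ((tick_spec _).le hlen).bind fun _ _ =>
        (assign_spec S k none).bind fun S' hS' => ?_
      obtain ⟨hkn, hkS⟩ := (hmem k).1 hk.1
      have hkh : q k < h := (hk.2 s hs.1).trans_lt hs.2
      have hl := load_update_none (q := q) hkn hkS
      have hSi : load q n S' i = load q n S i - q k := by rw [hS', hl, if_pos rfl]
      have hSo : ∀ i', i' ≠ i → load q n S' i' = load q n S i' := fun i' hi' => by
        rw [hS', hl, if_neg hi', sub_zero]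
      have hm : minLoad q n S ≤ minLoad q n S' := by
        refine le_minLoad fun i' => ?_
        by_cases hii : i' = i
        · rw [hii, hSi]; linarith
        · rw [hSo i' hii]; exact minLoad_le q n S i'
      obtain ⟨d, rfl⟩ : ∃ e, d = e + 1 := by
        refine Nat.exists_eq_succ_of_ne_zero fun h0 => ?_
        have h1 := Finset.card_eq_zero.1 (Nat.le_zero.1 (h0 ▸ hd))
        exact Finset.filter_eq_empty_iff.1 h1 (Finset.mem_range.2 hkn) hkS
      have hcard : ((Finset.range n).filter fun k => S' k = some i).card ≤ d := by
        have : ((Finset.range n).filter fun k => S' k = some i)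
            = ((Finset.range n).filter fun k => S k = some i).erase k := by
          ext k'
          by_cases hkk : k' = k
          · simp [hkk, hS']
          · simp [hkk, hS']
        rw [this, Finset.card_erase_of_mem (by simp [hkn, hkS])]
        omega
      refine (ih d (Nat.lt_succ_self d) hcard (Nat.lt_of_succ_lt_succ hcap)).imp fun r hr => ?_
      obtain ⟨R, hR, hres⟩ := hr
      have hkR : k ∉ R := fun hkR => by
        have := (hres.mem k hkR).2.2
        rw [hS', Function.update_self] at this
        simp at this
      refine ⟨R ++ [k], by simp [hR], fun k' => ?_, ?_, fun k' hk' => ?_, ?_, fun i' hi' => ?_,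
        hm.trans hres.mono, fun _ => ?_, hres.small⟩
      · rw [hres.eq, hS']
        by_cases hkk : k' = k
        · simp [hkk]
        · simp [hkk]
      · exact List.Nodup.append hres.nodup (List.nodup_singleton k) (by simpa using hkR)
      · rcases List.mem_append.1 hk' with hk' | hk'
        · obtain ⟨h1, h2, h3⟩ := hres.mem k' hk'
          have hkk : k' ≠ k := fun e => hkR (e ▸ hk')
          exact ⟨h1, h2, by rwa [hS', Function.update_of_ne hkk] at h3⟩
        · rw [List.mem_singleton.1 hk']
          exact ⟨hkn, hkh, hkS⟩
      · rw [hres.load_self, hSi]; simp; ring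
      · rw [hres.load_other i' hi', hSo i' hi']
      · by_cases hR0 : R = []
        · rw [hres.load_self, hR0, hSi]; simp; linarith
        · exact hm.trans_lt (hres.strict hR0)
    · refine Spec.mono (c := 0) (Spec.ret _) (by omega) fun r hr => ?_
      subst hr
      refine ⟨[], by simp, fun k => by simp, List.nodup_nil, by simp, by simp, fun _ _ => rfl,
        le_rfl, by simp, fun k hk hS hkh => ?_⟩
      have hne : small ≠ [] := List.ne_nil_of_mem (a := k) (by
        rw [hsmall, List.mem_filter, decide_eq_true_eq]
        exact ⟨(hmem k).2 ⟨hk, hS⟩, hkh⟩)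
      by_contra! hlt
      exact hcond (by simp [hb, hne, hlt])

/-- The schedule of the jobs that are not small, on its own. -/
noncomputable def bigOf (q : ℕ → ℝ) (n : ℕ) (h : ℝ) (S : Sched m) : Sched m :=
  fun j => if j < n ∧ ¬q j < h then S j else none

/-- The schedule that agrees with `SB` on the jobs that are not small and with `S` on the others. -/
noncomputable def overwrite (q : ℕ → ℝ) (n : ℕ) (h : ℝ) (SB S : Sched m) : Sched m :=
  fun j => if j < n ∧ ¬q j < h then SB j else S j

theorem bigPart_spec (hc : Cheap q n h κ) (S : Sched m) :
    Spec (bigPart q n h S) (n * (κ + 1)) fun T => T = bigOf q n h S := by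
  refine (foldlM_range_spec (fun k T => T = bigOf q k h S) (by funext j; simp [bigOf])
    fun j hj T hT => ?_)
  subst hT
  refine (lt_spec (hc _ (size_mem_operands hj) _ threshold_mem_operands)).bind fun b hb =>
    Spec.ite (fun hlt => ?_) fun hlt => ?_
  · have hlt : q j < h := by simpa [hb] using hlt
    refine (assign_spec _ _ _).imp fun T hT => ?_
    funext k
    by_cases hk : k = j
    · simp [hT, hk, bigOf, hlt]
    · have : k < j + 1 ↔ k < j := by omega
      simp [hT, Function.update_of_ne hk, bigOf, this]
  · have hlt : ¬q j < h := by simpa [hb] using hlt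
    refine (assign_spec _ _ _).imp fun T hT => ?_
    funext k
    by_cases hk : k = j
    · simp [hT, hk, bigOf, hlt]
    · have : k < j + 1 ↔ k < j := by omega
      simp [hT, Function.update_of_ne hk, bigOf, this]

theorem copyBig_spec (hc : Cheap q n h κ) (SB S : Sched m) :
    Spec (copyBig q n h SB S) (n * (κ + 1)) fun T => T = overwrite q n h SB S := by
  refine (foldlM_range_spec (fun k T => T = overwrite q k h SB S) (by funext j; simp [overwrite])
    fun j hj T hT => ?_)
  subst hT
  refine (lt_spec (hc _ (size_mem_operands hj) _ threshold_mem_operands)).bind fun b hb =>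
    Spec.ite (fun hlt => ?_) fun hlt => ?_
  · have hlt : q j < h := by simpa [hb] using hlt
    refine (Spec.ret _).mono (by omega) fun T hT => ?_
    funext k
    by_cases hk : k = j
    · simp [hT, hk, overwrite, hlt]
    · have : k < j + 1 ↔ k < j := by omega
      simp [hT, overwrite, this]
  · have hlt : ¬q j < h := by simpa [hb] using hlt
    refine (assign_spec _ _ _).imp fun T hT => ?_
    funext k
    by_cases hk : k = j
    · simp [hT, hk, overwrite, hlt]
    · have : k < j + 1 ↔ k < j := by omega
      simp [hT, Function.update_of_ne hk, overwrite, this]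

/-- The invariant of the main loop that holds for an arbitrary initial schedule: `S` and `SB` agree
on the jobs that are not small, `SB` contains no others, and `QB` and `Qs` list the unassigned
jobs. -/
structure LoopState (q : ℕ → ℝ) (n : ℕ) (h : ℝ) (S SB : Sched m) (QB Qs : List ℕ) : Prop where
  out : ∀ j, n ≤ j → S j = none
  outB : ∀ j, n ≤ j → SB j = none
  big : ∀ j < n, h ≤ q j → S j = SB j
  small : ∀ j, q j < h → SB j = none
  nodupB : QB.Nodup
  memB : ∀ k, k ∈ QB ↔ k < n ∧ h ≤ q k ∧ SB k = none
  nodup : Qs.Nodup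
  mem : ∀ k, k ∈ Qs ↔ k < n ∧ q k < h ∧ S k = none

/-- One iteration of the main loop: job `j` is pushed on machine `i`, which takes out the jobs `Q`,
and then the small jobs `R` are shed. -/
structure Iteration (q : ℕ → ℝ) (n : ℕ) (h : ℝ) (S SB : Sched m) (QB : List ℕ) (j : ℕ) (i : Fin m)
    (Q R : List ℕ) (S' SB' : Sched m) : Prop where
  mem : j ∈ QB
  max : ∀ k ∈ QB, q k ≤ q j
  least : load q n SB i = minLoad q n SB
  push : PushResult q n SB i j Q SB'
  shed : ShedResult q n h (overwrite q n h SB' S) i R S'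

theorem LoopState.next {SB S' SB' : Sched m} {QB Qs Q R : List ℕ} {j : ℕ} {i : Fin m}
    (hL : LoopState q n h S SB QB Qs) (hI : Iteration q n h S SB QB j i Q R S' SB') :
    LoopState q n h S' SB' (Q ++ QB.erase j) (R ++ Qs) := by
  obtain ⟨hjn, hjh, hjS⟩ := (hL.memB j).1 hI.mem
  have hP := hI.push
  have hR := hI.shed
  have hQbig : ∀ k ∈ Q, h ≤ q k := fun k hk => by
    by_contra! hlt
    have := (hP.mem k hk).2
    rw [hL.small k hlt] at this
    simp at this
  refine ⟨fun k hk => ?_, fun k hk => ?_, fun k hk hkh => ?_, fun k hkh => ?_, ?_, fun k => ?_, ?_,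
    fun k => ?_⟩
  · rw [hR.eq, overwrite, if_neg (by omega : ¬(k < n ∧ _)), hL.out k hk, ite_self]
  · rw [hP.eq, if_neg (by omega), hL.outB k hk, ite_self]
  · have hkR : k ∉ R := fun hkR => not_lt.2 hkh (hR.mem k hkR).2.1
    rw [hR.eq, if_neg hkR, overwrite, if_pos ⟨hk, not_lt.2 hkh⟩]
  · rw [hP.eq, hL.small k hkh, ite_self, if_neg]
    rintro rfl
    exact not_lt.2 hjh hkh
  · refine List.Nodup.append hP.nodup (hL.nodupB.erase j) fun k hk hk' => ?_
    have h1 := (hP.mem k hk).2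
    rw [((hL.memB k).1 (List.mem_of_mem_erase hk')).2.2] at h1
    simp at h1
  · rw [List.mem_append, hL.nodupB.mem_erase_iff, hL.memB, hP.eq]
    by_cases hkj : k = j
    · subst hkj
      simp only [ne_eq, not_true, false_and, or_false, if_true, reduceCtorEq, and_false, iff_false]
      intro hk
      have := (hP.mem k hk).2
      rw [hjS] at this
      simp at this
    · by_cases hkQ : k ∈ Q
      · simp [hkj, hkQ, hQbig k hkQ, (hP.mem k hkQ).1]
      · simp [hkj, hkQ]
  · refine List.Nodup.append hR.nodup hL.nodup fun k hk hk' => ?_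
    obtain ⟨hkn, hkh, h1⟩ := hR.mem k hk
    rw [overwrite, if_neg (by tauto), ((hL.mem k).1 hk').2.2] at h1
    simp at h1
  · rw [List.mem_append, hL.mem, hR.eq]
    by_cases hkR : k ∈ R
    · simp [hkR, (hR.mem k hkR).1, (hR.mem k hkR).2.1]
    · simp only [hkR, false_or, if_false]
      refine and_congr_right fun _ => and_congr_right fun hkh => ?_
      rw [overwrite, if_neg (by tauto)]

/-- Time bound for the part of an iteration of the main loop that follows the choice of a machine.
-/
def tailCost (m n κ : ℕ) : ℕ :=
  pushCost m n κ + (n * (κ + 1) + ((n + 1) * shedIterCost m n κ + n))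

/-- Time bound for one iteration of the main loop. -/
def iterCost (m n κ : ℕ) : ℕ :=
  1 + (extremeCost n κ + (n + (leastCost m n κ + tailCost m n κ)))

theorem LoopState.length_le {SB : Sched m} {QB Qs : List ℕ} (hL : LoopState q n h S SB QB Qs) :
    QB.length ≤ n :=
  length_le_of_nodup hL.nodupB fun k hk => ((hL.memB k).1 hk).1

/-- Total correctness of the main loop, with a loop invariant `J`. The set `D` consists of the jobs
that have been pushed so far: they are at least as large as all jobs in `QB`, so that Push never
takes them out again, and at most `d` pushes are left. -/
theorem insertBig_spec [NeZero m] (hq : ∀ j, 0 ≤ q j) (hc : Cheap q n h κ)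
    (J : Sched m → Sched m → List ℕ → List ℕ → Prop)
    (hJ : ∀ S SB QB Qs j i Q R S' SB', LoopState q n h S SB QB Qs →
      Iteration q n h S SB QB j i Q R S' SB' → J S SB QB Qs →
      J S' SB' (Q ++ QB.erase j) (R ++ Qs))
    {d cap : ℕ} {S SB : Sched m} {QB Qs : List ℕ} (hL : LoopState q n h S SB QB Qs)
    (h0 : J S SB QB Qs)
    (hD : ∃ D ⊆ Finset.range n, n ≤ D.card + d ∧
      ∀ a ∈ D, SB a ≠ none ∧ ∀ b ∈ QB, q b ≤ q a)
    (hcap : n + d + 1 < cap) :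
    Spec (insertBig q n h cap S SB QB Qs) (1 + d * iterCost m n κ) fun r =>
      ∃ SB', LoopState q n h r.1 SB' [] r.2 ∧ J r.1 SB' [] r.2 := by
  induction d generalizing cap S SB QB Qs with
  | zero =>
    obtain ⟨cap, rfl⟩ := Nat.exists_eq_succ_of_ne_zero (Nat.ne_of_gt (Nat.zero_lt_of_lt hcap))
    have hnil : QB = [] := by
      rw [List.eq_nil_iff_forall_not_mem]
      intro k hk
      obtain ⟨D, hDn, hcard, hD⟩ := hD
      obtain ⟨hkn, -, hkS⟩ := (hL.memB k).1 hk
      have : D = Finset.range n := Finset.eq_of_subset_of_card_le hDn (by simpa using hcard)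
      exact (hD k (this ▸ Finset.mem_range.2 hkn)).1 hkS
    subst hnil
    rw [insertBig]
    exact ((tick_spec 1).bind fun _ _ =>
      (Spec.pure ⟨SB, hL, h0⟩).le (Nat.zero_le _))
  | succ d ih =>
    obtain ⟨cap, rfl⟩ := Nat.exists_eq_succ_of_ne_zero (Nat.ne_of_gt (Nat.zero_lt_of_lt hcap))
    rw [insertBig]
    refine ((tick_spec 1).bind (d := extremeCost n κ + (n + (leastCost m n κ + (pushCost m n κ +
      (n * (κ + 1) + ((n + 1) * shedIterCost m n κ + (n + (1 + d * iterCost m n κ)))))))) fun _ _ =>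
      Spec.ite (fun hnil => ?_) fun hne => ?_).le
        (by simp only [Nat.succ_mul, iterCost, tailCost]; omega)
    · rw [List.isEmpty_iff] at hnil
      subst hnil
      exact (Spec.pure ⟨SB, hL, h0⟩).le (Nat.zero_le _)
    · rw [List.isEmpty_iff] at hne
      refine (largest_spec hc hne (fun k hk => ((hL.memB k).1 hk).1) hL.length_le).bind
        fun j hj => ((tick_spec _).le hL.length_le).bind fun _ _ =>
        (leastLoaded_spec hc SB).bind fun i hi => ?_
      obtain ⟨hjn, hjh, hjS⟩ := (hL.memB j).1 hj.1
      refine (push_spec hq hc hi hjn hjS).bind fun ⟨Q, SB'⟩ hP => ?_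
      have hP : PushResult q n SB i j Q SB' := hP
      refine (copyBig_spec hc SB' S).bind fun S₁ hS₁ => ?_
      subst hS₁
      refine (shedSmall_spec (d := n) hc i ?_ (by omega)).bind fun ⟨S', Qs'⟩ hR => ?_
      · exact (Finset.card_filter_le _ _).trans (by simp)
      obtain ⟨R, hRQ, hR⟩ := hR
      have hRQ : Qs' = R ++ Qs := hRQ
      subst hRQ
      have hI : Iteration q n h S SB QB j i Q R S' SB' := ⟨hj.1, hj.2, hi, hP, hR⟩
      refine ((tick_spec _).le (length_le_of_nodup hP.nodup fun k hk => (hP.mem k hk).1)).bind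
        fun _ _ => ih (hL.next hI) (hJ _ _ _ _ _ _ _ _ _ _ hL hI h0) ?_ (by omega)
      obtain ⟨D, hDn, hcard, hD⟩ := hD
      have hjD : j ∉ D := fun h' => (hD j h').1 hjS
      refine ⟨insert j D, Finset.insert_subset (Finset.mem_range.2 hjn) hDn, ?_, fun a ha => ?_⟩
      · rw [Finset.card_insert_of_notMem hjD]; omega
      -- a job taken out is smaller than `j`, hence smaller than all jobs pushed before
      · have hja : q j ≤ q a := by
          rcases Finset.mem_insert.1 ha with rfl | ha
          · exact le_rfl
          · exact (hD a ha).2 j hj.1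
        have haQ : a ∉ Q := fun haQ => absurd (hP.lt hq hi haQ) (not_lt.2 hja)
        refine ⟨?_, fun b hb => ?_⟩
        · rw [hP.eq, if_neg haQ]
          rcases Finset.mem_insert.1 ha with rfl | ha
          · simp
          · split_ifs
            · simp
            · exact (hD a ha).1
        · rcases List.mem_append.1 hb with hb | hb
          · exact (hP.lt hq hi hb).le.trans hja
          · exact (hj.2 b (List.mem_of_mem_erase hb)).trans hja

/-- In an iteration of the main loop, every least loaded machine may be chosen. -/
theorem insertBig_poss [NeZero m] (hq : ∀ j, 0 ≤ q j) (hc : Cheap q n h κ)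
    {cap : ℕ} {S SB : Sched m} {QB Qs : List ℕ} (hL : LoopState q n h S SB QB Qs) (hne : QB ≠ [])
    (hcap : n < cap) {i : Fin m} (hi : load q n SB i = minLoad q n SB)
    {X : Sched m × List ℕ → Prop}
    (hX : ∀ j Q R S' SB', Iteration q n h S SB QB j i Q R S' SB' →
      Poss (insertBig q n h cap S' SB' (Q ++ QB.erase j) (R ++ Qs)) X) :
    Poss (insertBig q n h (cap + 1) S SB QB Qs) X := by
  rw [insertBig]
  refine (tick_spec 1).poss.bind fun _ _ => ?_
  rw [if_neg (by simpa using hne)]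
  refine (largest_spec hc hne (fun k hk => ((hL.memB k).1 hk).1) hL.length_le).poss.bind
    fun j hj => (tick_spec _).poss.bind fun _ _ => ?_
  obtain ⟨hjn, hjh, hjS⟩ := (hL.memB j).1 hj.1
  refine Poss.bind (Q := fun i' => i' = i) ⟨i, can_leastLoaded hc SB hi, rfl⟩ fun i' hi' => ?_
  subst hi'
  refine (push_spec hq hc hi hjn hjS).poss.bind fun ⟨Q, SB'⟩ hP => ?_
  refine (copyBig_spec hc SB' S).poss.bind fun S₁ hS₁ => ?_
  subst hS₁
  refine (shedSmall_spec (d := n) hc i' ?_ hcap).poss.bind fun ⟨S', Qs'⟩ hR => ?_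
  · exact (Finset.card_filter_le _ _).trans (by simp)
  obtain ⟨R, hRQ, hR⟩ := hR
  have hRQ : Qs' = R ++ Qs := hRQ
  subst hRQ
  exact (tick_spec _).poss.bind fun _ _ => hX j Q R S' SB' ⟨hj.1, hj.2, hi, hP, hR⟩

/-- Time bound for `listSchedule`. -/
def listCost (m n κ : ℕ) : ℕ := n * (1 + n) + n * (leastCost m n κ + 1)

theorem listSchedule_spec [NeZero m] (hc : Cheap q n h κ) {l : List ℕ} (hnd : l.Nodup)
    (hl : ∀ k ∈ l, k < n ∧ S k = none) (J : Sched m → Prop) (h0 : J S)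
    (hJ : ∀ T k i, k ∈ l → T k = none → load q n T i = minLoad q n T → J T →
      J (Function.update T k (some i))) :
    Spec (listSchedule q n S l) (listCost m n κ) fun T =>
      (∀ k ∉ l, T k = S k) ∧ (∀ k ∈ l, T k ≠ none) ∧ J T := by
  have hlen := length_le_of_nodup hnd fun k hk => (hl k hk).1
  refine ((arrange_spec rfl).le (d := n * (1 + n)) (by gcongr)).bind fun o ho => ?_
  refine (foldlM_spec (c := leastCost m n κ + 1)
    (fun r T => r.Nodup ∧ (∀ k ∈ r, k ∈ l ∧ T k = none) ∧ (∀ k ∉ l, T k = S k) ∧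
      (∀ k ∈ l, k ∉ r → T k ≠ none) ∧ J T)
    ⟨ho.nodup_iff.2 hnd, fun k hk => ⟨ho.mem_iff.1 hk, (hl k (ho.mem_iff.1 hk)).2⟩,
      fun _ _ => rfl, fun k hk hk' => absurd (ho.mem_iff.2 hk) hk', h0⟩
    fun k r T hT => ?_).mono (by rw [ho.length_eq]; gcongr) fun T hT => ?_
  · obtain ⟨hr, h1, h2, h3, h4⟩ := hT
    obtain ⟨hkr, hr⟩ := List.nodup_cons.1 hr
    obtain ⟨hkl, hkT⟩ := h1 k (by simp)
    refine (leastLoaded_spec hc T).bind fun i hi => (assign_spec T k (some i)).imp fun T' hT' => ?_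
    subst hT'
    refine ⟨hr, fun k' hk' => ?_, fun k' hk' => ?_, fun k' hk' hk'' => ?_,
      hJ T k i hkl hkT hi h4⟩
    · have hkk : k' ≠ k := fun e => hkr (e ▸ hk')
      rw [Function.update_of_ne hkk]
      exact h1 k' (by simp [hk'])
    · have hkk : k' ≠ k := fun e => hk' (e ▸ hkl)
      rw [Function.update_of_ne hkk, h2 k' hk']
    · by_cases hkk : k' = k
      · simp [hkk]
      · rw [Function.update_of_ne hkk]
        exact h3 k' hk' (by simp [hkk, hk''])
  · exact ⟨hT.2.2.1, fun k hk => hT.2.2.2.1 k hk (by simp), hT.2.2.2.2⟩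

end

/-! ### Jump-optimal schedules are 1.7-approximate -/

/-- The weight of a job of size `x`, when the minimum load is `1`. It is chosen such that the jobs
of a machine have total weight at most `1` if no job can profitably jump to a machine of load `1`,
and at least `1` if the machine has load at least `1.7`. Both bounds are attained by jobs of sizes
`1, 1/2, 1/5` with weights `1/2, 1/3, 1/6`. -/
noncomputable def weight (x : ℝ) : ℝ :=
  if x < 1 / 5 then 5 / 6 * x else if x < 1 / 2 then 5 / 9 * x + 1 / 18
  else if x < 7 / 10 then 5 / 6 * x - 1 / 12 else if x ≤ 1 then 1 / 2 else 1

theorem weight_nonneg {x : ℝ} (hx : 0 ≤ x) : 0 ≤ weight x := by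
  unfold weight
  split_ifs <;> linarith

theorem weight_le_one {x : ℝ} : weight x ≤ 1 := by
  unfold weight
  split_ifs <;> linarith

theorem weight_le_half {x : ℝ} (hx : x ≤ 1) : weight x ≤ 1 / 2 := by
  unfold weight
  split_ifs <;> linarith

theorem weight_le_slope {x : ℝ} (hx : x ≤ 1) : weight x ≤ 5 / 6 * x := by
  unfold weight
  split_ifs <;> linarith

theorem weight_le_div {x : ℝ} (h0 : 0 ≤ x) (hx : x ≤ 1 / 2) : weight x ≤ x / (1 + x) := by
  rw [le_div_iff₀ (by linarith)]
  unfold weight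
  split_ifs <;> nlinarith

theorem weight_le_div' {x : ℝ} (h0 : 1 / 2 ≤ x) (hx : x ≤ 1) : weight x ≤ x / (2 - x) := by
  rw [le_div_iff₀ (by linarith)]
  unfold weight
  split_ifs <;> nlinarith

theorem le_weight {x : ℝ} (h0 : 0 ≤ x) (hx : x < 7 / 10) : 2 / 3 * x ≤ weight x := by
  unfold weight
  split_ifs <;> linarith

section

variable {A : Finset ℕ} {x : ℕ → ℝ}

theorem sum_weight_nonneg (hx : ∀ k ∈ A, 0 ≤ x k) : 0 ≤ ∑ k ∈ A, weight (x k) :=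
  Finset.sum_nonneg fun k hk => weight_nonneg (hx k hk)

/-- The weight of a machine on which every job `k` satisfies `load - x k ≤ 1`. If `s` is the
smallest size on the machine, the load is at most `1 + s`, and jobs of size `y ≤ 1/2` have weight
at most `y / (1 + y) ≤ y / (1 + s)`. -/
theorem sum_weight_le_one (hx : ∀ k ∈ A, 0 ≤ x k)
    (h : ∀ k ∈ A, ∑ l ∈ A, x l - x k ≤ 1) : ∑ k ∈ A, weight (x k) ≤ 1 := by
  by_cases hbig : ∃ k ∈ A, 1 / 2 < x k
  · obtain ⟨a, ha, hxa⟩ := hbig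
    set B := A.erase a with hB
    have hBA : ∀ k ∈ B, k ∈ A := fun k hk => Finset.mem_of_mem_erase hk
    have hsum : ∑ l ∈ A, x l = x a + ∑ l ∈ B, x l := (Finset.add_sum_erase A x ha).symm
    rw [← Finset.add_sum_erase A (fun k => weight (x k)) ha]
    -- a second job on the machine forces `x a ≤ 1`
    have hle : ∀ k ∈ B, x a + ∑ l ∈ B.erase k, x l ≤ 1 := fun k hk => by
      have h1 := h k (hBA k hk)
      have h2 := Finset.add_sum_erase B x hk
      linarith
    have hpos : ∀ k, 0 ≤ ∑ l ∈ B.erase k, x l := fun k =>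
      Finset.sum_nonneg fun l hl => hx l (hBA l (Finset.mem_of_mem_erase hl))
    rcases B.eq_empty_or_nonempty with h0 | hne
    · rw [← hB, h0]; simpa using weight_le_one
    · obtain ⟨s, hs, hmin⟩ := Finset.exists_min_image B x hne
      have hxa1 : x a ≤ 1 := by linarith [hle s hs, hpos s]
      have hs0 : 0 ≤ x s := hx s (hBA s hs)
      rcases (B.erase s).eq_empty_or_nonempty with h1 | hne'
      · have hxs : x s ≤ 1 := by
          have := h a ha
          have h2 := Finset.add_sum_erase B x hs
          rw [h1, Finset.sum_empty] at h2
          linarith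
        rw [← Finset.add_sum_erase B (fun k => weight (x k)) hs, h1, Finset.sum_empty]
        linarith [weight_le_half hxa1, weight_le_half hxs]
      · have hbound : ∀ k ∈ B.erase s, x k ≤ 1 - x a := fun k hk => by
          have h2 := Finset.single_le_sum (f := x)
            (fun l hl => hx l (hBA l (Finset.mem_of_mem_erase hl))) hk
          linarith [hle s hs]
        have hsa : x s ≤ 1 - x a := by
          obtain ⟨k, hk⟩ := hne'
          exact (hmin k (Finset.mem_of_mem_erase hk)).trans (hbound k hk)
        have hall : ∀ k ∈ B, weight (x k) ≤ x k / (1 + x s) := fun k hk => by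
          have hk1 : x k ≤ 1 - x a := by
            by_cases hks : k = s
            · rw [hks]; exact hsa
            · exact hbound k (Finset.mem_erase.2 ⟨hks, hk⟩)
          have hk0 := hx k (hBA k hk)
          refine (weight_le_div hk0 (by linarith)).trans ?_
          exact div_le_div_of_nonneg_left hk0 (by linarith) (by linarith [hmin k hk])
        have hwa : weight (x a) ≤ x a / (1 + x s) :=
          (weight_le_div' hxa.le hxa1).trans
            (div_le_div_of_nonneg_left (by linarith) (by linarith) (by linarith))
        have hsumB : ∑ k ∈ B, weight (x k) ≤ (∑ k ∈ B, x k) / (1 + x s) := by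
          rw [Finset.sum_div]; exact Finset.sum_le_sum hall
        have hfin : x a / (1 + x s) + (∑ k ∈ B, x k) / (1 + x s) ≤ 1 := by
          rw [← add_div, div_le_one (by linarith)]
          have := h s (hBA s hs)
          linarith
        linarith
  · push Not at hbig
    rcases A.eq_empty_or_nonempty with h0 | hne
    · simp [h0]
    · obtain ⟨s, hs, hmin⟩ := Finset.exists_min_image A x hne
      have hs0 := hx s hs
      calc ∑ k ∈ A, weight (x k) ≤ ∑ k ∈ A, x k / (1 + x s) :=
            Finset.sum_le_sum fun k hk => (weight_le_div (hx k hk) (hbig k hk)).trans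
              (div_le_div_of_nonneg_left (hx k hk) (by linarith) (by linarith [hmin k hk]))
        _ ≤ 1 := by
            rw [← Finset.sum_div, div_le_one (by linarith)]
            linarith [h s hs]

theorem sum_weight_of_small (hx : ∀ k ∈ A, x k < 1 / 5) :
    ∑ k ∈ A, weight (x k) = 5 / 6 * ∑ k ∈ A, x k := by
  rw [Finset.mul_sum]
  exact Finset.sum_congr rfl fun k hk => if_pos (hx k hk)

theorem le_weight_of_ge {y : ℝ} (h1 : 1 / 5 ≤ y) (h2 : y < 1 / 2) :
    weight y = 5 / 9 * y + 1 / 18 := by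
  rw [weight, if_neg (by linarith), if_pos h2]

/-- Jobs of sizes less than `0.7` and total size at least `0.7` have total weight at least `1/2`. -/
theorem half_le_sum_weight (hx : ∀ k ∈ A, 0 ≤ x k) (hlt : ∀ k ∈ A, x k < 7 / 10)
    (h : 7 / 10 ≤ ∑ k ∈ A, x k) : 1 / 2 ≤ ∑ k ∈ A, weight (x k) := by
  have herase : ∀ {B : Finset ℕ}, B ⊆ A → ∀ {b}, b ∈ B →
      (∑ k ∈ B, x k = x b + ∑ k ∈ B.erase b, x k) ∧
      (∑ k ∈ B, weight (x k) = weight (x b) + ∑ k ∈ B.erase b, weight (x k)) ∧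
      0 ≤ ∑ k ∈ B.erase b, weight (x k) ∧ B.erase b ⊆ A := fun {B} hB {b} hb =>
    ⟨(Finset.add_sum_erase B x hb).symm, (Finset.add_sum_erase B (fun k => weight (x k)) hb).symm,
      sum_weight_nonneg fun k hk => hx k (hB (Finset.mem_of_mem_erase hk)),
      (Finset.erase_subset _ _).trans hB⟩
  have hge : ∀ {y : ℝ}, 1 / 5 ≤ y → 1 / 6 ≤ weight y := fun {y} hy => by
    unfold weight
    split_ifs <;> linarith
  by_cases h0 : ∃ b ∈ A, 1 / 2 ≤ x b
  · obtain ⟨b, hb, hxb⟩ := h0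
    obtain ⟨e1, e2, e3, e4⟩ := herase (Finset.Subset.refl A) hb
    have hw : weight (x b) = 5 / 6 * x b - 1 / 12 := by
      rw [weight, if_neg (by linarith), if_neg (by linarith), if_pos (hlt b hb)]
    by_cases h1 : ∃ c ∈ A.erase b, 1 / 5 ≤ x c
    · obtain ⟨c, hc, hxc⟩ := h1
      obtain ⟨f1, f2, f3, f4⟩ := herase e4 hc
      linarith [hge hxc]
    · push Not at h1
      have := sum_weight_of_small h1
      linarith
  · push Not at h0
    by_cases h1 : ∃ b ∈ A, 1 / 5 ≤ x b
    · obtain ⟨b, hb, hxb⟩ := h1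
      obtain ⟨e1, e2, e3, e4⟩ := herase (Finset.Subset.refl A) hb
      have hwb := le_weight_of_ge hxb (h0 b hb)
      by_cases h2 : ∃ c ∈ A.erase b, 1 / 5 ≤ x c
      · obtain ⟨c, hc, hxc⟩ := h2
        obtain ⟨f1, f2, f3, f4⟩ := herase e4 hc
        have hwc := le_weight_of_ge hxc (h0 c (e4 hc))
        by_cases h3 : ∃ d ∈ (A.erase b).erase c, 1 / 5 ≤ x d
        · obtain ⟨d, hd, hxd⟩ := h3
          obtain ⟨g1, g2, g3, g4⟩ := herase f4 hd
          linarith [hge hxb, hge hxc, hge hxd]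
        · push Not at h3
          have h4 := sum_weight_of_small h3
          have h5 : 0 ≤ ∑ k ∈ (A.erase b).erase c, x k :=
            Finset.sum_nonneg fun k hk => hx k (f4 hk)
          linarith
      · push Not at h2
        have := sum_weight_of_small h2
        linarith [h0 b hb]
    · push Not at h1
      have := sum_weight_of_small h1
      linarith

/-- The weight of a machine of load at least `1.7`. -/
theorem one_le_sum_weight (hx : ∀ k ∈ A, 0 ≤ x k) (h : 17 / 10 ≤ ∑ k ∈ A, x k) :
    1 ≤ ∑ k ∈ A, weight (x k) := by
  by_cases hbig : ∃ a ∈ A, 1 < x a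
  · obtain ⟨a, ha, hxa⟩ := hbig
    have hw : weight (x a) = 1 := by
      rw [weight, if_neg (by linarith), if_neg (by linarith), if_neg (by linarith),
        if_neg (by linarith)]
    rw [← hw]
    exact Finset.single_le_sum (f := fun k => weight (x k))
      (fun k hk => weight_nonneg (hx k hk)) ha
  push Not at hbig
  have hhalf : ∀ a ∈ A, 7 / 10 ≤ x a → weight (x a) = 1 / 2 := fun a ha hxa => by
    rw [weight, if_neg (by linarith), if_neg (by linarith), if_neg (by linarith),
      if_pos (hbig a ha)]
  by_cases h0 : ∃ a ∈ A, 7 / 10 ≤ x a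
  · obtain ⟨a, ha, hxa⟩ := h0
    have e0 := hhalf a ha hxa
    have e1 := Finset.add_sum_erase A x ha
    have e2 := Finset.add_sum_erase A (fun k => weight (x k)) ha
    have e3 : ∀ k ∈ A.erase a, 0 ≤ x k := fun k hk => hx k (Finset.mem_of_mem_erase hk)
    by_cases h1 : ∃ b ∈ A.erase a, 7 / 10 ≤ x b
    · obtain ⟨b, hb, hxb⟩ := h1
      have f0 := hhalf b (Finset.mem_of_mem_erase hb) hxb
      have f1 := Finset.single_le_sum (f := fun k => weight (x k))
        (fun k hk => weight_nonneg (e3 k hk)) hb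
      linarith
    · push Not at h1
      have f1 := half_le_sum_weight e3 h1 (by linarith [hbig a ha])
      linarith
  · push Not at h0
    have h1 : ∑ k ∈ A, 2 / 3 * x k ≤ ∑ k ∈ A, weight (x k) :=
      Finset.sum_le_sum fun k hk => le_weight (hx k hk) (h0 k hk)
    rw [← Finset.mul_sum] at h1
    linarith

end

section

variable {m n : ℕ} {q : ℕ → ℝ}

/-- `S` is jump-optimal up to the additive error `η`. -/
def JumpOpt (q : ℕ → ℝ) (n : ℕ) (η : ℝ) (S : Sched m) : Prop :=
  ∀ k < n, ∀ i, S k = some i → load q n S i - q k ≤ minLoad q n S + η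

theorem JumpOpt.minLoad_lt_mul [NeZero m] {η : ℝ} {S : Sched m} (hJ : JumpOpt q n η S)
    (hq : ∀ j, 0 ≤ q j) (hS : ∀ j < n, (S j).isSome) (hη : 0 < η) (T : Sched m) :
    minLoad q n T < 1.7 * (minLoad q n S + η) := by
  by_contra! hT
  set a := minLoad q n S + η with ha
  have ha0 : 0 < a := by linarith [minLoad_nonneg (n := n) (S := S) hq]
  have hx : ∀ j, 0 ≤ q j / a := fun j => div_nonneg (hq j) ha0.le
  have hload : ∀ (U : Sched m) i, ∑ j ∈ (Finset.range n).filter (fun j => U j = some i), q j / a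
      = load q n U i / a := fun U i => by rw [load_eq_sum_filter, Finset.sum_div]
  refine weight_comparison (S := S) (T := T) (w := fun j => weight (q j / a)) (x := 1)
    (fun j => weight_nonneg (hx j)) hS (fun i => ?_) ?_ fun i => ?_
  · rw [load_eq_sum_filter]
    refine sum_weight_le_one (x := fun j => q j / a) (fun k _ => hx k) fun k hk => ?_
    simp only [Finset.mem_filter, Finset.mem_range] at hk
    rw [hload, ← sub_div, div_le_one ha0]
    exact hJ k hk.1 i hk.2
  · obtain ⟨i, hi⟩ := exists_load_eq_minLoad q n S
    refine ⟨i, ?_⟩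
    have h1 : load q n S i / a ≤ 1 := by rw [div_le_one ha0]; linarith
    have h2 : ∀ j ∈ (Finset.range n).filter (fun j => S j = some i), q j / a ≤ 1 := fun j hj => by
      refine le_trans ?_ h1
      simp only [Finset.mem_filter, Finset.mem_range] at hj
      exact div_le_div_of_nonneg_right (le_load hq hj.1 hj.2) ha0.le
    rw [load_eq_sum_filter]
    calc ∑ j ∈ (Finset.range n).filter (fun j => S j = some i), weight (q j / a)
        ≤ ∑ j ∈ (Finset.range n).filter (fun j => S j = some i), 5 / 6 * (q j / a) :=
          Finset.sum_le_sum fun j hj => weight_le_slope (h2 j hj)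
      _ < 1 := by rw [← Finset.mul_sum, hload]; linarith
  · rw [load_eq_sum_filter]
    refine one_le_sum_weight (x := fun j => q j / a) (fun k _ => hx k) ?_
    rw [hload, le_div_iff₀ ha0]
    exact le_trans (by linarith) (minLoad_le q n T i)

theorem JumpOpt.minLoad_le_mul [NeZero m] {η : ℝ} {S : Sched m} (hJ : JumpOpt q n η S)
    (hq : ∀ j, 0 ≤ q j) (hS : ∀ j < n, (S j).isSome) (hη : 0 ≤ η) (T : Sched m) :
    minLoad q n T ≤ 1.7 * (minLoad q n S + η) := by
  refine le_of_forall_pos_le_add fun e he => ?_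
  have : JumpOpt q n (η + e / 1.7) S := fun k hk i hi => (hJ k hk i hi).trans (by
    have : 0 < e / 1.7 := by positivity
    linarith)
  have h1 := this.minLoad_lt_mul hq hS (by positivity) T
  norm_num at h1 ⊢
  linarith

end

/-! ### Jump-optimality and migration in one iteration of the main loop -/

section

variable {m n : ℕ} {q : ℕ → ℝ} {h : ℝ} {S SB S' SB' : Sched m} {QB Qs Q R : List ℕ} {j : ℕ}
  {i : Fin m}

/-- List scheduling of a job of size at most `h` preserves jump-optimality up to `h`. -/
theorem JumpOpt.update_least [NeZero m] (hJ : JumpOpt q n h S) (hj : j < n) (hS : S j = none)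
    (hq : ∀ j, 0 ≤ q j) (hh : q j ≤ h) (hi : load q n S i = minLoad q n S) :
    JumpOpt q n h (Function.update S j (some i)) := by
  have hl := load_update_some (q := q) hj hS i
  have hm : minLoad q n S ≤ minLoad q n (Function.update S j (some i)) := by
    refine le_minLoad fun i' => (minLoad_le q n S i').trans ?_
    rw [hl]
    split_ifs <;> linarith [hq j]
  intro k hk i' hi'
  rw [hl]
  by_cases hkj : k = j
  · subst hkj
    have : i' = i := by simpa using hi'.symm
    rw [if_pos this, this]
    linarith [hq k]
  · rw [Function.update_of_ne hkj] at hi'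
    have := hJ k hk i' hi'
    split_ifs with hii
    · subst hii
      linarith [hq k]
    · linarith

theorem LoopState.load_eq (hL : LoopState q n h S SB QB Qs) (i : Fin m) :
    load q n S i = load q n SB i +
      ∑ k ∈ Finset.range n, if q k < h ∧ S k = some i then q k else 0 := by
  rw [load, load, ← Finset.sum_add_distrib]
  refine Finset.sum_congr rfl fun k hk => ?_
  by_cases hkh : q k < h
  · simp [hkh, hL.small k hkh]
  · simp [hkh, hL.big k (Finset.mem_range.1 hk) (not_lt.1 hkh)]

theorem Iteration.load_overwrite (hL : LoopState q n h S SB QB Qs)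
    (hI : Iteration q n h S SB QB j i Q R S' SB') (i' : Fin m) :
    load q n (overwrite q n h SB' S) i' = load q n S i' + load q n SB' i' - load q n SB i' := by
  rw [hL.load_eq i']
  have : load q n (overwrite q n h SB' S) i' = load q n SB' i' +
      ∑ k ∈ Finset.range n, if q k < h ∧ S k = some i' then q k else 0 := by
    rw [load, load, ← Finset.sum_add_distrib]
    refine Finset.sum_congr rfl fun k hk => ?_
    by_cases hkh : q k < h
    · simp [overwrite, hkh, (hL.next hI).small k hkh]
    · simp [overwrite, hkh, Finset.mem_range.1 hk]
  rw [this]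
  ring

theorem Iteration.eq_of_notMem (hL : LoopState q n h S SB QB Qs)
    (hI : Iteration q n h S SB QB j i Q R S' SB') {k : ℕ} (hkj : k ≠ j) (hkQ : k ∉ Q)
    (hkR : k ∉ R) : S' k = S k := by
  rw [hI.shed.eq, if_neg hkR, overwrite]
  split_ifs with hk
  · rw [hI.push.eq, if_neg hkj, if_neg hkQ, hL.big k hk.1 (not_lt.1 hk.2)]
  · rfl

variable [NeZero m]

theorem Iteration.minLoad_le_overwrite (hL : LoopState q n h S SB QB Qs)
    (hI : Iteration q n h S SB QB j i Q R S' SB') :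
    minLoad q n S ≤ minLoad q n (overwrite q n h SB' S) := by
  refine le_minLoad fun i' => ?_
  have h1 := hI.load_overwrite hL i'
  have h2 := minLoad_le q n S i'
  by_cases hi : i' = i
  · subst hi
    have h3 := hI.least
    have h4 := hI.push.mono
    have h5 := minLoad_le q n SB' i'
    linarith
  · have := hI.push.load_other i' hi
    linarith

theorem Iteration.minLoad_mono (hL : LoopState q n h S SB QB Qs)
    (hI : Iteration q n h S SB QB j i Q R S' SB') : minLoad q n S ≤ minLoad q n S' :=
  (hI.minLoad_le_overwrite hL).trans hI.shed.mono

/-- The key invariant: an iteration preserves jump-optimality up to `h`. On the machine `i`, either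
small jobs are left, and shedding has brought the load down to the minimum plus `h`, or all jobs
have gone through the test of Push. -/
theorem JumpOpt.iteration (hJ : JumpOpt q n h S) (hq : ∀ j, 0 ≤ q j) (hh : 0 ≤ h)
    (hL : LoopState q n h S SB QB Qs) (hI : Iteration q n h S SB QB j i Q R S' SB') :
    JumpOpt q n h S' := by
  have hL' := hL.next hI
  have hm := hI.minLoad_mono hL
  have hmB : minLoad q n SB' ≤ minLoad q n S' := by
    refine le_minLoad fun i' => (MachineCovering.minLoad_le q n SB' i').trans
      (load_le_of_sub hq fun k hk hki => ?_)
    have hkh : h ≤ q k := by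
      by_contra! hlt
      rw [hL'.small k hlt] at hki
      simp at hki
    rw [hL'.big k hk hkh, hki]
  intro k hk i' hki
  by_cases hi : i' = i
  · subst hi
    by_cases hsm : ∃ k' < n, S' k' = some i' ∧ q k' < h
    · obtain ⟨k', hk', hki', hlt⟩ := hsm
      have := hI.shed.small k' hk' hki' hlt
      linarith [hq k]
    · push Not at hsm
      have h1 : load q n S' i' ≤ load q n SB' i' :=
        load_le_of_sub hq fun k' hk' hki' => by
          rw [← hL'.big k' hk' (hsm k' hk' hki'), hki']
      have h2 := hI.push.opt k hk (by rw [← hL'.big k hk (hsm k hk hki), hki])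
      linarith
  · have h1 : load q n S' i' = load q n S i' := by
      have := hI.push.load_other i' hi
      rw [hI.shed.load_other i' hi, hI.load_overwrite hL i']
      linarith
    have h2 : S k = some i' := by
      have hkR : k ∉ R := fun hkR => by rw [hI.shed.eq, if_pos hkR] at hki; simp at hki
      rw [hI.shed.eq, if_neg hkR, overwrite] at hki
      split_ifs at hki with hkh
      · rw [hI.push.eq] at hki
        split_ifs at hki with h3
        · exact absurd (Option.some.inj hki).symm hi
        · rw [hL.big k hk (not_lt.1 hkh.2), hki]
      · exact hki
    have := hJ k hk i' h2
    linarith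

/-- The small jobs shed in an iteration have total size at most three times that of the job that was
pushed. -/
theorem Iteration.sum_shed_le (hJ : JumpOpt q n h S) (hq : ∀ j, 0 ≤ q j)
    (hL : LoopState q n h S SB QB Qs) (hI : Iteration q n h S SB QB j i Q R S' SB') :
    (R.map q).sum ≤ 3 * q j := by
  by_cases hR : R = []
  · simp [hR, hq j]
  obtain ⟨k, hk⟩ := List.exists_mem_of_ne_nil R hR
  obtain ⟨hkn, hkh, hki⟩ := hI.shed.mem k hk
  rw [overwrite, if_neg (by tauto)] at hki
  have h1 := hJ k hkn i hki
  have h2 := hI.shed.strict hR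
  have h3 := hI.shed.load_self
  have h4 := hI.load_overwrite hL i
  have h5 := hI.minLoad_le_overwrite hL
  have h6 := hI.push.load_self
  have h7 : 0 ≤ (Q.map q).sum :=
    List.sum_nonneg fun x hx => by obtain ⟨k, -, rfl⟩ := List.mem_map.1 hx; exact hq k
  have h8 := ((hL.memB j).1 hI.mem).2.1
  linarith

end

theorem sum_ite_mem_le {q : ℕ → ℝ} (hq : ∀ j, 0 ≤ q j) {l : List ℕ} (hl : l.Nodup) (t : ℕ) :
    (∑ k ∈ Finset.range t, if k ∈ l then q k else 0) ≤ (l.map q).sum := by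
  rw [← List.sum_toFinset _ hl, ← Finset.sum_filter]
  exact Finset.sum_le_sum_of_subset_of_nonneg (fun k hk => by
    simpa using (Finset.mem_filter.1 hk).2) fun k _ _ => hq k

theorem Iteration.migrated_le {m n t : ℕ} {q : ℕ → ℝ} {h : ℝ} {S₀ S SB S' SB' : Sched m}
    {QB Qs Q R : List ℕ} {j : ℕ} {i : Fin m} (hS₀ : IsSchedule t S₀) (hq : ∀ j, 0 ≤ q j)
    (hL : LoopState q n h S SB QB Qs) (hI : Iteration q n h S SB QB j i Q R S' SB') :
    migrated q t S₀ S' ≤ migrated q t S₀ S + (Q.map q).sum + (R.map q).sum := by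
  refine le_trans ?_ (add_le_add (add_le_add le_rfl (sum_ite_mem_le hq hI.push.nodup t))
    (sum_ite_mem_le hq hI.shed.nodup t))
  rw [migrated, migrated, ← Finset.sum_add_distrib, ← Finset.sum_add_distrib]
  refine Finset.sum_le_sum fun k hk => ?_
  rw [Finset.mem_range] at hk
  have h0 := hq k
  by_cases hkj : k = j
  -- `j` was unassigned before, hence is already counted as migrated
  · have hne : S₀ k ≠ S k := by
      obtain ⟨hjn, hjh, hjS⟩ := (hL.memB j).1 hI.mem
      have := (hS₀ k).2 hk
      rw [hkj] at this ⊢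
      rw [hL.big j hjn hjh, hjS]
      intro he
      simp [he] at this
    rw [if_neg hne]
    split_ifs <;> linarith
  · by_cases hkQ : k ∈ Q
    · rw [if_pos hkQ]; split_ifs <;> linarith
    · by_cases hkR : k ∈ R
      · rw [if_pos hkR]; split_ifs <;> linarith
      · rw [hI.eq_of_notMem hL hkj hkQ hkR, if_neg hkQ, if_neg hkR]; linarith

/-- The potential of an unassigned job of size `u`; it bounds the total size of the old jobs that
will migrate because of it. The linear term pays for pushes that take out at most one job, which is
smaller by at least `u / (2 * N)`; the quadratic term pays for pushes that take out several jobs.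
-/
noncomputable def potential (N : ℕ) (h UB u : ℝ) : ℝ := 8 * N * u + 4 * (min u UB ^ 2 / h)

section

variable {N : ℕ} {h UB u : ℝ}

theorem potential_le (hh : 0 ≤ h) (hUB : 0 ≤ UB) (hUBh : UB ≤ N * h) (hu : 0 ≤ u) :
    potential N h UB u ≤ 12 * N * u := by
  have : min u UB ^ 2 / h ≤ N * u := by
    rcases hh.eq_or_lt with rfl | hh
    · simp; positivity
    · rw [div_le_iff₀ hh, sq]
      calc min u UB * min u UB ≤ u * UB :=
            mul_le_mul (min_le_left _ _) (min_le_right _ _) (le_min hu hUB) hu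
        _ ≤ u * (N * h) := mul_le_mul_of_nonneg_left hUBh hu
        _ = N * u * h := by ring
  unfold potential
  linarith

/-- A push of a job of size `u` that takes out jobs of the sizes in `l`. If these are several jobs
of size at least `h` and total size `s`, each has size at most `s - h`, so that the sum of their
squares is at most `s ^ 2 - h * s`. -/
theorem sum_potential_add_le (hN : 1 ≤ N) (hh : 0 ≤ h) (hUB : 0 ≤ UB) (hUBh : UB ≤ N * h)
    (hu : 0 ≤ u) {l : List ℝ} (hl : ∀ v ∈ l, h ≤ v) (hgap : ∀ v ∈ l, u ≤ 2 * N * (u - v))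
    (hsum : l.sum ≤ u) (hsum' : l.sum ≤ UB) :
    (l.map (potential N h UB)).sum + 4 * u ≤ potential N h UB u := by
  have hN' : (1 : ℝ) ≤ N := by exact_mod_cast hN
  have h0 : 0 ≤ l.sum := List.sum_nonneg fun v hv => hh.trans (hl v hv)
  have hNu : u ≤ N * u := le_mul_of_one_le_left hu hN'
  have hsq : 0 ≤ min u UB ^ 2 / h := div_nonneg (sq_nonneg _) hh
  match l, hl, hgap, hsum, hsum', h0 with
  | [], _, _, _, _, _ =>
    simp only [List.map_nil, List.sum_nil, potential]
    linarith
  | [v], hl, hgap, hsum, _, h0 =>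
    simp only [List.map_cons, List.map_nil, List.sum_cons, List.sum_nil, add_zero] at *
    have h1 := hgap v (by simp)
    have h2 : min v UB ^ 2 / h ≤ min u UB ^ 2 / h := by
      have : 0 ≤ min v UB := le_min h0 hUB
      gcongr
    unfold potential
    linarith
  | a :: b :: r, hl, hgap, hsum, hsum', h0 =>
    set l := a :: b :: r with hldef
    have hN2 : u - l.sum ≤ N * (u - l.sum) := le_mul_of_one_le_left (by linarith) hN'
    have hlin : (l.map fun v : ℝ => 8 * N * v).sum = 8 * N * l.sum := by
      rw [List.sum_map_mul_left, List.map_id']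
    have hpos : ∀ v ∈ l, 0 ≤ v := fun v hv => hh.trans (hl v hv)
    rcases hh.eq_or_lt with rfl | hh
    -- if `h = 0`, then `UB = 0`, and only jobs of size `0` can be taken out
    · have h1 : (l.map (potential N 0 UB)).sum = 8 * N * l.sum := by
        rw [← hlin]
        congr 2
        funext v
        simp [potential]
      have h2 : l.sum = 0 := by
        rw [mul_zero] at hUBh
        linarith
      rw [h1, h2]
      unfold potential
      simp only [div_zero]
      linarith
    · have hstep : ∀ v ∈ l, potential N h UB v ≤ 8 * N * v + 4 / h * (l.sum - h) * v := by
        intro v hv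
        have h1 : v + h ≤ l.sum := by
          rw [← List.sum_erase hv]
          have hlen : (l.erase v).length = r.length + 1 := by
            rw [List.length_erase_of_mem hv]; simp [hldef]
          obtain ⟨w, hw⟩ := List.exists_mem_of_length_pos (l := l.erase v) (by omega)
          have h2 := List.single_le_sum (fun x hx => hpos x (List.mem_of_mem_erase hx)) w hw
          linarith [hl w (List.mem_of_mem_erase hw)]
        have hv0 := hpos v hv
        have h3 : min v UB ^ 2 / h ≤ 1 / h * (l.sum - h) * v := by
          rw [div_le_iff₀ hh]
          calc min v UB ^ 2 ≤ v ^ 2 := by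
                have : 0 ≤ min v UB := le_min hv0 hUB
                have := min_le_left v UB
                gcongr
            _ ≤ (l.sum - h) * v := by nlinarith
            _ = 1 / h * (l.sum - h) * v * h := by field_simp
        unfold potential
        calc 8 * N * v + 4 * (min v UB ^ 2 / h) ≤ 8 * N * v + 4 * (1 / h * (l.sum - h) * v) := by
              linarith
          _ = _ := by ring
      have h1 : (l.map (potential N h UB)).sum ≤
          (l.map fun v : ℝ => 8 * N * v + 4 / h * (l.sum - h) * v).sum := List.sum_le_sum hstep
      have h2 : (l.map fun v : ℝ => 8 * N * v + 4 / h * (l.sum - h) * v).sum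
          = 8 * N * l.sum + 4 / h * (l.sum - h) * l.sum := by
        rw [List.sum_map_add, hlin, List.sum_map_mul_left, List.map_id']
      have h3 : 4 / h * (l.sum - h) * l.sum = 4 * (l.sum ^ 2 / h) - 4 * l.sum := by
        field_simp
      have h4 : l.sum ^ 2 / h ≤ min u UB ^ 2 / h := by
        have := le_min hsum hsum'
        gcongr
      unfold potential at *
      linarith

end

/-- What the main loop needs to know about the rounded sizes: distinct sizes differ by a factor of
at least about `1 + 1 / (2 * N)`, and `UB` bounds the minimum load of every schedule. -/
structure Rounded (m N : ℕ) (q : ℕ → ℝ) (n : ℕ) (h UB : ℝ) : Prop where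
  pos : 1 ≤ N
  nonneg : ∀ j, 0 ≤ q j
  gap : ∀ a b, q a < q b → q b ≤ 2 * N * (q b - q a)
  h_nonneg : 0 ≤ h
  UB_nonneg : 0 ≤ UB
  UB_le : UB ≤ N * h
  minLoad_le : ∀ T : Sched m, minLoad q n T ≤ UB

/-- An iteration decreases the total potential by at least the total size of the jobs that it takes
out or sheds. -/
theorem Iteration.potential_le {m n N t : ℕ} [NeZero m] {q : ℕ → ℝ} {h UB : ℝ}
    {S₀ S SB S' SB' : Sched m} {QB Qs Q R : List ℕ} {j : ℕ} {i : Fin m}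
    (hr : Rounded m N q n h UB) (hS₀ : IsSchedule t S₀) (hJ : JumpOpt q n h S)
    (hL : LoopState q n h S SB QB Qs) (hI : Iteration q n h S SB QB j i Q R S' SB') :
    migrated q t S₀ S' + ((Q ++ QB.erase j).map fun k => potential N h UB (q k)).sum ≤
      migrated q t S₀ S + (QB.map fun k => potential N h UB (q k)).sum := by
  have hq := hr.nonneg
  have h1 := hI.migrated_le hS₀ hq hL
  have h2 := hI.sum_shed_le hJ hq hL
  have hjn := (hL.memB j).1 hI.mem
  have hle : (Q.map q).sum ≤ q j := by
    by_cases hQ : Q = []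
    · simp [hQ, hq j]
    · exact (hI.push.sum_lt hI.least hQ).le
  have hle' : (Q.map q).sum ≤ UB := by
    refine le_trans ?_ (hr.minLoad_le SB)
    rw [← hI.least, load_eq_sum_filter, ← List.sum_toFinset _ hI.push.nodup]
    refine Finset.sum_le_sum_of_subset_of_nonneg (fun k hk => ?_) fun k _ _ => hq k
    have := hI.push.mem k (List.mem_toFinset.1 hk)
    simp [this]
  have h3 := sum_potential_add_le (l := Q.map q) hr.pos hr.h_nonneg hr.UB_nonneg hr.UB_le (hq j)
    (fun v hv => ?_) (fun v hv => ?_) hle hle'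
  · rw [List.map_map] at h3
    have h4 : (QB.map fun k => potential N h UB (q k)).sum = potential N h UB (q j) +
        ((QB.erase j).map fun k => potential N h UB (q k)).sum := by
      rw [← List.sum_cons, ← List.map_cons (f := fun k => potential N h UB (q k))]
      exact ((List.perm_cons_erase hI.mem).map _).sum_eq
    rw [List.map_append, List.sum_append, h4]
    have h5 : (Q.map (potential N h UB ∘ q)).sum = (Q.map fun k => potential N h UB (q k)).sum := rfl
    linarith
  · obtain ⟨k, hk, rfl⟩ := List.mem_map.1 hv
    exact (((hL.next hI).memB k).1 (List.mem_append_left _ hk)).2.1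
  · obtain ⟨k, hk, rfl⟩ := List.mem_map.1 hv
    exact hr.gap k j (hI.push.lt hq hI.least hk)

/-! ### Rounding and the threshold for small jobs -/

/-- The rounded size of a job of size `x`. -/
noncomputable def rnd (N : ℕ) (x : ℝ) : ℝ :=
  if x ≤ 0 then 0 else
    (2 : ℝ) ^ Int.log 2 x + ⌊(x - (2 : ℝ) ^ Int.log 2 x) / ((2 : ℝ) ^ Int.log 2 x / N)⌋ *
      ((2 : ℝ) ^ Int.log 2 x / N)

section

variable {N : ℕ} {x y : ℝ}

theorem rnd_of_pos (hN : 1 ≤ N) (hx : 0 < x) : ∃ k : ℕ, k < N ∧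
    rnd N x = (2 : ℝ) ^ Int.log 2 x * ((N + k) / N) ∧ rnd N x ≤ x ∧
      x < rnd N x + (2 : ℝ) ^ Int.log 2 x / N := by
  have hN' : (0 : ℝ) < N := by exact_mod_cast hN
  have hb : (0 : ℝ) < (2 : ℝ) ^ Int.log 2 x := by positivity
  have h1 : (2 : ℝ) ^ Int.log 2 x ≤ x := by
    simpa using Int.zpow_log_le_self (R := ℝ) (b := 2) (by norm_num) hx
  have h2 : x < (2 : ℝ) ^ Int.log 2 x * 2 := by
    have := Int.lt_zpow_succ_log_self (R := ℝ) (b := 2) (by norm_num) x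
    rwa [zpow_add_one₀ (by norm_num), Nat.cast_ofNat] at this
  rw [rnd, if_neg (not_le.2 hx)]
  set b := (2 : ℝ) ^ Int.log 2 x
  have hg : 0 < b / N := div_pos hb hN'
  set z := (x - b) / (b / N) with hz
  have hzg : z * (b / N) = x - b := div_mul_cancel₀ _ hg.ne'
  have hz0 : 0 ≤ z := div_nonneg (by linarith) hg.le
  have hzN : z < N := by
    rw [hz, div_lt_iff₀ hg, mul_div_cancel₀ _ hN'.ne']
    linarith
  have hk : ((⌊z⌋.toNat : ℕ) : ℝ) = (⌊z⌋ : ℝ) := by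
    have : ((⌊z⌋.toNat : ℕ) : ℤ) = ⌊z⌋ := Int.toNat_of_nonneg (Int.floor_nonneg.2 hz0)
    exact_mod_cast this
  have h3 := Int.floor_le z
  have h4 := Int.lt_floor_add_one z
  refine ⟨⌊z⌋.toNat, ?_, ?_, ?_, ?_⟩
  · have : ((⌊z⌋.toNat : ℕ) : ℝ) < N := by rw [hk]; linarith
    exact_mod_cast this
  · rw [hk]; field_simp
  · nlinarith
  · nlinarith

theorem rnd_of_nonpos (hx : x ≤ 0) : rnd N x = 0 := if_pos hx

theorem zpow_log_le_rnd (hN : 1 ≤ N) (hx : 0 < x) : (2 : ℝ) ^ Int.log 2 x ≤ rnd N x := by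
  obtain ⟨k, -, h, -⟩ := rnd_of_pos hN hx
  have hN' : (0 : ℝ) < N := by exact_mod_cast hN
  rw [h]
  refine le_mul_of_one_le_right (by positivity) ?_
  rw [le_div_iff₀ hN']
  have : (0 : ℝ) ≤ k := by positivity
  linarith

theorem rnd_nonneg (hN : 1 ≤ N) : 0 ≤ rnd N x := by
  rcases le_or_gt x 0 with hx | hx
  · rw [rnd_of_nonpos hx]
  · exact le_trans (by positivity) (zpow_log_le_rnd hN hx)

theorem rnd_le (hN : 1 ≤ N) (hx : 0 ≤ x) : rnd N x ≤ x := by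
  rcases hx.eq_or_lt with rfl | hx
  · rw [rnd_of_nonpos le_rfl]
  · obtain ⟨k, -, -, h, -⟩ := rnd_of_pos hN hx
    exact h

theorem le_rnd (hN : 1 ≤ N) : x ≤ (1 + 1 / N) * rnd N x := by
  rcases le_or_gt x 0 with hx | hx
  · rw [rnd_of_nonpos hx]; linarith
  · obtain ⟨k, -, -, -, h⟩ := rnd_of_pos hN hx
    have h1 := zpow_log_le_rnd hN hx
    have : (2 : ℝ) ^ Int.log 2 x / N ≤ rnd N x / N := by gcongr
    calc x ≤ rnd N x + rnd N x / N := by linarith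
      _ = _ := by ring

/-- Distinct rounded sizes differ by a constant fraction of `1 / N`. -/
theorem rnd_gap (hN : 1 ≤ N) (h : rnd N x < rnd N y) : rnd N y ≤ 2 * N * (rnd N y - rnd N x) := by
  have hN' : (1 : ℝ) ≤ N := by exact_mod_cast hN
  have hN0 : (0 : ℝ) < N := by linarith
  have hy : 0 < y := by
    by_contra! hy
    rw [rnd_of_nonpos hy] at h
    exact absurd (rnd_nonneg hN) (not_le.2 h)
  have hy0 := rnd_nonneg (N := N) (x := y) hN
  rcases le_or_gt x 0 with hx | hx
  · rw [rnd_of_nonpos hx]; nlinarith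
  obtain ⟨k, hk, hyk, -⟩ := rnd_of_pos hN hy
  obtain ⟨l, hl, hxl, -⟩ := rnd_of_pos hN hx
  generalize Int.log 2 y = e at hyk
  generalize Int.log 2 x = f at hxl
  have hb : (0 : ℝ) < 2 ^ e := by positivity
  have hk' : (k : ℝ) + 1 ≤ N := by exact_mod_cast hk
  have hl' : (l : ℝ) + 1 ≤ N := by exact_mod_cast hl
  have hyk' : rnd N y * N = 2 ^ e * (N + k) := by rw [hyk]; field_simp
  have hxl' : rnd N x * N = 2 ^ f * (N + l) := by rw [hxl]; field_simp
  have hk0 : (0 : ℝ) ≤ k := by positivity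
  have hl0 : (0 : ℝ) ≤ l := by positivity
  have hy2 : rnd N y ≤ 2 ^ e * 2 := by
    refine le_of_mul_le_mul_right ?_ hN0
    rw [hyk']; nlinarith
  rcases lt_trichotomy f e with hfe | hfe | hfe
  · have h2 : (2 : ℝ) ^ f * 2 ≤ 2 ^ e := by
      rw [← zpow_add_one₀ (by norm_num)]
      exact zpow_le_zpow_right₀ (by norm_num) (by omega)
    have h3 : rnd N x * N * 2 ≤ 2 ^ e * (2 * N - 1) := by
      rw [hxl']
      calc (2 : ℝ) ^ f * (N + l) * 2 = 2 ^ f * 2 * (N + l) := by ring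
        _ ≤ 2 ^ e * (2 * N - 1) := by gcongr; linarith
    have h4 : rnd N y ≤ 2 ^ e * (2 * k + 1) := by
      refine le_of_mul_le_mul_right ?_ hN0
      rw [hyk']
      have : (k : ℝ) ≤ k * N := le_mul_of_one_le_right hk0 hN'
      rw [mul_assoc]
      gcongr
      nlinarith
    nlinarith
  · subst hfe
    have h1 : l < k := by
      by_contra! hkl
      have : (k : ℝ) ≤ l := by exact_mod_cast hkl
      have h5 : rnd N y * N ≤ rnd N x * N := by rw [hyk', hxl']; gcongr
      exact absurd (le_of_mul_le_mul_right h5 hN0) (not_le.2 h)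
    have h1' : (l : ℝ) + 1 ≤ k := by exact_mod_cast h1
    nlinarith
  · have h2 : (2 : ℝ) ^ e * 2 ≤ 2 ^ f := by
      rw [← zpow_add_one₀ (by norm_num)]
      exact zpow_le_zpow_right₀ (by norm_num) (by omega)
    have h3 : (2 : ℝ) ^ f ≤ rnd N x := by
      refine le_of_mul_le_mul_right ?_ hN0
      rw [hxl']; nlinarith [show (0 : ℝ) < 2 ^ f by positivity]
    linarith

/-- The threshold for small jobs. -/
noncomputable def thr (N : ℕ) (UB : ℝ) : ℝ := if UB ≤ 0 then 0 else (2 : ℝ) ^ Int.clog 2 (UB / N)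

theorem thr_nonneg {UB : ℝ} : 0 ≤ thr N UB := by
  unfold thr
  split_ifs <;> positivity

theorem le_thr (hN : 1 ≤ N) {UB : ℝ} : UB ≤ N * thr N UB := by
  have hN0 : (0 : ℝ) < N := by exact_mod_cast hN
  unfold thr
  split_ifs with h
  · simpa using h
  · have := Int.self_le_zpow_clog (R := ℝ) (b := 2) (by norm_num) (UB / N)
    rw [div_le_iff₀ hN0] at this
    push_cast at this
    linarith

theorem thr_le (hN : 1 ≤ N) {UB : ℝ} (hUB : 0 ≤ UB) : N * thr N UB ≤ 2 * UB := by
  have hN0 : (0 : ℝ) < N := by exact_mod_cast hN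
  unfold thr
  split_ifs with h
  · simpa using hUB
  · have := Int.zpow_pred_clog_lt_self (R := ℝ) (b := 2) (by norm_num)
      (div_pos (not_le.1 h) hN0)
    rw [zpow_sub_one₀ (by norm_num), lt_div_iff₀ hN0] at this
    push_cast at this
    linarith

theorem thr_mono {UB UB' : ℝ} (h : UB ≤ UB') : thr N UB ≤ thr N UB' := by
  rcases le_or_gt UB 0 with h0 | h0
  · rw [thr, if_pos h0]; exact thr_nonneg
  rcases Nat.eq_zero_or_pos N with rfl | hN
  · simp [thr, not_le.2 h0, not_le.2 (h0.trans_le h)]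
  have hN0 : (0 : ℝ) < N := by exact_mod_cast hN
  rw [thr, thr, if_neg (not_le.2 h0), if_neg (not_le.2 (h0.trans_le h))]
  refine zpow_le_zpow_right₀ (by norm_num) (Int.clog_mono_right (div_pos h0 hN0) ?_)
  gcongr

end

/-- The array of rounded sizes of the first `n` jobs, as the algorithm computes it. -/
noncomputable def sizes (N n : ℕ) (p : ℕ → ℝ) : ℕ → ℝ := fun j => if j < n then rnd N (p j) else 0

/-- The threshold for small jobs on the arrival of job `n - 1`. -/
noncomputable def thrAt (m N n : ℕ) (p : ℕ → ℝ) : ℝ := thr N (2 * lptValue m (sizes N n p) n)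

section

variable {m N n : ℕ} {p : ℕ → ℝ}

theorem sizes_nonneg (hN : 1 ≤ N) (j : ℕ) : 0 ≤ sizes N n p j := by
  unfold sizes
  split_ifs
  exacts [rnd_nonneg hN, le_rfl]

theorem sizes_of_lt {j : ℕ} (hj : j < n) : sizes N n p j = rnd N (p j) := if_pos hj

theorem rounded_sizes [NeZero m] (hN : 1 ≤ N) :
    Rounded m N (sizes N n p) n (thrAt m N n p) (2 * lptValue m (sizes N n p) n) where
  pos := hN
  nonneg := sizes_nonneg hN
  gap := fun a b hab => by
    have hb : b < n := by
      by_contra hb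
      rw [sizes, sizes, if_neg hb] at hab
      split_ifs at hab
      · exact absurd (rnd_nonneg hN) (not_le.2 hab)
      · exact absurd hab (lt_irrefl _)
    rw [sizes_of_lt hb] at hab ⊢
    by_cases ha : a < n
    · rw [sizes_of_lt ha] at hab ⊢
      exact rnd_gap hN hab
    · have h0 : rnd N (0 : ℝ) = 0 := rnd_of_nonpos le_rfl
      rw [sizes, if_neg ha, ← h0] at hab ⊢
      exact rnd_gap hN hab
  h_nonneg := thr_nonneg
  UB_nonneg := mul_nonneg (by norm_num) (lptValue_nonneg (sizes_nonneg hN) n)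
  UB_le := le_thr hN
  minLoad_le := minLoad_le_two_mul_lptValue (sizes_nonneg hN)

/-- Bound on the cost of the arithmetic operations in the rounding of `x`. -/
structure RoundCheap (N : ℕ) (x : ℝ) (κ : ℕ) : Prop where
  self : opCost x 0 ≤ κ
  base : opCost ((2 : ℝ) ^ Int.log 2 x) N ≤ κ
  diff : opCost x ((2 : ℝ) ^ Int.log 2 x) ≤ κ
  quot : opCost (x - (2 : ℝ) ^ Int.log 2 x) ((2 : ℝ) ^ Int.log 2 x / N) ≤ κ
  floor : opCost ((x - (2 : ℝ) ^ Int.log 2 x) / ((2 : ℝ) ^ Int.log 2 x / N)) 0 ≤ κ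
  prod : opCost ⌊(x - (2 : ℝ) ^ Int.log 2 x) / ((2 : ℝ) ^ Int.log 2 x / N)⌋
    ((2 : ℝ) ^ Int.log 2 x / N) ≤ κ
  sum : opCost ((2 : ℝ) ^ Int.log 2 x)
    (⌊(x - (2 : ℝ) ^ Int.log 2 x) / ((2 : ℝ) ^ Int.log 2 x / N)⌋ *
      ((2 : ℝ) ^ Int.log 2 x / N)) ≤ κ

theorem roundSize_spec {x : ℝ} {κ : ℕ} (hc : RoundCheap N x κ) :
    Spec (roundSize N x) (8 * κ) fun z => z = rnd N x := by
  unfold roundSize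
  refine ((leq_spec hc.self).bind (d := 7 * κ) fun b hb => Spec.ite (fun h => ?_)
    fun h => ?_).le (by omega)
  · have hx : x ≤ 0 := by simpa [hb] using h
    exact (Spec.ret _).mono (by omega) fun z hz => hz.trans (rnd_of_nonpos hx).symm
  · have hx : ¬x ≤ 0 := by simpa [hb] using h
    refine Spec.le (c := κ + (κ + (κ + (κ + (κ + (κ + κ)))))) ?_ (by omega)
    refine (pow2Floor_spec hc.self).bind fun b hb => ?_
    subst hb
    refine (div_spec hc.base).bind fun g hg => ?_
    subst hg
    refine (sub_spec hc.diff).bind fun d hd => ?_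
    subst hd
    refine (div_spec hc.quot).bind fun r hr => ?_
    subst hr
    refine (floor_spec hc.floor).bind fun k hk => ?_
    subst hk
    refine (mul_spec hc.prod).bind fun z hz => ?_
    subst hz
    exact (add_spec hc.sum).imp fun z hz => by rw [hz, rnd, if_neg hx]

theorem roundAll_spec {κ : ℕ} (hc : ∀ j < n, RoundCheap N (p j) κ) :
    Spec (roundAll N n p) (n * (1 + 8 * κ)) fun q => q = sizes N n p := by
  refine foldlM_range_spec (fun k q => q = sizes N k p) (by funext j; simp [sizes])
    fun j hj q hq => ?_
  refine ((tick_spec 1).bind fun _ _ => (roundSize_spec (hc j hj)).bind fun x hx =>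
    Spec.pure ?_).le (by omega)
  subst hq hx
  funext k
  by_cases hk : k = j
  · simp [hk, sizes]
  · have : k < j + 1 ↔ k < j := by omega
    simp [Function.update_of_ne hk, sizes, this]

/-- Bounds on the cost of all arithmetic operations on the arrival of job `n - 1`. -/
structure OnlineCheap (m N n : ℕ) (p : ℕ → ℝ) (κ : ℕ) : Prop where
  round : ∀ j < n, RoundCheap N (p j) κ
  double : opCost 2 (lptValue m (sizes N n p) n) ≤ κ
  test : opCost (2 * lptValue m (sizes N n p) n) 0 ≤ κ
  quot : opCost (2 * lptValue m (sizes N n p) n) N ≤ κ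
  pow : opCost (2 * lptValue m (sizes N n p) n / N) 0 ≤ κ
  ops : Cheap (sizes N n p) n (thrAt m N n p) κ

theorem threshold_spec {κ : ℕ} {UB : ℝ} (h1 : opCost UB 0 ≤ κ) (h2 : opCost UB N ≤ κ)
    (h3 : opCost (UB / N) 0 ≤ κ) : Spec (threshold N UB) (3 * κ) fun h => h = thr N UB := by
  unfold threshold
  refine ((leq_spec h1).bind (d := 2 * κ) fun b hb => Spec.ite (fun h => ?_)
    fun h => ?_).le (by omega)
  · have hx : UB ≤ 0 := by simpa [hb] using h
    exact (Spec.ret _).mono (by omega) fun z hz => hz.trans (if_pos hx).symm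
  · have hx : ¬UB ≤ 0 := by simpa [hb] using h
    refine Spec.le (c := κ + κ) ?_ (by omega)
    refine (div_spec h2).bind fun g hg => ?_
    subst hg
    exact (pow2Ceil_spec h3).imp fun z hz => by rw [hz, thr, if_neg hx]

/-! ### The algorithm on the arrival of a job -/

/-- Time bound for `onlineJump`. -/
def onlineCost (m n κ : ℕ) : ℕ :=
  n * (1 + 8 * κ) + (lptCost m n κ + (κ + (3 * κ + (κ + (leastCost m n κ + 1 +
    (n * (κ + 1) + (1 + n * iterCost m n κ + listCost m n κ)))))))

theorem LoopState.init {m n : ℕ} {q : ℕ → ℝ} {h : ℝ} {t : ℕ} {S : Sched m} (hS : IsSchedule t S)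
    (hn : n = t + 1) (ht : h ≤ q t) : LoopState q n h S (bigOf q n h S) [t] [] := by
  have hnone : ∀ k, t ≤ k → S k = none := fun k hk => by
    have := (hS k).not.2 (not_lt.2 hk)
    simpa using this
  have hsome : ∀ k, S k = none → t ≤ k := fun k hk => by
    by_contra! hlt
    have := (hS k).2 hlt
    simp [hk] at this
  refine ⟨fun j hj => hnone j (by omega), fun j hj => if_neg (by omega), fun j hj hjh => ?_,
    fun j hj => if_neg (by tauto), List.nodup_singleton t, fun k => ?_, List.nodup_nil, fun k => ?_⟩
  · rw [bigOf, if_pos ⟨hj, not_lt.2 hjh⟩]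
  · rw [List.mem_singleton]
    constructor
    · rintro rfl
      exact ⟨by omega, ht, by rw [bigOf, hnone k le_rfl, ite_self]⟩
    · rintro ⟨h1, h2, h3⟩
      rw [bigOf, if_pos ⟨h1, not_lt.2 h2⟩] at h3
      have := hsome k h3
      omega
  · simp only [List.not_mem_nil, false_iff, not_and]
    intro h1 h2 h3
    have := hsome k h3
    obtain rfl : k = t := by omega
    linarith

variable [NeZero m]

/-- The target of the specifications below: the new schedule is complete, and if the old one was
nearly jump-optimal, then so is the new one, and little has been migrated. -/
def GoodStep (N : ℕ) (q : ℕ → ℝ) (t : ℕ) (h : ℝ) (S S' : Sched m) : Prop :=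
  IsSchedule (t + 1) S' ∧ (JumpOpt q (t + 1) h S → JumpOpt q (t + 1) h S' ∧
    migrated q t S S' ≤ 12 * N * q t)

section

variable {q : ℕ → ℝ} {h UB : ℝ} {t κ cap : ℕ} {S : Sched m}

theorem assignSmall_spec (hr : Rounded m N q (t + 1) h UB) (hops : Cheap q (t + 1) h κ)
    (hS : IsSchedule t S) (hlt : q t < h) :
    Spec (do let i ← leastLoaded q (t + 1) S; assign S t (some i)) (leastCost m (t + 1) κ + 1)
      (GoodStep N q t h S) := by
  have hq0 := hr.nonneg
  have htn : t < t + 1 := by omega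
  have hSt : S t = none := by
    have := (hS t).not.2 (lt_irrefl t)
    simpa using this
  refine (leastLoaded_spec hops S).bind fun i hi => (assign_spec S t (some i)).imp fun S' hS' => ?_
  subst hS'
  refine ⟨fun j => ?_, fun hJ => ⟨hJ.update_least htn hSt hq0 hlt.le hi, ?_⟩⟩
  · by_cases hj : j = t
    · simp [hj]
    · rw [Function.update_of_ne hj, hS j]
      omega
  · have : migrated q t S (Function.update S t (some i)) = 0 :=
      Finset.sum_eq_zero fun k hk => by
        rw [Function.update_of_ne (Finset.mem_range.1 hk).ne, if_pos rfl]
    rw [this]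
    have := hq0 t
    positivity

theorem assignBig_spec (hr : Rounded m N q (t + 1) h UB) (hops : Cheap q (t + 1) h κ)
    (hS : IsSchedule t S) (hge : h ≤ q t) (hcap : 2 * (t + 1) + 1 < cap) :
    Spec (do
      let SB ← bigPart q (t + 1) h S
      let (S', Qs) ← insertBig q (t + 1) h cap S SB [t] []
      listSchedule q (t + 1) S' Qs)
      ((t + 1) * (κ + 1) + (1 + (t + 1) * iterCost m (t + 1) κ + listCost m (t + 1) κ))
      (GoodStep N q t h S) := by
  have hq0 := hr.nonneg
  refine (bigPart_spec hops S).bind fun SB hSB => ?_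
  subst hSB
  have hL := LoopState.init hS rfl hge
  refine (insertBig_spec (d := t + 1) hq0 hops
    (fun S' _ QB _ => JumpOpt q (t + 1) h S → JumpOpt q (t + 1) h S' ∧
      migrated q t S S' + (QB.map fun k => potential N h UB (q k)).sum ≤ potential N h UB (q t))
    (fun S₁ SB QB Qs j i Q R S₂ SB' hL hI h0 hJ => ?_) hL (fun hJ => ⟨hJ, ?_⟩)
    ⟨∅, by simp, by simp, by simp⟩ (by omega)).bind fun ⟨S₁, Qs⟩ hS₁ => ?_
  · obtain ⟨h1, h2⟩ := h0 hJ
    exact ⟨h1.iteration hq0 hr.h_nonneg hL hI, (hI.potential_le hr hS h1 hL).trans h2⟩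
  · simp [migrated]
  · obtain ⟨SB, hL₁, hJ₁⟩ := hS₁
    have hL₁ : LoopState q (t + 1) h S₁ SB [] Qs := hL₁
    have hJ₁ : JumpOpt q (t + 1) h S → JumpOpt q (t + 1) h S₁ ∧ migrated q t S S₁ +
      (([] : List ℕ).map fun k => potential N h UB (q k)).sum ≤ potential N h UB (q t) := hJ₁
    refine (listSchedule_spec hops hL₁.nodup
      (fun k hk => ⟨((hL₁.mem k).1 hk).1, ((hL₁.mem k).1 hk).2.2⟩)
      (fun T => JumpOpt q (t + 1) h S → JumpOpt q (t + 1) h T) (fun hJ => (hJ₁ hJ).1)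
      fun T k i hk hT hi hJT hJ => (hJT hJ).update_least ((hL₁.mem k).1 hk).1 hT hq0
        ((hL₁.mem k).1 hk).2.1.le hi).imp fun S' hS' => ?_
    obtain ⟨h1, h2, h3⟩ := hS'
    refine ⟨fun k => ?_, fun hJ => ⟨h3 hJ, ?_⟩⟩
    · rcases lt_or_ge k (t + 1) with hk | hk
      · refine iff_of_true ?_ hk
        rw [Option.isSome_iff_ne_none]
        by_cases hkQ : k ∈ Qs
        · exact h2 k hkQ
        · rw [h1 k hkQ]
          intro hnone
          rcases lt_or_ge (q k) h with hkh | hkh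
          · exact hkQ ((hL₁.mem k).2 ⟨hk, hkh, hnone⟩)
          · rw [hL₁.big k hk hkh] at hnone
            simpa using (hL₁.memB k).2 ⟨hk, hkh, hnone⟩
      · refine iff_of_false ?_ (by omega)
        have hkQ : k ∉ Qs := fun hkQ => by have := ((hL₁.mem k).1 hkQ).1; omega
        rw [h1 k hkQ, hL₁.out k hk]
        simp
    · have h4 := (hJ₁ hJ).2
      simp only [List.map_nil, List.sum_nil, add_zero] at h4
      refine le_trans ?_ (h4.trans
        (potential_le hr.h_nonneg hr.UB_nonneg hr.UB_le (hq0 t)))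
      refine Finset.sum_le_sum fun k hk => ?_
      have hk0 := hq0 k
      by_cases hkQ : k ∈ Qs
      · have hne : S k ≠ S₁ k := by
          rw [((hL₁.mem k).1 hkQ).2.2]
          have := (hS k).2 (Finset.mem_range.1 hk)
          intro he
          simp [he] at this
        rw [if_neg hne]
        split_ifs <;> linarith
      · rw [h1 k hkQ]

end

/-- Correctness of the algorithm for an arbitrary current schedule `S`, and the facts on
jump-optimality and migration that hold if `S` is nearly jump-optimal. -/
theorem onlineJump_spec {t κ cap : ℕ} (hN : 1 ≤ N) (hc : OnlineCheap m N (t + 1) p κ) {S : Sched m}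
    (hS : IsSchedule t S) (hcap : 2 * (t + 1) + 1 < cap) :
    Spec (onlineJump cap N p t S) (onlineCost m (t + 1) κ)
      (GoodStep N (sizes N (t + 1) p) t (thrAt m N (t + 1) p) S) := by
  have hr := rounded_sizes (m := m) (n := t + 1) (p := p) hN
  unfold onlineJump
  refine (roundAll_spec hc.round).bind fun q hq => ?_
  subst hq
  refine (lptMinLoad_spec hr.nonneg hc.ops).bind fun τ hτ => ?_
  obtain ⟨rfl, -⟩ := hτ
  refine (mul_spec hc.double).bind fun UB hUB => ?_
  subst hUB
  refine (threshold_spec hc.test hc.quot hc.pow).bind fun h hh => ?_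
  subst hh
  refine (lt_spec (hc.ops _ (size_mem_operands (Nat.lt_succ_self t)) _
    threshold_mem_operands)).bind fun b hb => Spec.ite (fun hlt => ?_) fun hlt => ?_
  · exact (assignSmall_spec hr hc.ops hS (by simpa [hb] using hlt)).le (Nat.le_add_right _ _)
  · exact (assignBig_spec hr hc.ops hS (by simpa [hb] using hlt) hcap).le (Nat.le_add_left _ _)

/-- A run of the algorithm in which the choices in the main loop are prescribed. -/
theorem onlineJump_poss {t κ cap : ℕ} (hN : 1 ≤ N) (hc : OnlineCheap m N (t + 1) p κ) {S : Sched m}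
    (ht : thrAt m N (t + 1) p ≤ sizes N (t + 1) p t) {X : Sched m → Prop}
    (hX : Poss (insertBig (sizes N (t + 1) p) (t + 1) (thrAt m N (t + 1) p) cap S
      (bigOf (sizes N (t + 1) p) (t + 1) (thrAt m N (t + 1) p) S) [t] []) fun r =>
        r.2 = [] ∧ X r.1) :
    Poss (onlineJump cap N p t S) X := by
  have hr := rounded_sizes (m := m) (n := t + 1) (p := p) hN
  unfold onlineJump
  refine (roundAll_spec hc.round).poss.bind fun q hq => ?_
  subst hq
  refine (lptMinLoad_spec hr.nonneg hc.ops).poss.bind fun τ hτ => ?_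
  obtain ⟨rfl, -⟩ := hτ
  refine (mul_spec hc.double).poss.bind fun UB hUB => ?_
  subst hUB
  refine (threshold_spec hc.test hc.quot hc.pow).poss.bind fun h hh => ?_
  subst hh
  refine (lt_spec (hc.ops _ (size_mem_operands (Nat.lt_succ_self t)) _
    threshold_mem_operands)).poss.bind fun b hb => ?_
  rw [if_neg (by simpa [hb] using ht)]
  refine (bigPart_spec hc.ops S).poss.bind fun SB hSB => ?_
  subst hSB
  refine hX.bind fun ⟨S₁, Qs⟩ hS₁ => ?_
  obtain ⟨h1, h2⟩ := hS₁
  have h1 : Qs = [] := h1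
  subst h1
  exact (listSchedule_spec hc.ops List.nodup_nil (by simp) (fun _ => True) trivial
    (by simp)).poss.imp fun T hT => by
      have : T = S₁ := funext fun k => hT.1 k (by simp)
      rw [this]; exact h2

theorem exists_onlineCheap (m N n : ℕ) (p : ℕ → ℝ) : ∃ κ, OnlineCheap m N n p κ := by
  obtain ⟨κ₁, h₁⟩ := exists_cheap (sizes N n p) n (thrAt m N n p)
  have h₂ : ∃ κ₂, ∀ j < n, RoundCheap N (p j) κ₂ := by
    have : ∀ j, ∃ κ, ∀ κ' ≥ κ, RoundCheap N (p j) κ' := fun j => by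
      refine ⟨opCost (p j) 0 + opCost ((2 : ℝ) ^ Int.log 2 (p j)) N +
        opCost (p j) ((2 : ℝ) ^ Int.log 2 (p j)) +
        opCost (p j - (2 : ℝ) ^ Int.log 2 (p j)) ((2 : ℝ) ^ Int.log 2 (p j) / N) +
        opCost ((p j - (2 : ℝ) ^ Int.log 2 (p j)) / ((2 : ℝ) ^ Int.log 2 (p j) / N)) 0 +
        opCost ⌊(p j - (2 : ℝ) ^ Int.log 2 (p j)) / ((2 : ℝ) ^ Int.log 2 (p j) / N)⌋
          ((2 : ℝ) ^ Int.log 2 (p j) / N) +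
        opCost ((2 : ℝ) ^ Int.log 2 (p j))
          (⌊(p j - (2 : ℝ) ^ Int.log 2 (p j)) / ((2 : ℝ) ^ Int.log 2 (p j) / N)⌋ *
          ((2 : ℝ) ^ Int.log 2 (p j) / N)), fun κ' hκ' => ⟨?_, ?_, ?_, ?_, ?_, ?_, ?_⟩⟩ <;> omega
    choose κ hκ using this
    exact ⟨∑ j ∈ Finset.range n, κ j, fun j hj => hκ j _
      (Finset.single_le_sum (f := κ) (fun _ _ => Nat.zero_le _) (Finset.mem_range.2 hj))⟩
  obtain ⟨κ₂, h₂⟩ := h₂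
  have hmono : ∀ {x κ κ'}, RoundCheap N x κ → κ ≤ κ' → RoundCheap N x κ' := fun h hle =>
    ⟨h.1.trans hle, h.2.trans hle, h.3.trans hle, h.4.trans hle, h.5.trans hle, h.6.trans hle,
      h.7.trans hle⟩
  refine ⟨κ₁ + κ₂ + opCost 2 (lptValue m (sizes N n p) n) +
    opCost (2 * lptValue m (sizes N n p) n) 0 + opCost (2 * lptValue m (sizes N n p) n) N +
    opCost (2 * lptValue m (sizes N n p) n / N) 0,
    fun j hj => hmono (h₂ j hj) (by omega), by omega, by omega, by omega, by omega,
    fun x hx y hy => (h₁ x hx y hy).trans (by omega)⟩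

end

/-! ### Reachable schedules: competitiveness and migration -/

section

variable {m N t : ℕ} [NeZero m] {p : ℕ → ℝ} {S S' : Sched m}

omit [NeZero m] in
theorem lptValue_congr {q q' : ℕ → ℝ} {n : ℕ} (h : ∀ j < n, q j = q' j) :
    lptValue m q n = lptValue m q' n := by
  unfold lptValue
  rw [Multiset.map_congr rfl fun j hj => h j (Multiset.mem_range.1 hj)]

theorem thrAt_mono (hN : 1 ≤ N) : thrAt m N t p ≤ thrAt m N (t + 1) p := by
  refine thr_mono ?_
  have h1 : lptValue m (sizes N t p) t = lptValue m (sizes N (t + 1) p) t :=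
    lptValue_congr fun j hj => by rw [sizes_of_lt hj, sizes_of_lt (by omega)]
  rw [h1]
  linarith [lptValue_mono (m := m) (q := sizes N (t + 1) p) (sizes_nonneg hN) t]

theorem Step.goodStep (hN : 1 ≤ N) (hS : IsSchedule t S) (h : Step N p t S S') :
    GoodStep N (sizes N (t + 1) p) t (thrAt m N (t + 1) p) S S' := by
  obtain ⟨ω, T, cap, r, hrun, -⟩ := h
  obtain ⟨κ, hκ⟩ := exists_onlineCheap m N (t + 1) p
  exact (onlineJump_spec (cap := max cap (2 * (t + 1) + 2)) hN hκ hS (by omega)).of_run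
    (onlineJump_refines (le_max_left _ _) N p t S _ _ hrun)

/-- The arrival of a job does not affect near jump-optimality of the schedule of the old jobs. -/
theorem JumpOpt.arrival (hN : 1 ≤ N) (hS : IsSchedule t S)
    (hJ : JumpOpt (sizes N t p) t (thrAt m N t p) S) :
    JumpOpt (sizes N (t + 1) p) (t + 1) (thrAt m N (t + 1) p) S := by
  have hSt : S t = none := by
    have := (hS t).not.2 (lt_irrefl t)
    simpa using this
  have hload : ∀ i, load (sizes N (t + 1) p) (t + 1) S i = load (sizes N t p) t S i := fun i => by
    rw [load, Finset.sum_range_succ, hSt, if_neg (by simp), add_zero]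
    exact Finset.sum_congr rfl fun j hj => by
      rw [sizes_of_lt (Finset.mem_range.1 hj), sizes_of_lt (by have := Finset.mem_range.1 hj; omega)]
  have hmin : minLoad (sizes N (t + 1) p) (t + 1) S = minLoad (sizes N t p) t S := by
    unfold minLoad
    simp only [hload]
  intro k hk i hki
  have hkt : k < t := (hS k).1 (by simp [hki])
  rw [hload, hmin, sizes_of_lt hk, ← sizes_of_lt (n := t) hkt]
  linarith [hJ k hkt i hki, thrAt_mono (m := m) (t := t) (p := p) hN]

theorem Reaches.jumpOpt (hN : 1 ≤ N) (h : Reaches N p t S) :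
    IsSchedule t S ∧ JumpOpt (sizes N t p) t (thrAt m N t p) S := by
  induction h with
  | zero => exact ⟨fun j => by simp, fun k hk => absurd hk (by omega)⟩
  | succ _ hstep ih =>
    have := hstep.goodStep hN ih.1
    exact ⟨this.1, (this.2 (ih.2.arrival hN ih.1)).1⟩

theorem migrated_le_of_reaches (hN : 2 ≤ N) (hp : ∀ j, 0 ≤ p j) (h : Reaches N p t S)
    (hstep : Step N p t S S') : migrated p t S S' ≤ 50 * N * p t := by
  have hN1 : 1 ≤ N := by omega
  obtain ⟨hS, hJ⟩ := h.jumpOpt hN1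
  have h1 := ((hstep.goodStep hN1 hS).2 (hJ.arrival hN1 hS)).2
  have hδ : (1 : ℝ) / N ≤ 1 / 2 := by
    have : (2 : ℝ) ≤ N := by exact_mod_cast hN
    gcongr
  have h2 : migrated p t S S' ≤ 3 / 2 * migrated (sizes N (t + 1) p) t S S' := by
    rw [migrated, migrated, Finset.mul_sum]
    refine Finset.sum_le_sum fun j hj => ?_
    split_ifs
    · simp
    · rw [sizes_of_lt (by have := Finset.mem_range.1 hj; omega)]
      refine (le_rnd hN1).trans ?_
      have := rnd_nonneg (x := p j) hN1
      gcongr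
      linarith
  have h3 : sizes N (t + 1) p t ≤ p t := by
    rw [sizes_of_lt (by omega)]
    exact rnd_le hN1 (hp t)
  have h4 : (N : ℝ) * sizes N (t + 1) p t ≤ N * p t := by gcongr
  have h5 : 0 ≤ (N : ℝ) * p t := mul_nonneg (by positivity) (hp t)
  linarith

theorem opt_le {c : ℝ} (h : ∀ T : Sched m, minLoad p t T ≤ c) : opt p t m ≤ c := by
  refine ciSup_le fun A => ?_
  refine le_trans (le_of_eq ?_) (h fun j => if hj : j < t then some (A ⟨j, hj⟩) else none)
  unfold minLoad load
  congr 1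
  funext i
  rw [Finset.sum_range]
  exact Finset.sum_congr rfl fun j _ => by simp

theorem opt_le_of_reaches {ε : ℝ} (hε : 0 < ε) (hε1 : ε ≤ 1) (hN : 2 ≤ N) (hNε : 50 / ε ≤ N)
    (hp : ∀ j, 0 ≤ p j) (h : Reaches N p t S) : opt p t m ≤ (1.7 + ε) * minLoad p t S := by
  have hN1 : 1 ≤ N := by omega
  have hN0 : (0 : ℝ) < N := by exact_mod_cast hN1
  obtain ⟨hS, hJ⟩ := h.jumpOpt hN1
  set q := sizes N t p with hq
  set η := thrAt m N t p with hη
  have hq0 : ∀ j, 0 ≤ q j := sizes_nonneg hN1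
  have hall : ∀ j < t, (S j).isSome := fun j hj => (hS j).2 hj
  have hη0 : 0 ≤ η := thr_nonneg
  have hT := hJ.minLoad_le_mul hq0 hall hη0
  -- the threshold is small, since the LPT schedule is also subject to the bound `1.7`
  have h1 : N * η ≤ 6.8 * (minLoad q t S + η) := by
    obtain ⟨L, -, -, hL⟩ := exists_lpt_schedule (m := m) hq0 t
    have h2 := hT L
    have h3 : N * η ≤ 2 * (2 * lptValue m q t) :=
      thr_le hN1 (mul_nonneg (by norm_num) (lptValue_nonneg hq0 t))
    rw [hL] at h2
    linarith
  have hw0 : 0 ≤ minLoad q t S := minLoad_nonneg hq0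
  have hw : minLoad q t S ≤ minLoad p t S :=
    minLoad_le_minLoad fun i => (minLoad_le q t S i).trans (load_mono (fun j hj => by
      rw [hq, sizes_of_lt hj]; exact rnd_le hN1 (hp j)) i)
  refine opt_le fun T => ?_
  have h2 : minLoad p t T ≤ (1 + 1 / N) * minLoad q t T := by
    obtain ⟨i, hi⟩ := exists_load_eq_minLoad q t T
    refine (minLoad_le p t T i).trans ?_
    rw [← hi, load, load, Finset.mul_sum]
    refine Finset.sum_le_sum fun j hj => ?_
    split_ifs
    · rw [hq, sizes_of_lt (Finset.mem_range.1 hj)]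
      exact le_rnd hN1
    · simp
  have h3 := hT T
  set w := minLoad q t S
  have hδ0 : (0 : ℝ) < 1 / N := by positivity
  have hδε : 50 * (1 / (N : ℝ)) ≤ ε := by
    rw [div_le_iff₀ hε] at hNε
    rw [mul_one_div, div_le_iff₀ hN0]
    linarith
  set δ := 1 / (N : ℝ)
  have hη' : η ≤ 6.8 * δ * (w + η) := by
    have : N * η * δ ≤ 6.8 * (w + η) * δ := by gcongr
    have hNδ : N * δ = 1 := mul_one_div_cancel hN0.ne'
    calc η = N * δ * η := by rw [hNδ, one_mul]
      _ ≤ _ := by linarith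
  have h4 : (1 + δ) * minLoad q t T ≤ (1 + δ) * (1.7 * (w + η)) := by gcongr
  have h5 : (1 + δ) * (1.7 * (w + η)) ≤ (1.7 + ε) * (w + η - 6.8 * δ * (w + η)) := by
    have h6 : 0 ≤ w + η := by linarith
    have h7 : (1 + δ) * 1.7 ≤ (1.7 + ε) * (1 - 6.8 * δ) := by
      have : δ * ε ≤ δ * 1 := by gcongr
      linarith
    calc (1 + δ) * (1.7 * (w + η)) = (1 + δ) * 1.7 * (w + η) := by ring
      _ ≤ (1.7 + ε) * (1 - 6.8 * δ) * (w + η) := by gcongr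
      _ = _ := by ring
  calc minLoad p t T ≤ (1.7 + ε) * (w + η - 6.8 * δ * (w + η)) := by linarith
    _ ≤ (1.7 + ε) * minLoad p t S := by
      gcongr
      linarith

end

/-! ### Polynomial running time on rational sizes -/

theorem bitLength_ratCast (x : ℚ) : bitLength (x : ℝ) = x.num.natAbs.size + x.den.size := by
  have h : ∃ y : ℚ, (y : ℝ) = x := ⟨x, rfl⟩
  have : h.choose = x := by exact_mod_cast h.choose_spec
  rw [bitLength, dif_pos h, this]

/-- `x` is a rational number with a denominator of at most `K` bits and absolute value at most
`2 ^ K`. -/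
def Short (K : ℕ) (x : ℝ) : Prop :=
  ∃ D : ℕ, 0 < D ∧ D ≤ 2 ^ K ∧ (∃ a : ℤ, x * D = a) ∧ |x| ≤ 2 ^ K

theorem Short.bitLength_le {K : ℕ} {x : ℝ} (h : Short K x) : bitLength x ≤ 3 * K + 2 := by
  obtain ⟨D, hD, hDK, ⟨a, ha⟩, hx⟩ := h
  have hD' : (D : ℝ) ≠ 0 := by positivity
  obtain ⟨y, rfl⟩ : ∃ y : ℚ, (y : ℝ) = x := ⟨a / D, by push_cast; rw [← ha]; field_simp⟩
  have hy : y = Rat.divInt a D := by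
    rw [Rat.divInt_eq_div, eq_div_iff (by exact_mod_cast hD.ne')]
    exact_mod_cast ha
  have hden : y.den ≤ D := by
    have : (y.den : ℤ) ∣ (D : ℤ) := by rw [hy]; exact Rat.den_dvd a D
    exact Nat.le_of_dvd hD (by exact_mod_cast this)
  have hnum : y.num.natAbs ≤ 2 ^ (2 * K) := by
    have h1 : |(y.num : ℝ)| = |(y : ℝ)| * y.den := by
      have h2 : (y.num : ℝ) = y * y.den := by exact_mod_cast (Rat.mul_den_eq_num y).symm
      rw [h2, abs_mul, Nat.abs_cast]
    have h2 : |(y.num : ℝ)| ≤ 2 ^ (2 * K) := by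
      rw [h1, two_mul, pow_add]
      have : (y.den : ℝ) ≤ 2 ^ K := by exact_mod_cast hden.trans hDK
      gcongr
    have h3 : ((y.num.natAbs : ℕ) : ℝ) = |(y.num : ℝ)| := by rw [Nat.cast_natAbs]; simp
    rw [← h3] at h2
    exact_mod_cast h2
  rw [bitLength_ratCast]
  have h4 : y.num.natAbs.size ≤ 2 * K + 1 :=
    Nat.size_le.2 (hnum.trans_lt (Nat.pow_lt_pow_right (by norm_num) (by omega)))
  have h5 : y.den.size ≤ K + 1 :=
    Nat.size_le.2 ((hden.trans hDK).trans_lt (Nat.pow_lt_pow_right (by norm_num) (by omega)))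
  omega

theorem Short.opCost_le {s : ℕ} {x y : ℝ} (hx : Short (4 * s) x) (hy : Short (4 * s) y) :
    opCost x y ≤ (24 * s + 5) ^ 2 := by
  have h1 := hx.bitLength_le
  have h2 := hy.bitLength_le
  exact Nat.pow_le_pow_left (by omega) 2

theorem Short.natCast {K : ℕ} {k : ℕ} (h : k ≤ 2 ^ K) : Short K (k : ℝ) :=
  ⟨1, by norm_num, Nat.one_le_two_pow, ⟨k, by push_cast; ring⟩, by
    rw [Nat.abs_cast]; exact_mod_cast h⟩

theorem exists_int_zpow_mul {e : ℤ} {k : ℕ} (h : -(k : ℤ) ≤ e) :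
    ∃ a : ℤ, (2 : ℝ) ^ e * 2 ^ k = a := by
  refine ⟨2 ^ (e + k).toNat, ?_⟩
  rw [← zpow_natCast, ← zpow_add₀ (by norm_num)]
  push_cast
  rw [← zpow_natCast, Int.toNat_of_nonneg (by omega)]

section

variable {N s : ℕ} {x : ℝ}

/-- A rational size whose numerator and denominator have at most `s` bits. -/
def ShortSize (s : ℕ) (x : ℝ) : Prop :=
  ∃ a d : ℕ, 0 < d ∧ a < 2 ^ s ∧ d < 2 ^ s ∧ x * d = a

theorem shortSize_of_bitLength_le {y : ℚ} (hy : (0 : ℝ) ≤ y) (h : bitLength (y : ℝ) ≤ s) :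
    ShortSize s (y : ℝ) := by
  rw [bitLength_ratCast] at h
  have hy' : 0 ≤ y := by exact_mod_cast hy
  refine ⟨y.num.natAbs, y.den, y.pos, Nat.size_le.1 (by omega), Nat.size_le.1 (by omega), ?_⟩
  have h1 : (y : ℝ) * y.den = y.num := by exact_mod_cast Rat.mul_den_eq_num y
  have h2 : ((y.num.natAbs : ℕ) : ℤ) = y.num := Int.natAbs_of_nonneg (Rat.num_nonneg.2 hy')
  rw [h1, ← h2]
  simp

theorem ShortSize.le (hx : ShortSize s x) : x ≤ 2 ^ s := by
  obtain ⟨a, d, hd, ha, -, h⟩ := hx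
  have hd' : (1 : ℝ) ≤ d := by exact_mod_cast hd
  have ha' : (a : ℝ) ≤ 2 ^ s := by exact_mod_cast ha.le
  by_contra! hlt
  have : (0 : ℝ) < 2 ^ s := by positivity
  nlinarith

theorem ShortSize.log_bounds (hx : ShortSize s x) (h0 : 0 < x) :
    -(s : ℤ) ≤ Int.log 2 x ∧ Int.log 2 x ≤ s := by
  obtain ⟨a, d, hd, ha, hds, h⟩ := id hx
  constructor
  · have h1 := Int.lt_zpow_succ_log_self (R := ℝ) (b := 2) (by norm_num) x
    push_cast at h1
    have hd0 : (0 : ℝ) < d := by exact_mod_cast hd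
    have ha1 : (1 : ℝ) ≤ a := by
      have : 0 < a := by
        rcases Nat.eq_zero_or_pos a with rfl | h'
        · have : 0 < x * d := by positivity
          rw [h] at this
          simp at this
        · exact h'
      exact_mod_cast this
    have h2 : (2 : ℝ) ^ (-(s : ℤ)) < 2 ^ (Int.log 2 x + 1) := by
      refine lt_of_le_of_lt ?_ h1
      rw [zpow_neg, zpow_natCast, inv_le_iff_one_le_mul₀ (by positivity)]
      have : (d : ℝ) ≤ 2 ^ s := by exact_mod_cast hds.le
      calc (1 : ℝ) ≤ a := ha1
        _ = d * x := by rw [← h]; ring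
        _ ≤ 2 ^ s * x := by gcongr
        _ = x * 2 ^ s := mul_comm _ _
    have := (zpow_lt_zpow_iff_right₀ (by norm_num : (1 : ℝ) < 2)).1 h2
    omega
  · have h1 := Int.zpow_log_le_self (R := ℝ) (b := 2) (by norm_num) h0
    push_cast at h1
    have h2 : (2 : ℝ) ^ Int.log 2 x ≤ 2 ^ (s : ℤ) := by
      rw [zpow_natCast]; exact h1.trans hx.le
    exact (zpow_le_zpow_iff_right₀ (by norm_num : (1 : ℝ) < 2)).1 h2

theorem roundCheap_of_shortSize (hN : 1 ≤ N) (hNs : N < 2 ^ s) (hx : ShortSize s x) (h0 : 0 ≤ x) :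
    RoundCheap N x ((24 * s + 5) ^ 2) := by
  have hN0 : (0 : ℝ) < N := by exact_mod_cast hN
  have hpow : ∀ k, k ≤ 4 → 2 ^ (k * s) ≤ 2 ^ (4 * s) := fun k hk =>
    Nat.pow_le_pow_right (by norm_num) (by gcongr)
  have hs : (2 : ℕ) ^ s ≤ 2 ^ (4 * s) := by simpa using hpow 1 (by norm_num)
  have hsR : (2 : ℝ) ^ s ≤ 2 ^ (4 * s) := by exact_mod_cast hs
  have hxs := hx.le
  obtain ⟨a, d, hd, ha, hds, hxd⟩ := id hx
  have hd0 : (0 : ℝ) < d := by exact_mod_cast hd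
  have hprod : ∀ {u v : ℕ}, u < 2 ^ s → v ≤ 2 ^ s → u * v ≤ 2 ^ (4 * s) := fun hu hv =>
    (Nat.mul_le_mul hu.le hv).trans (by
      rw [← pow_add, ← two_mul]; exact hpow 2 (by norm_num))
  have hsx : Short (4 * s) x :=
    ⟨d, hd, hds.le.trans hs, ⟨a, by exact_mod_cast hxd⟩, by rw [abs_of_nonneg h0]; linarith⟩
  have hsN : Short (4 * s) (N : ℝ) := Short.natCast (hNs.le.trans hs)
  have hs0 : Short (4 * s) (0 : ℝ) := by
    simpa using Short.natCast (K := 4 * s) (k := 0) (by positivity)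
  rcases h0.eq_or_lt with rfl | hpos
  -- for `x = 0` the operands are those that arise from the junk value `Int.log 2 0 = 0`
  · have hs1 : Short (4 * s) (1 : ℝ) := by
      simpa using Short.natCast (K := 4 * s) (k := 1) Nat.one_le_two_pow
    have hb : (2 : ℝ) ^ Int.log 2 (0 : ℝ) = 1 := by simp
    have hr : ((0 : ℝ) - 1) / (1 / N) = -N := by field_simp; norm_num
    have hf : ((⌊((0 : ℝ) - 1) / (1 / N)⌋ : ℤ) : ℝ) = -N := by
      rw [hr]
      have : (-(N : ℝ)) = ((-(N : ℤ) : ℤ) : ℝ) := by push_cast; ring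
      rw [this, Int.floor_intCast]
    have hneg : ∀ {y : ℝ}, Short (4 * s) y → Short (4 * s) (-y) := by
      rintro y ⟨D, h1, h2, ⟨b, hb⟩, h4⟩
      exact ⟨D, h1, h2, ⟨-b, by push_cast; rw [← hb]; ring⟩, by rwa [abs_neg]⟩
    have hg : Short (4 * s) (1 / (N : ℝ)) :=
      ⟨N, hN, hNs.le.trans hs, ⟨1, by push_cast; field_simp⟩, by
        rw [abs_of_pos (by positivity)]
        have h1 : (1 : ℝ) / N ≤ 1 := by
          rw [div_le_one hN0]; exact_mod_cast hN
        exact h1.trans (one_le_pow₀ (by norm_num))⟩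
    have hm1 : ((0 : ℝ) - 1) = -1 := by norm_num
    refine ⟨hs0.opCost_le hs0, ?_, ?_, ?_, ?_, ?_, ?_⟩
    · rw [hb]; exact hs1.opCost_le hsN
    · rw [hb]; exact hs0.opCost_le hs1
    · rw [hb, hm1]; exact (hneg hs1).opCost_le hg
    · rw [hb, hr]; exact (hneg hsN).opCost_le hs0
    · rw [hb, hf]; exact (hneg hsN).opCost_le hg
    · rw [hb, hf]
      have : -(N : ℝ) * (1 / N) = -1 := by field_simp
      rw [this]
      exact hs1.opCost_le (hneg hs1)
  obtain ⟨he1, he2⟩ := hx.log_bounds hpos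
  have hle : (2 : ℝ) ^ Int.log 2 x ≤ x := by
    simpa using Int.zpow_log_le_self (R := ℝ) (b := 2) (by norm_num) hpos
  have hlt : x < (2 : ℝ) ^ Int.log 2 x * 2 := by
    have := Int.lt_zpow_succ_log_self (R := ℝ) (b := 2) (by norm_num) x
    rwa [zpow_add_one₀ (by norm_num), Nat.cast_ofNat] at this
  obtain ⟨u, hu⟩ := exists_int_zpow_mul he1
  obtain ⟨v, hv⟩ := exists_int_zpow_mul (e := -Int.log 2 x) (k := s) (by omega)
  rw [zpow_neg] at hv
  have hb0 : (0 : ℝ) < (2 : ℝ) ^ Int.log 2 x := by positivity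
  set b := (2 : ℝ) ^ Int.log 2 x with hb
  have hg0 : 0 < b / N := by positivity
  set r := (x - b) / (b / N) with hr
  have hrg : r * (b / N) = x - b := div_mul_cancel₀ _ hg0.ne'
  have hr0 : 0 ≤ r := div_nonneg (by linarith) hg0.le
  have hrN : r ≤ N := by
    rw [hr, div_le_iff₀ hg0, mul_div_cancel₀ _ hN0.ne']
    linarith
  have hNR : (N : ℝ) ≤ 2 ^ (4 * s) := by exact_mod_cast hNs.le.trans hs
  have hf0 : (0 : ℝ) ≤ ⌊r⌋ := by exact_mod_cast Int.floor_nonneg.2 hr0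
  have hfr := Int.floor_le r
  have hsb : Short (4 * s) b :=
    ⟨2 ^ s, by positivity, hs, ⟨u, by push_cast; exact hu⟩, by rw [abs_of_pos hb0]; linarith⟩
  have hsd : Short (4 * s) (x - b) :=
    ⟨d * 2 ^ s, by positivity, hprod hds le_rfl, ⟨a * 2 ^ s - u * d, by
      push_cast; rw [← hxd, ← hu]; ring⟩, by rw [abs_of_nonneg (by linarith)]; linarith⟩
  have hbN : b / N ≤ b := div_le_self hb0.le (by exact_mod_cast hN)
  have hsg : Short (4 * s) (b / N) :=
    ⟨N * 2 ^ s, by positivity, hprod hNs le_rfl, ⟨u, by push_cast; rw [← hu]; field_simp⟩, by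
      rw [abs_of_pos hg0]; linarith⟩
  have hsr : Short (4 * s) r :=
    ⟨d * 2 ^ s, by positivity, hprod hds le_rfl, ⟨(a * v - d * 2 ^ s) * N, by
      push_cast; rw [← hxd, ← hv, hr]; field_simp⟩, by rw [abs_of_nonneg hr0]; linarith⟩
  have hsf : Short (4 * s) (⌊r⌋ : ℝ) :=
    ⟨1, by norm_num, Nat.one_le_two_pow, ⟨⌊r⌋, by simp⟩, by rw [abs_of_nonneg hf0]; linarith⟩
  have hfg : ⌊r⌋ * (b / N) ≤ x - b := hrg ▸ mul_le_mul_of_nonneg_right hfr hg0.le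
  have hsz : Short (4 * s) (⌊r⌋ * (b / N)) :=
    ⟨N * 2 ^ s, by positivity, hprod hNs le_rfl, ⟨⌊r⌋ * u, by push_cast; rw [← hu]; field_simp⟩, by
      rw [abs_of_nonneg (by positivity)]; linarith⟩
  exact ⟨hsx.opCost_le hs0, hsb.opCost_le hsN, hsx.opCost_le hsb, hsd.opCost_le hsg,
    hsr.opCost_le hs0, hsf.opCost_le hsg, hsb.opCost_le hsz⟩

/-- Rounded sizes are multiples of `1 / (N * 2 ^ s)`. -/
theorem exists_int_rnd (hN : 1 ≤ N) (hx : ShortSize s x) :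
    ∃ a : ℤ, rnd N x * (N * 2 ^ s) = a := by
  rcases le_or_gt x 0 with h0 | h0
  · exact ⟨0, by rw [rnd_of_nonpos h0]; simp⟩
  · have hN0 : (N : ℝ) ≠ 0 := by positivity
    obtain ⟨k, -, hk, -⟩ := rnd_of_pos hN h0
    obtain ⟨u, hu⟩ := exists_int_zpow_mul (hx.log_bounds h0).1
    refine ⟨u * (N + k), ?_⟩
    push_cast
    rw [hk, ← hu]
    field_simp

end

section

variable {m N n s : ℕ} {p : ℕ → ℝ}

/-- Sums of rounded sizes: multiples of `1 / (N * 2 ^ s)` between `0` and `2 ^ (2 * s)`. -/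
theorem sum_sizes_short (hN : 1 ≤ N) (hn : n ≤ s) (hp : ∀ j < n, 0 ≤ p j ∧ ShortSize s (p j))
    {A : Finset ℕ} (hA : A ⊆ Finset.range n) :
    (∃ a : ℤ, (∑ j ∈ A, sizes N n p j) * (N * 2 ^ s) = a) ∧ 0 ≤ ∑ j ∈ A, sizes N n p j ∧
      ∑ j ∈ A, sizes N n p j ≤ 2 ^ (2 * s) := by
  refine ⟨?_, Finset.sum_nonneg fun j _ => sizes_nonneg hN j, ?_⟩
  · have : ∀ j, ∃ a : ℤ, sizes N n p j * (N * 2 ^ s) = a := fun j => by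
      by_cases hj : j < n
      · rw [sizes_of_lt hj]; exact exists_int_rnd hN (hp j hj).2
      · exact ⟨0, by simp [sizes, hj]⟩
    choose a ha using this
    exact ⟨∑ j ∈ A, a j, by rw [Finset.sum_mul]; push_cast; exact Finset.sum_congr rfl fun j _ => ha j⟩
  · calc ∑ j ∈ A, sizes N n p j ≤ A.card • (2 : ℝ) ^ s := Finset.sum_le_card_nsmul _ _ _ fun j hj => by
          have hj := Finset.mem_range.1 (hA hj)
          rw [sizes_of_lt hj]
          exact (rnd_le hN (hp j hj).1).trans (hp j hj).2.le
      _ ≤ 2 ^ s * 2 ^ s := by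
          rw [nsmul_eq_mul]
          have h1 : A.card ≤ n := by simpa using Finset.card_le_card hA
          have h2 : A.card ≤ 2 ^ s := h1.trans (hn.trans Nat.lt_two_pow_self.le)
          have h3 : (A.card : ℝ) ≤ 2 ^ s := by exact_mod_cast h2
          gcongr
      _ = 2 ^ (2 * s) := by ring

variable [NeZero m]

theorem lptValue_short (hN : 1 ≤ N) (hn : n ≤ s) (hp : ∀ j < n, 0 ≤ p j ∧ ShortSize s (p j)) :
    (∃ a : ℤ, lptValue m (sizes N n p) n * (N * 2 ^ s) = a) ∧ 0 ≤ lptValue m (sizes N n p) n ∧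
      lptValue m (sizes N n p) n ≤ 2 ^ (2 * s) := by
  obtain ⟨S, -, -, hS⟩ := exists_lpt_schedule (m := m) (sizes_nonneg (N := N) (n := n) (p := p) hN) n
  obtain ⟨i, hi⟩ := exists_load_eq_minLoad (sizes N n p) n S
  rw [← hS, ← hi, load_eq_sum_filter]
  exact sum_sizes_short hN hn hp (Finset.filter_subset _ _)

theorem thrAt_short (hN : 1 ≤ N) (hNs : N < 2 ^ s) (hn : n ≤ s)
    (hp : ∀ j < n, 0 ≤ p j ∧ ShortSize s (p j)) :
    (∃ a : ℤ, thrAt m N n p * 2 ^ (3 * s) = a) ∧ thrAt m N n p ≤ 4 * 2 ^ (2 * s) := by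
  obtain ⟨⟨a, ha⟩, h0, hle⟩ := lptValue_short (m := m) hN hn hp
  have hN1 : (1 : ℝ) ≤ N := by exact_mod_cast hN
  have hN0 : (0 : ℝ) < N := by linarith
  have hNR : (N : ℝ) ≤ 2 ^ s := by exact_mod_cast hNs.le
  refine ⟨?_, ?_⟩
  · unfold thrAt
    generalize lptValue m (sizes N n p) n = τ at *
    rw [thr]
    split_ifs with hτ
    · exact ⟨0, by simp⟩
    · have hτ0 : 0 < τ := by linarith
      have ha1 : (1 : ℝ) ≤ a := by
        have : (0 : ℝ) < a := by rw [← ha]; positivity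
        exact_mod_cast (by exact_mod_cast this : 0 < a)
      have h2 : (2 : ℝ) ^ (-((3 * s : ℕ) : ℤ)) ≤ 2 ^ Int.clog 2 (2 * τ / N) := by
        refine le_trans ?_ (by
          simpa using Int.self_le_zpow_clog (R := ℝ) (b := 2) (by norm_num) (2 * τ / N))
        rw [zpow_neg, zpow_natCast, inv_le_iff_one_le_mul₀ (by positivity)]
        calc (1 : ℝ) ≤ τ * (N * 2 ^ s) := by rw [ha]; exact ha1
          _ ≤ τ * (2 ^ s * 2 ^ s) := by gcongr
          _ = 2 ^ (2 * s) * 2 ^ s * (τ / 2 ^ s) := by field_simp; ring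
          _ ≤ 2 ^ (2 * s) * 2 ^ s * (2 * τ / N) := by
              gcongr
              linarith
          _ = 2 * τ / N * 2 ^ (3 * s) := by ring
      have h3 := (zpow_le_zpow_iff_right₀ (by norm_num : (1 : ℝ) < 2)).1 h2
      exact exists_int_zpow_mul h3
  · have h1 := thr_le hN (UB := 2 * lptValue m (sizes N n p) n) (by linarith)
    have h2 : 0 ≤ thrAt m N n p := thr_nonneg
    have h3 : thrAt m N n p ≤ N * thrAt m N n p := le_mul_of_one_le_left h2 hN1
    unfold thrAt at *
    linarith

theorem onlineCheap_of_short (hN : 1 ≤ N) (hNs : N < 2 ^ s) (hs : 2 ≤ s) (hn : n ≤ s)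
    (hp : ∀ j < n, 0 ≤ p j ∧ ShortSize s (p j)) :
    OnlineCheap m N n p ((24 * s + 5) ^ 2) := by
  have hN1 : (1 : ℝ) ≤ N := by exact_mod_cast hN
  have hN0 : (0 : ℝ) < N := by linarith
  have hpow : ∀ {k}, k ≤ 4 → 2 ^ (k * s) ≤ 2 ^ (4 * s) := fun {k} hk =>
    Nat.pow_le_pow_right (by norm_num) (by gcongr)
  have h8 : (8 : ℝ) * 2 ^ (2 * s) ≤ 2 ^ (4 * s) := by
    have h1 : (2 : ℝ) ^ 4 ≤ 2 ^ (2 * s) := pow_le_pow_right₀ (by norm_num) (by omega)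
    calc (8 : ℝ) * 2 ^ (2 * s) ≤ 2 ^ (2 * s) * 2 ^ (2 * s) := by gcongr; linarith
      _ = 2 ^ (4 * s) := by ring
  have h20 : (0 : ℝ) < 2 ^ (2 * s) := by positivity
  have hN2 : N * 2 ^ s ≤ 2 ^ (2 * s) := by
    rw [two_mul, pow_add]; gcongr
  have hN3 : N * (N * 2 ^ s) ≤ 2 ^ (3 * s) := by
    have : 3 * s = s + 2 * s := by ring
    rw [this, pow_add]; gcongr
  have hN4 : N * 2 ^ (3 * s) ≤ 2 ^ (4 * s) := by
    have : 4 * s = s + 3 * s := by ring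
    rw [this, pow_add]; gcongr
  have hs0 : Short (4 * s) (0 : ℝ) := by
    simpa using Short.natCast (K := 4 * s) (k := 0) (by positivity)
  have hs2 : Short (4 * s) (2 : ℝ) := by
    refine Short.natCast (K := 4 * s) (k := 2) ?_
    calc 2 = 2 ^ 1 := rfl
      _ ≤ 2 ^ (4 * s) := Nat.pow_le_pow_right (by norm_num) (by omega)
  have hsN : Short (4 * s) (N : ℝ) :=
    Short.natCast (hNs.le.trans (by simpa using hpow (k := 1) (by norm_num)))
  obtain ⟨⟨a, ha⟩, h0, hle⟩ := lptValue_short (m := m) hN hn hp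
  obtain ⟨⟨c, hc⟩, hth⟩ := thrAt_short (m := m) hN hNs hn hp
  have hth0 : 0 ≤ thrAt m N n p := thr_nonneg
  have hsτ : Short (4 * s) (lptValue m (sizes N n p) n) :=
    ⟨N * 2 ^ s, by positivity, hN2.trans (hpow (by norm_num)), ⟨a, by push_cast; exact ha⟩, by
      rw [abs_of_nonneg h0]; linarith⟩
  have hsUB : Short (4 * s) (2 * lptValue m (sizes N n p) n) :=
    ⟨N * 2 ^ s, by positivity, hN2.trans (hpow (by norm_num)),
      ⟨2 * a, by push_cast; rw [← ha]; ring⟩, by rw [abs_of_nonneg (by linarith)]; linarith⟩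
  have hsq : Short (4 * s) (2 * lptValue m (sizes N n p) n / N) :=
    ⟨N * (N * 2 ^ s), by positivity, hN3.trans (hpow (by norm_num)),
      ⟨2 * a, by push_cast; rw [← ha]; field_simp⟩, by
        rw [abs_of_nonneg (by positivity)]
        have : 2 * lptValue m (sizes N n p) n / N ≤ 2 * lptValue m (sizes N n p) n :=
          div_le_self (by linarith) hN1
        linarith⟩
  have hop : ∀ x ∈ operands (sizes N n p) n (thrAt m N n p), Short (4 * s) x := by
    rintro x ⟨A, hA, B, hB, e, he, rfl⟩
    obtain ⟨⟨a₁, h₁⟩, hA0, hA1⟩ := sum_sizes_short hN hn hp hA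
    obtain ⟨⟨a₂, h₂⟩, hB0, hB1⟩ := sum_sizes_short hN hn hp hB
    have he' : (∃ c : ℤ, e * 2 ^ (3 * s) = c) ∧ 0 ≤ e ∧ e ≤ 4 * 2 ^ (2 * s) := by
      rcases he with rfl | rfl
      · exact ⟨⟨0, by simp⟩, le_rfl, by positivity⟩
      · exact ⟨⟨c, hc⟩, hth0, hth⟩
    obtain ⟨⟨c', hc'⟩, he0, he1⟩ := he'
    refine ⟨N * 2 ^ (3 * s), by positivity, hN4,
      ⟨a₁ * 2 ^ (2 * s) - a₂ * 2 ^ (2 * s) + N * c', ?_⟩, ?_⟩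
    · push_cast
      rw [← h₁, ← h₂, ← hc']
      have : (2 : ℝ) ^ (3 * s) = 2 ^ s * 2 ^ (2 * s) := by ring
      rw [this]
      ring
    · rw [abs_le]
      constructor <;> linarith
  exact ⟨fun j hj => roundCheap_of_shortSize hN hNs (hp j hj).2 (hp j hj).1, hs2.opCost_le hsτ,
    hsUB.opCost_le hs0, hsUB.opCost_le hsN, hsq.opCost_le hs0,
    fun x hx y hy => (hop x hx).opCost_le (hop y hy)⟩

end

/-- Functions given by a polynomial with natural coefficients. -/
def IsPoly (f : ℕ → ℕ) : Prop := ∃ P : Polynomial ℕ, ∀ s, P.eval s = f s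

theorem IsPoly.id : IsPoly fun s => s := ⟨Polynomial.X, fun s => by simp⟩

theorem IsPoly.const (c : ℕ) : IsPoly fun _ => c := ⟨Polynomial.C c, fun s => by simp⟩

theorem IsPoly.add {f g : ℕ → ℕ} (hf : IsPoly f) (hg : IsPoly g) : IsPoly fun s => f s + g s := by
  obtain ⟨P, hP⟩ := hf
  obtain ⟨Q, hQ⟩ := hg
  exact ⟨P + Q, fun s => by rw [Polynomial.eval_add, hP, hQ]⟩

theorem IsPoly.mul {f g : ℕ → ℕ} (hf : IsPoly f) (hg : IsPoly g) : IsPoly fun s => f s * g s := by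
  obtain ⟨P, hP⟩ := hf
  obtain ⟨Q, hQ⟩ := hg
  exact ⟨P * Q, fun s => by rw [Polynomial.eval_mul, hP, hQ]⟩

theorem isPoly_onlineCost : IsPoly fun s => onlineCost s s ((24 * s + 5) ^ 2) := by
  simp only [onlineCost, lptCost, iterCost, tailCost, listCost, pushCost, shedIterCost, leastCost,
    extremeCost, minLoadCost, loadCost, sq]
  repeat' first
    | exact IsPoly.id
    | exact IsPoly.const _
    | apply IsPoly.add
    | apply IsPoly.mul

theorem onlineCost_mono {m m' n n' κ κ' : ℕ} (hm : m ≤ m') (hn : n ≤ n') (hκ : κ ≤ κ') :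
    onlineCost m n κ ≤ onlineCost m' n' κ' := by
  simp only [onlineCost, lptCost, iterCost, tailCost, listCost, pushCost, shedIterCost, leastCost,
    extremeCost, minLoadCost, loadCost]
  gcongr

theorem exists_polynomial_time : ∃ P : Polynomial ℕ,
    ∀ (N m : ℕ) (p : ℕ → ℝ) (t : ℕ) (S : Sched m) (ω : ℕ → ℕ),
      2 ≤ N → 1 ≤ m → (∀ j, 0 ≤ p j) → IsSchedule t S →
      ∃ (S' : Sched m) (T : ℕ), Halts N p t S ω S' T ∧ IsSchedule (t + 1) S' ∧
        ((∀ j, ∃ x : ℚ, p j = (x : ℝ)) → T ≤ P.eval (inputSize m N p t)) := by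
  obtain ⟨P, hP⟩ := isPoly_onlineCost
  refine ⟨P, fun N m p t S ω hN hm hp hS => ?_⟩
  have : NeZero m := ⟨by omega⟩
  have hrun : ∀ κ, OnlineCheap m N (t + 1) p κ → ∃ (S' : Sched m) (T : ℕ),
      Halts N p t S ω S' T ∧ IsSchedule (t + 1) S' ∧ T ≤ onlineCost m (t + 1) κ := fun κ hκ => by
    obtain ⟨S', r, h1, h2, h3⟩ :=
      (onlineJump_spec (cap := 2 * (t + 1) + 2) (by omega) hκ hS (by omega)).total ⟨0, ω⟩
    exact ⟨S', r.time, ⟨_, r, h1, rfl⟩, h3.1, by simpa using h2⟩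
  by_cases hrat : ∀ j, ∃ x : ℚ, p j = (x : ℝ)
  · set s := inputSize m N p t with hs
    have hsum : ∀ j < t + 1, bitLength (p j) ≤ s := fun j hj => by
      have := Finset.single_le_sum (f := fun j => 1 + bitLength (p j))
        (fun _ _ => Nat.zero_le _) (Finset.mem_range.2 hj)
      rw [hs, inputSize]
      omega
    have hts : t + 1 ≤ s := by
      have : ∑ j ∈ Finset.range (t + 1), 1 ≤ ∑ j ∈ Finset.range (t + 1), (1 + bitLength (p j)) :=
        Finset.sum_le_sum fun j _ => by omega
      rw [Finset.sum_const, Finset.card_range, smul_eq_mul, mul_one] at this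
      rw [hs, inputSize]
      omega
    have hms : m ≤ s := by rw [hs, inputSize]; omega
    have hNs : N.size ≤ s := by rw [hs, inputSize]; omega
    have hs2 : 2 ≤ s := le_trans (Nat.lt_size.2 (by simpa using hN)) hNs
    obtain ⟨S', T, h1, h2, h3⟩ := hrun _ (onlineCheap_of_short (m := m) (by omega)
      (Nat.size_le.1 hNs) hs2 hts fun j hj => ⟨hp j, by
        obtain ⟨y, hy⟩ := hrat j
        have h4 := hsum j hj
        have h5 := hp j
        rw [hy] at h4 h5 ⊢
        exact shortSize_of_bitLength_le h5 h4⟩)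
    exact ⟨S', T, h1, h2, fun _ => h3.trans ((onlineCost_mono hms hts le_rfl).trans (hP s).ge)⟩
  · obtain ⟨κ, hκ⟩ := exists_onlineCheap m N (t + 1) p
    obtain ⟨S', T, h1, h2, -⟩ := hrun κ hκ
    exact ⟨S', T, h1, h2, fun h => absurd h hrat⟩

/-! ### The lower bound on the migration factor -/

section

variable {m N t : ℕ} {p : ℕ → ℝ}

theorem rnd_eq_self {e : ℤ} {k : ℕ} (hk : k < N) :
    rnd N ((2 : ℝ) ^ e * ((N + k) / N)) = (2 : ℝ) ^ e * ((N + k) / N) := by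
  have hN : (0 : ℝ) < N := by exact_mod_cast (Nat.zero_le k).trans_lt hk
  have hkN : (k : ℝ) < N := by exact_mod_cast hk
  have he : (0 : ℝ) < (2 : ℝ) ^ e := by positivity
  have hx : (0 : ℝ) < (2 : ℝ) ^ e * ((N + k) / N) := by positivity
  have hlog : Int.log 2 ((2 : ℝ) ^ e * ((N + k) / N)) = e := by
    refine le_antisymm ?_ ?_
    · refine Int.lt_add_one_iff.1 ((Int.lt_zpow_iff_log_lt (by norm_num) hx).1 ?_)
      rw [Nat.cast_ofNat, zpow_add_one₀ (by norm_num)]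
      gcongr
      rw [div_lt_iff₀ hN]
      linarith
    · refine (Int.zpow_le_iff_le_log (by norm_num) hx).1 ?_
      rw [Nat.cast_ofNat]
      refine le_mul_of_one_le_right he.le ?_
      rw [le_div_iff₀ hN]
      linarith [Nat.cast_nonneg (α := ℝ) k]
  rw [rnd, if_neg (not_le.2 hx), hlog]
  have : ((2 : ℝ) ^ e * ((N + k) / N) - 2 ^ e) / (2 ^ e / N) = (k : ℤ) := by
    push_cast
    field_simp
    ring
  rw [this, Int.floor_intCast]
  push_cast
  field_simp

theorem sizes_eq_self {n : ℕ} (hr : ∀ j < n, rnd N (p j) = p j) {j : ℕ} (hj : j < n) :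
    sizes N n p j = p j := by
  rw [sizes_of_lt hj, hr j hj]

theorem thrAt_mul_le {c : ℝ} [NeZero m] (hN : 1 ≤ N) {n : ℕ}
    (h : lptValue m (sizes N n p) n ≤ c) : N * thrAt m N n p ≤ 4 * c := by
  have h1 : N * thrAt m N n p ≤ 2 * (2 * lptValue m (sizes N n p) n) :=
    thr_le hN (mul_nonneg (by norm_num) (lptValue_nonneg (sizes_nonneg hN) n))
  linarith

theorem Poss.exists_step {cap : ℕ} {S : Sched m} {X : Sched m → Prop}
    (h : Poss (onlineJump cap N p t S) X) : ∃ S', Step N p t S S' ∧ X S' := by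
  obtain ⟨S', hS', hX⟩ := h
  obtain ⟨ω, hω⟩ := hS' fun _ => 0
  obtain ⟨s, hs⟩ := hω 0
  exact ⟨S', ⟨ω, s, cap, _, hs, rfl⟩, hX⟩

theorem insertBig_nil_poss {q : ℕ → ℝ} {n cap : ℕ} {h : ℝ} {S SB : Sched m} {Qs : List ℕ}
    {X : Sched m × List ℕ → Prop} (hX : X (S, Qs)) :
    Poss (insertBig q n h (cap + 1) S SB [] Qs) X := by
  rw [insertBig]
  exact (tick_spec 1).poss.bind fun _ _ => Poss.pure hX

variable {n : ℕ} {q : ℕ → ℝ} {h : ℝ} {S SB S' SB' : Sched m} {QB Qs Q R : List ℕ} {j : ℕ}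
  {i : Fin m}

theorem Iteration.shed_eq_nil (hI : Iteration q n h S SB QB j i Q R S' SB')
    (hbig : ∀ j < n, h ≤ q j) : R = [] := by
  refine List.eq_nil_iff_forall_not_mem.2 fun k hk => ?_
  have h1 := hI.shed.mem k hk
  linarith [hbig k h1.1]

/-- A job that is pushed on a machine without smaller jobs does not displace any job. -/
theorem Iteration.push_eq_nil (hI : Iteration q n h S SB QB j i Q R S' SB') (hq : ∀ j, 0 ≤ q j)
    (hle : ∀ k < n, SB k = some i → q j ≤ q k) : Q = [] := by
  refine List.eq_nil_iff_forall_not_mem.2 fun k hk => ?_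
  have h1 := hI.push.mem k hk
  linarith [hI.push.lt hq hI.least hk, hle k h1.1 h1.2]

theorem bigOf_eq_self (hS : ∀ j, n ≤ j → S j = none) (hbig : ∀ j < n, h ≤ q j) :
    bigOf q n h S = S := by
  funext j
  unfold bigOf
  split_ifs with hj
  · rfl
  · rw [hS j]
    by_contra! hjn
    exact hj ⟨hjn, not_lt.2 (hbig j hjn)⟩

theorem IsSchedule.eq_none (hS : IsSchedule t S) (hj : t ≤ j) : S j = none := by
  have := (hS j).not.2 (not_lt.2 hj)
  simpa using this

/-- If no job is small and the least loaded machine `i` only has jobs that are at least as large as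
the new job, the new job may be put on `i`, without migration. -/
theorem IsSchedule.step_update [NeZero m] (hN : 1 ≤ N)
    (hr : ∀ j < t + 1, rnd N (p j) = p j) (hS : IsSchedule t S)
    (hbig : ∀ j < t + 1, thrAt m N (t + 1) p ≤ p j)
    (hi : ∀ i', load p (t + 1) S i ≤ load p (t + 1) S i')
    (hle : ∀ k < t, S k = some i → p t ≤ p k) :
    Step N p t S (Function.update S t (some i)) := by
  obtain ⟨κ, hκ⟩ := exists_onlineCheap m N (t + 1) p
  have hq0 : ∀ j, 0 ≤ sizes N (t + 1) p j := sizes_nonneg hN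
  have hbig' : ∀ j < t + 1, thrAt m N (t + 1) p ≤ sizes N (t + 1) p j := fun j hj => by
    rw [sizes_eq_self hr hj]
    exact hbig j hj
  have ht := hbig' t (Nat.lt_succ_self t)
  have hload : ∀ i', load (sizes N (t + 1) p) (t + 1) S i' = load p (t + 1) S i' := fun i' =>
    load_congr (fun j hj => sizes_eq_self hr hj) fun _ _ => Iff.rfl
  have hbo := bigOf_eq_self (S := S) (fun j (hj : t + 1 ≤ j) => hS.eq_none (by omega)) hbig'
  have hL := LoopState.init (n := t + 1) hS rfl ht
  rw [hbo] at hL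
  suffices Poss (onlineJump (t + 3) N p t S) (fun S' => S' = Function.update S t (some i)) by
    obtain ⟨S', h1, rfl⟩ := this.exists_step
    exact h1
  refine onlineJump_poss hN hκ ht ?_
  rw [hbo]
  refine insertBig_poss (i := i) hq0 hκ.ops hL (by simp) (by omega) ?_ ?_
  · exact le_antisymm (le_minLoad fun i' => by rw [hload, hload]; exact hi i') (minLoad_le _ _ _ _)
  intro j Q R S' SB' hI
  have hj : j = t := List.mem_singleton.1 hI.mem
  subst hj
  have hR := hI.shed_eq_nil hbig'
  have hQ : Q = [] := hI.push_eq_nil hq0 fun k hk hki => by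
    have hkt : k < j := (hS k).1 (by simp [hki])
    rw [sizes_eq_self hr hk, sizes_eq_self hr (Nat.lt_succ_self j)]
    exact hle k hkt hki
  subst hR hQ
  rw [List.erase_cons_head, List.nil_append]
  refine insertBig_nil_poss ⟨rfl, ?_⟩
  funext k
  have h1 := hI.shed.eq k
  have h2 := hI.push.eq k
  simp only [List.not_mem_nil, if_false, overwrite] at h1 h2
  change S' k = _
  rw [h1, Function.update_apply, h2]
  split_ifs with h3 h4 h4
  · rfl
  · rfl
  · exact absurd ⟨by omega, not_lt.2 (hbig' k (by omega))⟩ h3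
  · rfl

end

/-! #### A long chain of displacements -/

/-- The sizes of the instance with a long chain of displacements, in units of `1 / N`. In decreasing
order come job `0`, which gets a machine for itself, the jobs `1, …, m - 1`, which are put on one
machine each, and the jobs `m, …, 2 * m - 2`, such that job `2 * m - 1 - i` joins job `i`. Then all
machines have about the same load, and the last job `2 * m - 1` is slightly larger than job `m`. -/
def chainSize (N m j : ℕ) : ℕ :=
  if j = 0 then 2 * ((3 * N + 1) / 2 + (m - 1))
  else if j < m then 2 * (N + (m - 1 - j))
  else if j < 2 * m - 1 then N + 2 * (2 * m - 1 - j)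
  else N + 2 * m

/-- The schedule of the first `k` jobs of the instance with a long chain of displacements. -/
def chainSched (m k : ℕ) [NeZero m] : Sched m :=
  fun j => if j < k then some (Fin.ofNat m (if j < m then j else 2 * m - 1 - j)) else none

section

variable {m N k n j : ℕ} [NeZero m] {i : Fin m}

theorem chainSched_eq_some (hk : k ≤ 2 * m - 1) :
    chainSched m k j = some i ↔ j < k ∧ (j = i ∨ j + i = 2 * m - 1) := by
  have hi := i.isLt
  unfold chainSched
  by_cases hj : j < k
  · rw [if_pos hj, Option.some_inj, Fin.ext_iff, Fin.val_ofNat]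
    split_ifs with hjm
    · rw [Nat.mod_eq_of_lt hjm]
      omega
    · rw [Nat.mod_eq_of_lt (by omega)]
      omega
  · simp [hj]

theorem isSchedule_chainSched : IsSchedule k (chainSched m k) := fun j => by
  unfold chainSched
  split_ifs with h <;> simp [h]

theorem load_chainSched (p : ℕ → ℝ) (hk : k ≤ 2 * m - 1) (hn : k ≤ n) :
    load p n (chainSched m k) i =
      (if (i : ℕ) < k then p i else 0) + if 2 * m - 1 - i < k then p (2 * m - 1 - i) else 0 := by
  have hi := i.isLt
  have h1 : ∀ a, (if a < k then p a else 0) =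
      ∑ j ∈ Finset.range n, if j = a then (if j < k then p j else 0) else 0 := fun a => by
    rw [Finset.sum_ite_eq']
    by_cases h : a < k
    · rw [if_pos (Finset.mem_range.2 (by omega))]
    · simp [h]
  rw [h1, h1, ← Finset.sum_add_distrib]
  refine Finset.sum_congr rfl fun j _ => ?_
  by_cases hj : j < k
  · by_cases ha : j = i
    · have hb : j ≠ 2 * m - 1 - i := by omega
      rw [if_pos ((chainSched_eq_some hk).2 ⟨hj, Or.inl ha⟩), if_pos ha, if_neg hb, if_pos hj,
        add_zero]
    · by_cases hb : j = 2 * m - 1 - i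
      · rw [if_pos ((chainSched_eq_some hk).2 ⟨hj, Or.inr (by omega)⟩), if_neg ha, if_pos hb,
          if_pos hj, zero_add]
      · rw [if_neg fun h => ?_, if_neg ha, if_neg hb, add_zero]
        have := (chainSched_eq_some hk).1 h
        omega
  · have : ¬chainSched m k j = some i := fun h => hj ((chainSched_eq_some hk).1 h).1
    simp [hj, this]

theorem chainSched_succ (hk : k < 2 * m - 1) (hi : k = i ∨ k + i = 2 * m - 1) :
    chainSched m (k + 1) = Function.update (chainSched m k) k (some i) := by
  funext j
  rw [Function.update_apply]
  split_ifs with hj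
  · exact (chainSched_eq_some (by omega)).2 ⟨by omega, by omega⟩
  · unfold chainSched
    have : j < k + 1 ↔ j < k := by omega
    simp only [this]

/-- The load of `chainSched` in units of `1 / N`. -/
theorem load_chainSched_chainSize (hk : k ≤ 2 * m - 1) (hn : k ≤ n) :
    load (fun j => (chainSize N m j : ℝ) / N) n (chainSched m k) i =
      (((if (i : ℕ) < k then chainSize N m i else 0) +
        if 2 * m - 1 - i < k then chainSize N m (2 * m - 1 - i) else 0 : ℕ) : ℝ) / N := by
  rw [load_chainSched _ hk hn]
  push_cast
  rw [add_div, ite_div, ite_div, zero_div]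

end

section

variable {m N : ℕ}

theorem rnd_chainSize (hm : 2 * m + 1 ≤ N) (hN : 2 ≤ N) (j : ℕ) :
    rnd N ((chainSize N m j : ℝ) / N) = (chainSize N m j : ℝ) / N := by
  have h : ∃ k < N, chainSize N m j = N + k ∨ chainSize N m j = 2 * (N + k) := by
    unfold chainSize
    split_ifs
    · exact ⟨(3 * N + 1) / 2 + (m - 1) - N, by omega, Or.inr (by omega)⟩
    · exact ⟨m - 1 - j, by omega, Or.inr (by omega)⟩
    · exact ⟨2 * (2 * m - 1 - j), by omega, Or.inl (by omega)⟩
    · exact ⟨2 * m, by omega, Or.inl (by omega)⟩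
  obtain ⟨k, hk, h | h⟩ := h
  · have := rnd_eq_self (N := N) (e := 0) hk
    rw [zpow_zero, one_mul] at this
    rw [h, Nat.cast_add, this]
  · have := rnd_eq_self (N := N) (e := 1) hk
    rw [zpow_one, ← mul_div_assoc] at this
    rw [h, Nat.cast_mul, Nat.cast_add, Nat.cast_ofNat, this]

theorem le_chainSize (j : ℕ) : N ≤ chainSize N m j := by
  unfold chainSize
  split_ifs <;> omega

theorem chainSize_le (hm : 2 * m + 1 ≤ N) (j : ℕ) : chainSize N m j ≤ 4 * N := by
  unfold chainSize
  split_ifs <;> omega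

theorem one_le_chainSize_div (hN : 1 ≤ N) (j : ℕ) : 1 ≤ (chainSize N m j : ℝ) / N := by
  rw [le_div_iff₀ (by exact_mod_cast hN), one_mul]
  exact_mod_cast le_chainSize j

/-- None of the jobs of the instance is ever small. -/
theorem thrAt_chainSize_le [NeZero m] (hm : 2 * m + 1 ≤ N) (hN : 32 ≤ N) {n : ℕ}
    (hn : n ≤ 2 * m) (j : ℕ) :
    thrAt m N n (fun j => (chainSize N m j : ℝ) / N) ≤ (chainSize N m j : ℝ) / N := by
  refine le_trans ?_ (one_le_chainSize_div (by omega) j)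
  have hN0 : (0 : ℝ) < N := by exact_mod_cast (by omega : 0 < N)
  have hm0 : (0 : ℝ) < m := by exact_mod_cast NeZero.pos m
  have hN' : (32 : ℝ) ≤ N := by exact_mod_cast hN
  have hq0 := sizes_nonneg (N := N) (n := n) (p := fun j => (chainSize N m j : ℝ) / N) (by omega)
  have h1 : lptValue m (sizes N n fun j => (chainSize N m j : ℝ) / N) n ≤ 8 := by
    obtain ⟨L, -, -, hL⟩ := exists_lpt_schedule (m := m) hq0 n
    rw [← hL]
    have h2 : (m : ℝ) * minLoad (sizes N n fun j => (chainSize N m j : ℝ) / N) n L ≤ n * 4 :=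
      calc _ = ∑ _i : Fin m, minLoad (sizes N n fun j => (chainSize N m j : ℝ) / N) n L := by simp
        _ ≤ ∑ i, load (sizes N n fun j => (chainSize N m j : ℝ) / N) n L i :=
          Finset.sum_le_sum fun i _ => minLoad_le _ _ _ i
        _ ≤ ∑ j ∈ Finset.range n, sizes N n (fun j => (chainSize N m j : ℝ) / N) j :=
          sum_load_le hq0
        _ ≤ ∑ j ∈ Finset.range n, 4 := Finset.sum_le_sum fun j hj => by
          rw [sizes_eq_self (fun j _ => rnd_chainSize hm (by omega) j) (Finset.mem_range.1 hj),
            div_le_iff₀ hN0]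
          exact_mod_cast chainSize_le hm j
        _ = n * 4 := by simp
    have h3 : (n : ℝ) ≤ 2 * m := by exact_mod_cast hn
    exact le_of_mul_le_mul_left (by linarith) hm0
  have h2 := thrAt_mul_le (by omega) h1
  exact le_of_mul_le_mul_left (by linarith) hN0

theorem reaches_chainSched [NeZero m] (hm : 2 * m + 1 ≤ N) (hN : 32 ≤ N) {k : ℕ}
    (hk : k ≤ 2 * m - 1) :
    Reaches N (fun j => (chainSize N m j : ℝ) / N) k (chainSched m k) := by
  have hm0 := NeZero.pos m
  have hN0 : (0 : ℝ) < N := by exact_mod_cast (by omega : 0 < N)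
  induction k with
  | zero =>
    have : chainSched m 0 = fun _ => none := by funext j; simp [chainSched]
    rw [this]
    exact Reaches.zero
  | succ k ih =>
    refine (ih (by omega)).succ ?_
    obtain ⟨i, hi⟩ : ∃ i : Fin m, (i : ℕ) = if k < m then k else 2 * m - 1 - k :=
      ⟨⟨if k < m then k else 2 * m - 1 - k, by split_ifs <;> omega⟩, rfl⟩
    rw [chainSched_succ (i := i) (by omega) (by split_ifs at hi <;> omega)]
    refine isSchedule_chainSched.step_update (by omega)
      (fun j _ => rnd_chainSize hm (by omega) j) (fun j _ => thrAt_chainSize_le hm hN (by omega) j)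
      (fun i' => ?_) fun l hl hli => ?_
    · have hi' := i'.isLt
      rw [load_chainSched_chainSize (by omega) (by omega),
        load_chainSched_chainSize (by omega) (by omega)]
      gcongr ?_ / _
      rw [Nat.cast_le]
      unfold chainSize
      grind
    · rw [chainSched_eq_some (by omega)] at hli
      gcongr ?_ / _
      rw [Nat.cast_le]
      unfold chainSize
      grind

end

section

variable {m N : ℕ}

/-- The jobs that are pushed in turn on the arrival of job `2 * m - 1`; for `r > 0`, the job
`chainJob m r` has been displaced by `chainJob m (r - 1)`. -/
def chainJob (m r : ℕ) : ℕ := if r = 0 then 2 * m - 1 else m + r - 1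

theorem chainSize_chainJob {r : ℕ} (hr : r < m) :
    chainSize N m (chainJob m r) = N + 2 * (m - r) := by
  unfold chainSize chainJob
  grind

/-- The situation after `r` pushes: the machines `0, …, m - 1 - r` are untouched, the load of the
others exceeds theirs, and the jobs `m, …, m + r - 1` have left their machines. -/
structure ChainState [NeZero m] (N r : ℕ) (q : ℕ → ℝ) (SB : Sched m) : Prop where
  untouched : ∀ j (i : Fin m), (i : ℕ) < m - r →
    (SB j = some i ↔ chainSched m (2 * m - 1) j = some i)
  full : ∀ i : Fin m, m - r ≤ (i : ℕ) → (chainSize N m 0 : ℝ) / N ≤ load q (2 * m) SB i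
  left : ∀ s (i : Fin m), s < r → (i : ℕ) + s + 1 = m → SB (m + s) ≠ some i

variable [NeZero m] {q : ℕ → ℝ} {h : ℝ} {r j : ℕ} {S SB S' SB' : Sched m} {Q R Qs : List ℕ}
  {i : Fin m}

theorem ChainState.load_eq (hS : ChainState N r q SB)
    (hq : ∀ j < 2 * m, q j = (chainSize N m j : ℝ) / N) (hi : (i : ℕ) < m - r) :
    load q (2 * m) SB i =
      ((chainSize N m i + if (i : ℕ) = 0 then 0 else chainSize N m (2 * m - 1 - i) : ℕ) : ℝ) /
        N := by
  rw [load_congr (T := chainSched m (2 * m - 1)) hq fun j _ => hS.untouched j i hi,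
    load_chainSched_chainSize le_rfl (by omega), if_pos (by omega)]
  congr 3
  split_ifs <;> first | rfl | omega

/-- The next machine to be used is the last untouched one. -/
theorem ChainState.least (hS : ChainState N r q SB)
    (hq : ∀ j < 2 * m, q j = (chainSize N m j : ℝ) / N) (hi : (i : ℕ) + r + 1 = m) :
    load q (2 * m) SB i = minLoad q (2 * m) SB := by
  refine le_antisymm (le_minLoad fun i' => ?_) (minLoad_le _ _ _ _)
  have h' := i'.isLt
  rw [hS.load_eq hq (by omega)]
  by_cases hi' : (i' : ℕ) < m - r
  · rw [hS.load_eq hq hi']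
    gcongr ?_ / _
    rw [Nat.cast_le]
    unfold chainSize
    grind
  · refine le_trans ?_ (hS.full i' (by omega))
    gcongr ?_ / _
    rw [Nat.cast_le]
    unfold chainSize
    grind

theorem ChainState.left_push (hS : ChainState N r q SB) (hi : (i : ℕ) + r + 1 = m)
    (hP : PushResult q (2 * m) SB i (chainJob m r) Q SB') {s : ℕ} {i' : Fin m} (hs : s < r)
    (hi' : (i' : ℕ) + s + 1 = m) : SB' (m + s) ≠ some i' := by
  rw [hP.eq]
  split_ifs
  · rw [Ne, Option.some_inj, Fin.ext_iff]
    omega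
  · simp
  · exact hS.left s i' hs hi'

/-- A push on a machine with two jobs displaces the second one. -/
theorem ChainState.next (hS : ChainState N r q SB) (hN : 2 * m + 1 ≤ N) (hq0 : ∀ j, 0 ≤ q j)
    (hq : ∀ j < 2 * m, q j = (chainSize N m j : ℝ) / N) (hr : r + 1 < m)
    (hi : (i : ℕ) + r + 1 = m) (hj : SB (chainJob m r) = none)
    (hP : PushResult q (2 * m) SB i (chainJob m r) Q SB') :
    Q = [chainJob m (r + 1)] ∧ ChainState N (r + 1) q SB' := by
  have hN0 : (0 : ℝ) < N := by exact_mod_cast (by omega : 0 < N)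
  have hx : chainJob m r < 2 * m := by unfold chainJob; split_ifs <;> omega
  have hqx : q (chainJob m r) = ((N + 2 * (m - r) : ℕ) : ℝ) / N := by
    rw [hq _ hx, chainSize_chainJob (by omega)]
  have hqk : q (m + r) = ((N + 2 * (m - r - 1) : ℕ) : ℝ) / N := by
    rw [hq _ (by omega)]
    congr 2
    unfold chainSize
    grind
  have hload : load q (2 * m) SB i = ((3 * N + 2 * (m - 1) : ℕ) : ℝ) / N := by
    rw [hS.load_eq hq (by omega)]
    congr 2
    unfold chainSize
    grind
  have hkj : m + r ≠ chainJob m r := by unfold chainJob; split_ifs <;> omega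
  have hki : SB (m + r) = some i :=
    (hS.untouched _ _ (by omega)).2
      ((chainSched_eq_some (k := 2 * m - 1) le_rfl).2 ⟨by omega, by omega⟩)
  have hself := hP.load_self
  have hsub : ∀ k ∈ Q, k = m + r := fun k hk => by
    have h1 := (chainSched_eq_some (k := 2 * m - 1) le_rfl).1
      ((hS.untouched k i (by omega)).1 (hP.mem k hk).2)
    by_contra hne
    have h2 : k = i := by omega
    have h3 := hP.lt hq0 (hS.least hq hi) hk
    rw [h2, hqx, hq _ (by omega), div_lt_div_iff_of_pos_right hN0, Nat.cast_lt] at h3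
    unfold chainSize at h3
    grind
  have hQ : Q = [m + r] := by
    by_cases hmem : m + r ∈ Q
    · exact List.perm_singleton.1 ((List.perm_ext_iff_of_nodup hP.nodup (List.nodup_singleton _)).2
        fun k => ⟨fun hk => List.mem_singleton.2 (hsub k hk), fun hk => by
          rwa [List.mem_singleton.1 hk]⟩)
    · have hnil : Q = [] := List.eq_nil_iff_forall_not_mem.2 fun k hk => hmem (hsub k hk ▸ hk)
      -- without the second job, the machine still has a larger load than machine `i - 1`
      have h1 := hP.opt (m + r) (by omega) (by rw [hP.eq, if_neg hkj, if_neg hmem, hki])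
      obtain ⟨i', hi'⟩ : ∃ i' : Fin m, (i' : ℕ) + r + 2 = m :=
        ⟨⟨m - r - 2, by omega⟩, by simp; omega⟩
      have h2 := minLoad_le q (2 * m) SB' i'
      rw [hP.load_other i' (by rw [Ne, Fin.ext_iff]; omega), hS.load_eq hq (by omega)] at h2
      rw [hnil, List.map_nil, List.sum_nil, sub_zero] at hself
      have h3 := h1.trans h2
      rw [hself, hload, hqx, hqk, ← add_div, ← sub_div, div_le_div_iff_of_pos_right hN0,
        sub_le_iff_le_add, ← Nat.cast_add, ← Nat.cast_add, Nat.cast_le] at h3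
      unfold chainSize at h3
      grind
  have hnext : chainJob m (r + 1) = m + r := by simp [chainJob, ← add_assoc]
  refine ⟨by rw [hnext, hQ], fun k i' hi' => ?_, fun i' hi' => ?_, fun s i' hs hi' => ?_⟩
  · rw [← hS.untouched k i' (by omega), hP.eq, hQ]
    have hne : i ≠ i' := by rw [Ne, Fin.ext_iff]; omega
    by_cases hk : k = chainJob m r
    · simp [hk, hj, hne]
    · by_cases hk' : k = m + r
      · simp [hk', hkj, hki, hne]
      · simp [hk, hk']
  · by_cases hii : i' = i
    · rw [hii, hself, hQ, hload, List.map_singleton, List.sum_singleton, hqx, hqk, ← add_div,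
        ← sub_div]
      gcongr ?_ / _
      rw [le_sub_iff_add_le]
      norm_cast
      unfold chainSize
      grind
    · rw [hP.load_other i' hii]
      refine hS.full i' ?_
      have : (i' : ℕ) ≠ i := fun h => hii (Fin.ext h)
      omega
  · by_cases hsr : s = r
    · rw [hsr, hP.eq, if_neg hkj, hQ]
      simp
    · exact hS.left_push hi hP (by omega) hi'

/-- The chain ends on machine `0`, which has only one job. -/
theorem ChainState.last (hS : ChainState N r q SB) (hN : 2 * m + 1 ≤ N) (hq0 : ∀ j, 0 ≤ q j)
    (hq : ∀ j < 2 * m, q j = (chainSize N m j : ℝ) / N) (hr : r + 1 = m) (hi : (i : ℕ) = 0)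
    (hI : Iteration q (2 * m) h S SB [chainJob m r] j i Q R S' SB') : Q = [] := by
  have hN0 : (0 : ℝ) < N := by exact_mod_cast (by omega : 0 < N)
  refine hI.push_eq_nil hq0 fun k hk hki => ?_
  have h1 := (chainSched_eq_some (k := 2 * m - 1) le_rfl).1 ((hS.untouched k i (by omega)).1 hki)
  have h2 : k = 0 := by omega
  have hx : chainJob m r < 2 * m := by unfold chainJob; split_ifs <;> omega
  rw [List.mem_singleton.1 hI.mem, h2, hq _ hx, hq 0 (by omega), chainSize_chainJob (by omega)]
  gcongr ?_ / _
  rw [Nat.cast_le]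
  unfold chainSize
  grind

theorem ChainState.insertBig_poss {κ : ℕ} (hq0 : ∀ j, 0 ≤ q j) (hm : 2 ≤ m)
    (hN : 2 * m + 1 ≤ N) (hq : ∀ j < 2 * m, q j = (chainSize N m j : ℝ) / N)
    (hc : Cheap q (2 * m) h κ)
    (hbig : ∀ j < 2 * m, h ≤ q j) {d cap : ℕ} (hrd : r + d + 1 = m) (hcap : 2 * m + d < cap)
    (hL : LoopState q (2 * m) h S SB [chainJob m r] []) (hS : ChainState N r q SB) :
    Poss (insertBig q (2 * m) h (cap + 1) S SB [chainJob m r] []) fun z => z.2 = [] ∧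
      ∀ s (i : Fin m), s + 1 < m → (i : ℕ) + s + 1 = m → z.1 (m + s) ≠ some i := by
  induction d generalizing r cap S SB with
  | zero =>
    refine MachineCovering.insertBig_poss (i := ⟨0, by omega⟩) hq0 hc hL (by simp) (by omega)
      (hS.least hq (by simp; omega)) fun j Q R S' SB' hI => ?_
    have hQ := hS.last hN hq0 hq (by omega) rfl hI
    have hR := hI.shed_eq_nil hbig
    have hj := List.mem_singleton.1 hI.mem
    have hL' := hL.next hI
    subst hQ hR hj
    rw [List.erase_cons_head, List.nil_append] at hL' ⊢
    obtain ⟨cap, rfl⟩ : ∃ c, cap = c + 1 := ⟨cap - 1, by omega⟩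
    refine insertBig_nil_poss ⟨rfl, fun s i' hs hi' => ?_⟩
    change S' (m + s) ≠ some i'
    rw [hL'.big (m + s) (by omega) (hbig _ (by omega))]
    exact hS.left_push (by simp; omega) hI.push (by omega) hi'
  | succ d ih =>
    refine MachineCovering.insertBig_poss (i := ⟨m - 1 - r, by omega⟩) hq0 hc hL (by simp)
      (by omega) (hS.least hq (by simp; omega)) fun j Q R S' SB' hI => ?_
    have hR := hI.shed_eq_nil hbig
    have hj := List.mem_singleton.1 hI.mem
    have hL' := hL.next hI
    subst hR hj
    obtain ⟨hQ, hS'⟩ := hS.next hN hq0 hq (by omega) (by simp; omega)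
      ((hL.memB _).1 hI.mem).2.2 hI.push
    subst hQ
    rw [List.erase_cons_head, List.append_nil, List.nil_append] at hL' ⊢
    obtain ⟨cap, rfl⟩ : ∃ c, cap = c + 1 := ⟨cap - 1, by omega⟩
    exact ih (by omega) (by omega) hL' hS'

end

theorem exists_migration_of_le {N : ℕ} (hN : 32 ≤ N) :
    ∃ (m : ℕ) (p : ℕ → ℝ) (t : ℕ) (S S' : Sched m), 1 ≤ m ∧ (∀ j, 0 < p j) ∧
      Reaches N p t S ∧ Step N p t S S' ∧ 1 / 4000 * N * p t ≤ migrated p t S S' := by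
  obtain ⟨m, hm⟩ : ∃ m, m = (N - 1) / 2 := ⟨_, rfl⟩
  obtain ⟨t, ht⟩ : ∃ t, t + 1 = 2 * m := ⟨2 * m - 1, by omega⟩
  have : NeZero m := ⟨by omega⟩
  have hmN : 2 * m + 1 ≤ N := by omega
  have hN0 : (0 : ℝ) < N := by exact_mod_cast (by omega : 0 < N)
  obtain ⟨p, hp⟩ : ∃ p : ℕ → ℝ, p = fun j => (chainSize N m j : ℝ) / N := ⟨_, rfl⟩
  have hp1 : ∀ j, 1 ≤ p j := fun j => hp ▸ one_le_chainSize_div (by omega) j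
  have hS : Reaches N p t (chainSched m t) := hp ▸ reaches_chainSched hmN hN (by omega)
  obtain ⟨κ, hκ⟩ := exists_onlineCheap m N (t + 1) p
  have hops := hκ.ops
  have hq : ∀ j < 2 * m, sizes N (2 * m) p j = (chainSize N m j : ℝ) / N := fun j hj => by
    rw [hp, sizes_eq_self (fun j _ => rnd_chainSize hmN (by omega) j) hj]
  have hbig : ∀ j < 2 * m, thrAt m N (2 * m) p ≤ sizes N (2 * m) p j := fun j hj => by
    rw [hq j hj, hp]
    exact thrAt_chainSize_le hmN hN le_rfl j
  have hq0 : ∀ j, 0 ≤ sizes N (2 * m) p j := sizes_nonneg (by omega)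
  have hlt : thrAt m N (t + 1) p ≤ sizes N (t + 1) p t := by
    rw [ht]
    exact hbig t (by omega)
  have hL := LoopState.init (S := chainSched m t) (n := t + 1) isSchedule_chainSched rfl hlt
  have hbo : bigOf (sizes N (2 * m) p) (2 * m) (thrAt m N (2 * m) p) (chainSched m t) =
      chainSched m t :=
    bigOf_eq_self (fun j hj => IsSchedule.eq_none (t := t) isSchedule_chainSched (by omega)) hbig
  have hjob : chainJob m 0 = t := by simp only [chainJob, if_true]; omega
  obtain ⟨S', hstep, hS'⟩ : ∃ S', Step N p t (chainSched m t) S' ∧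
      ∀ s (i : Fin m), s + 1 < m → (i : ℕ) + s + 1 = m → S' (m + s) ≠ some i := by
    refine Poss.exists_step (cap := 3 * m + 1) (onlineJump_poss (by omega) hκ hlt ?_)
    rw [ht] at hL hops ⊢
    rw [hbo, ← hjob] at hL ⊢
    have htm : t = 2 * m - 1 := by omega
    refine ChainState.insertBig_poss (d := m - 1) (r := 0) hq0 (by omega) hmN hq hops hbig
      (by omega) (by omega) hL ⟨fun j i _ => by rw [hjob, htm], fun i hi => ?_, fun s i hs => ?_⟩
    · have := i.isLt
      omega
    · omega
  refine ⟨m, p, t, chainSched m t, S', by omega, fun j => by linarith [hp1 j], hS, hstep, ?_⟩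
  have h1 : ((m - 1 : ℕ) : ℝ) ≤ migrated p t (chainSched m t) S' := by
    calc ((m - 1 : ℕ) : ℝ) = ∑ j ∈ Finset.Ico m t, 1 := by
          rw [Finset.sum_const, Nat.card_Ico, nsmul_one]
          congr 1
          omega
      _ ≤ ∑ j ∈ Finset.Ico m t, if chainSched m t j = S' j then 0 else p j := by
          refine Finset.sum_le_sum fun j hj => ?_
          rw [Finset.mem_Ico] at hj
          obtain ⟨i, hi⟩ : ∃ i : Fin m, (i : ℕ) = 2 * m - 1 - j :=
            ⟨⟨2 * m - 1 - j, by omega⟩, rfl⟩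
          have h2 := hS' (j - m) i (by omega) (by omega)
          rw [Nat.add_sub_cancel' hj.1] at h2
          rw [(chainSched_eq_some (i := i) (by omega)).2 ⟨hj.2, Or.inr (by omega)⟩,
            if_neg (Ne.symm h2)]
          exact hp1 j
      _ ≤ migrated p t (chainSched m t) S' := by
          refine Finset.sum_le_sum_of_subset_of_nonneg (fun j hj => ?_) fun j _ _ => ?_
          · rw [Finset.mem_Ico] at hj
            exact Finset.mem_range.2 hj.2
          · split_ifs
            · exact le_rfl
            · linarith [hp1 j]
  have h2 : N * p t ≤ 2 * N := by
    rw [hp, mul_div_cancel₀ _ hN0.ne', ← hjob, chainSize_chainJob (by omega)]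
    exact_mod_cast (by omega : N + 2 * (m - 0) ≤ 2 * N)
  have h3 : (N : ℝ) ≤ 1000 * (m - 1 : ℕ) := by
    exact_mod_cast (by omega : N ≤ 1000 * (m - 1))
  linarith

/-! #### An instance for small `N` -/

/-- Sizes for which, on two machines, the arrival of job `2` brings jobs `0` and `1` together. -/
noncomputable def pairSize (j : ℕ) : ℝ := if j = 0 then 1 else if j = 1 then 1 / 4 else 16

theorem rnd_pairSize {N : ℕ} (hN : 1 ≤ N) (j : ℕ) : rnd N (pairSize j) = pairSize j := by
  have h : ∃ e : ℤ, pairSize j = (2 : ℝ) ^ e := by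
    unfold pairSize
    split_ifs
    exacts [⟨0, by norm_num⟩, ⟨-2, by norm_num⟩, ⟨4, by norm_num⟩]
  have hN0 : (N : ℝ) ≠ 0 := by exact_mod_cast (by omega : N ≠ 0)
  obtain ⟨e, he⟩ := h
  have := rnd_eq_self (N := N) (e := e) (k := 0) (by omega)
  rwa [Nat.cast_zero, add_zero, div_self hN0, mul_one, ← he] at this

theorem exists_reaches {m N : ℕ} (hN : 2 ≤ N) (hm : 1 ≤ m) {p : ℕ → ℝ} (hp : ∀ j, 0 ≤ p j)
    (t : ℕ) : ∃ S : Sched m, Reaches N p t S := by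
  have : NeZero m := ⟨by omega⟩
  obtain ⟨P, hP⟩ := exists_polynomial_time
  induction t with
  | zero => exact ⟨_, Reaches.zero⟩
  | succ t ih =>
    obtain ⟨S, hS⟩ := ih
    obtain ⟨S', T, h, -⟩ := hP N m p t S (fun _ => 0) hN hm hp (hS.jumpOpt (by omega)).1
    exact ⟨S', hS.succ ⟨_, T, h⟩⟩

theorem load_eq_of_sizes {m N n : ℕ} {p : ℕ → ℝ} (hr : ∀ j < n, rnd N (p j) = p j) (S : Sched m) :
    load (sizes N n p) n S = load p n S := by
  funext i
  exact load_congr (fun j hj => sizes_eq_self hr hj) fun _ _ => Iff.rfl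

theorem exists_migration_of_lt {N : ℕ} (hN : 2 ≤ N) (hN' : N < 32) :
    ∃ (m : ℕ) (p : ℕ → ℝ) (t : ℕ) (S S' : Sched m), 1 ≤ m ∧ (∀ j, 0 < p j) ∧
      Reaches N p t S ∧ Step N p t S S' ∧ 1 / 4000 * N * p t ≤ migrated p t S S' := by
  have hN2 : (2 : ℝ) ≤ N := by exact_mod_cast hN
  have hN32 : (N : ℝ) < 32 := by exact_mod_cast hN'
  have hpos : ∀ j, 0 < pairSize j := fun j => by unfold pairSize; split_ifs <;> norm_num
  have p0 : pairSize 0 = 1 := rfl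
  have p1 : pairSize 1 = 1 / 4 := rfl
  have p2 : pairSize 2 = 16 := rfl
  have hother : ∀ o : Option (Fin 2), ∃ i, o ≠ some i := fun o => by
    by_cases h : o = some 0
    · exact ⟨1, by simp [h]⟩
    · exact ⟨0, h⟩
  have hload2 : ∀ (S : Sched 2) i, load pairSize 2 S i =
      (if S 0 = some i then 1 else 0) + if S 1 = some i then 1 / 4 else 0 := fun S i => by
    simp [load, Finset.sum_range_succ, p0, p1]
  have hload3 : ∀ (S : Sched 2) i, load pairSize 3 S i =
      (if S 0 = some i then 1 else 0) + (if S 1 = some i then 1 / 4 else 0) +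
        if S 2 = some i then 16 else 0 := fun S i => by
    simp [load, Finset.sum_range_succ, p0, p1, p2]
  have hmin : ∀ n (S : Sched 2), minLoad (sizes N n pairSize) n S = minLoad pairSize n S :=
    fun n S => by
      unfold minLoad
      rw [load_eq_of_sizes (fun j _ => rnd_pairSize (by omega) j)]
  -- one machine does not get the largest job, and its load bounds the minimum load
  have hmin2 : ∀ S : Sched 2, minLoad pairSize 2 S ≤ 1 / 4 := fun S => by
    obtain ⟨i, hi⟩ := hother (S 0)
    refine (minLoad_le _ _ _ i).trans ?_
    rw [hload2, if_neg hi]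
    split_ifs <;> norm_num
  have hmin3 : ∀ S : Sched 2, minLoad pairSize 3 S ≤ 5 / 4 := fun S => by
    obtain ⟨i, hi⟩ := hother (S 2)
    refine (minLoad_le _ _ _ i).trans ?_
    rw [hload3, if_neg hi]
    split_ifs <;> norm_num
  have hthr : ∀ n c, (∀ S : Sched 2, minLoad pairSize n S ≤ c) → 0 ≤ c →
      thrAt 2 N n pairSize ≤ 2 * c := fun n c hc hc0 => by
    obtain ⟨L, -, -, hL⟩ := exists_lpt_schedule (m := 2)
      (sizes_nonneg (N := N) (n := n) (p := pairSize) (by omega)) n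
    have h1 := thrAt_mul_le (by omega) (hL ▸ hmin n L ▸ hc L)
    have h2 := thr_nonneg (N := N) (UB := 2 * lptValue 2 (sizes N n pairSize) n)
    have h3 : 2 * thrAt 2 N n pairSize ≤ N * thrAt 2 N n pairSize :=
      mul_le_mul_of_nonneg_right hN2 h2
    linarith
  have hopt : ∀ {n} {S : Sched 2}, Reaches N pairSize n S → ∀ k < n, ∀ i, S k = some i →
      load pairSize n S i - pairSize k ≤ minLoad pairSize n S + thrAt 2 N n pairSize :=
    fun {n S} h k hk i hi => by
      have h1 := (h.jumpOpt (by omega)).2 k hk i hi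
      rwa [load_eq_of_sizes (fun j _ => rnd_pairSize (by omega) j), hmin,
        sizes_eq_self (fun j _ => rnd_pairSize (by omega) j) hk] at h1
  obtain ⟨S', h3⟩ := exists_reaches (m := 2) hN (by omega) (fun j => (hpos j).le) 3
  obtain ⟨S, hS, hstep⟩ : ∃ S : Sched 2, Reaches N pairSize 2 S ∧ Step N pairSize 2 S S' := by
    cases h3 with
    | succ h1 h2 => exact ⟨_, h1, h2⟩
  refine ⟨2, pairSize, 2, S, S', by omega, hpos, hS, hstep, ?_⟩
  have hne : S 0 ≠ S 1 := fun h => by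
    obtain ⟨i, hi⟩ := Option.isSome_iff_exists.1 (((hS.jumpOpt (by omega)).1 0).2 (by omega))
    obtain ⟨i', hi'⟩ := hother (S 0)
    have h1 := hopt hS 1 (by omega) i (h ▸ hi)
    have h2 := minLoad_le pairSize 2 S i'
    rw [hload2, if_neg hi', if_neg (h ▸ hi')] at h2
    rw [hload2, if_pos hi, if_pos (h ▸ hi), p1] at h1
    linarith [hthr 2 _ hmin2 (by norm_num)]
  have heq : S' 0 = S' 1 := by
    have hsome := fun j => ((h3.jumpOpt (by omega)).1 j).2
    obtain ⟨i, hi⟩ := Option.isSome_iff_exists.1 (hsome 2 (by omega))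
    have halone : ∀ k < 2, S' k ≠ some i := fun k hk hki => by
      have h1 := hopt h3 k (by omega) i hki
      have h2 : pairSize k + 16 ≤ load pairSize 3 S' i := by
        rw [← p2]
        exact add_le_load (fun j => (hpos j).le) (by omega) (by omega) (by omega) hki hi
      linarith [hthr 3 _ hmin3 (by norm_num), hmin3 S']
    obtain ⟨a, ha⟩ := Option.isSome_iff_exists.1 (hsome 0 (by omega))
    obtain ⟨b, hb⟩ := Option.isSome_iff_exists.1 (hsome 1 (by omega))
    have h4 := halone 0 (by omega)
    have h5 := halone 1 (by omega)
    rw [ha, Ne, Option.some_inj] at h4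
    rw [hb, Ne, Option.some_inj] at h5
    rw [ha, hb]
    congr 1
    omega
  have h4 : 1 / 4 ≤ migrated pairSize 2 S S' := by
    simp only [migrated, Finset.sum_range_succ, Finset.sum_range_zero, zero_add, p0, p1]
    split_ifs with h5 h6
    · exact absurd (h5.trans (heq.trans h6.symm)) hne
    all_goals norm_num
  rw [p2]
  linarith

end MachineCovering

theorem theorem3 :
    ∃ (C c : ℝ) (P : Polynomial ℕ), 0 < C ∧ 0 < c ∧
      -- every run ends with a schedule, after polynomially many ticks if the sizes are rational
      (∀ (N m : ℕ) (p : ℕ → ℝ) (t : ℕ) (S : MachineCovering.Sched m) (ω : ℕ → ℕ),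
        2 ≤ N → 1 ≤ m → (∀ j, 0 ≤ p j) → MachineCovering.IsSchedule t S →
        ∃ (S' : MachineCovering.Sched m) (T : ℕ),
          MachineCovering.Halts N p t S ω S' T ∧
          MachineCovering.IsSchedule (t + 1) S' ∧
          ((∀ j, ∃ x : ℚ, p j = (x : ℝ)) → T ≤ P.eval (MachineCovering.inputSize m N p t))) ∧
      -- competitive ratio
      (∀ (ε : ℝ) (N m : ℕ) (p : ℕ → ℝ) (t : ℕ) (S : MachineCovering.Sched m),
        0 < ε → ε ≤ 1 → 2 ≤ N → C / ε ≤ N → 1 ≤ m → (∀ j, 0 ≤ p j) →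
        MachineCovering.Reaches N p t S →
        MachineCovering.opt p t m ≤ (1.7 + ε) * MachineCovering.minLoad p t S) ∧
      -- migration factor, upper bound
      (∀ (N m : ℕ) (p : ℕ → ℝ) (t : ℕ) (S S' : MachineCovering.Sched m),
        2 ≤ N → 1 ≤ m → (∀ j, 0 ≤ p j) →
        MachineCovering.Reaches N p t S → MachineCovering.Step N p t S S' →
        MachineCovering.migrated p t S S' ≤ C * N * p t) ∧
      -- migration factor, lower bound
      (∀ N : ℕ, 2 ≤ N →
        ∃ (m : ℕ) (p : ℕ → ℝ) (t : ℕ) (S S' : MachineCovering.Sched m),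
          1 ≤ m ∧ (∀ j, 0 < p j) ∧
          MachineCovering.Reaches N p t S ∧ MachineCovering.Step N p t S S' ∧
          c * N * p t ≤ MachineCovering.migrated p t S S') := by
  obtain ⟨P, hP⟩ := MachineCovering.exists_polynomial_time
  refine ⟨50, 1 / 4000, P, by norm_num, by norm_num, hP, ?_, ?_, ?_⟩
  · intro ε N m p t S hε hε1 hN hNε hm hp h
    have : NeZero m := ⟨by omega⟩
    exact MachineCovering.opt_le_of_reaches hε hε1 hN hNε hp h
  · intro N m p t S S' hN hm hp h hstep
    have : NeZero m := ⟨by omega⟩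
    exact MachineCovering.migrated_le_of_reaches hN hp h hstep
  · intro N hN
    rcases lt_or_ge N 32 with h | h
    · exact MachineCovering.exists_migration_of_lt hN h
    · exact MachineCovering.exists_migration_of_le h
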